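/- Let $\Omega=(0,1)\times(0,1)\times(-1,1)$ with coordinates $(x,y,z)$; all functions are periodic in $x,y,z$ (with periods $1,1,2$) and real-valued. Let $L^2_{\bar\sigma}(\Omega)$ be the closure in $L^2(\Omega)^2$ of the smooth periodic fields $v=(v_1,v_2)$, even in $z$, with $\operatorname{div}_H\bar v=0$, where $\operatorname{div}_H v=\partial_xv_1+\partial_yv_2$ and $\bar v=\frac12\int_{-1}^1v\,dz$, and let $\mathbb P_{\bar\sigma}$ be the hydrostatic Helmholtz projection onto it, extended to distributions as a Fourier multiplier. With $\Delta_H=\partial_x^2+\partial_y^2$ and $\Delta=\Delta_H+\partial_z^2$ let $$\text{(i)}\quad A=\nu(-\Delta)+\varepsilon(-\Delta)^{8/5},\ \ \varepsilon>0,\ \nu\ge 0,\qquad\text{or}\qquad\text{(ii)}\quad A=\nu(-\Delta)+\varepsilon(-\Delta_H)^{2},\ \ \varepsilon>0,\ \nu>0,$$ and let $a(k)$, $k\in\mathbb Z^3$, be its Fourier symbol. For $s\in\mathbb R$ let $D(A^s)$ be the space of all $v$ (fields or distributions, even in $z$) with $\mathbb P_{\bar\sigma}v=v$ and $\sum_k(1+a(k))^{2s}|\hat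 v(k)|^2<\infty$. Put $w(v)(x,y,z)=-\int_{-1}^z\operatorname{div}_Hv(x,y,\zeta)\,d\zeta$. Let $T\in(0,\infty)$, $v_0\in L^2_{\bar\sigma}(\Omega)$ and $f\in L^2(0,T;D(A^{-1/2}))$. Then there is a unique strong solution $$v\in L^2(0,T;D(A^{1/2}))\cap H^1(0,T;D(A^{-1/2}))$$ on all of $(0,T)$ of the hyper-viscous primitive equations $$\partial_tv+Av+\mathbb P_{\bar\sigma}\big(w(v)\partial_zv+v\cdot\nabla_Hv\big)=f\ \text{ in } D(A^{-1/2})\text{ for a.e. }t\in(0,T),\qquad v(0)=v_0 .$$ Its continuous representative lies in $C([0,T];L^2(\Omega)^2)$ and satisfies the energy equality $$\|v(t)\|_{L^2(\Omega)}^2+2\int_0^t\|A^{1/2}v(s)\|_{L^2(\Omega)}^2\,ds=\|v(0)\|_{L^2(\Omega)}^2+2\int_0^tf(s)\cdot v(s)\,ds,\qquad 0<t\le T,$$ where $f(s)\cdot v(s)$ denotes the duality pairing of $D(A^{-1/2})$ and $D(A^{1/2})$ that extends the $L^2(\Omega)$ inner product. -/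

import Mathlib

open MeasureTheory Set Filter Topology
open scoped ContDiff

noncomputable section

namespace HPE

/-! ### The domain and smooth periodic functions -/

/-- Points `(x, y, z)` of `ℝ³`. -/
abbrev Pt : Type := Fin 3 → ℝ

/-- Values of horizontal velocity fields. -/
abbrev V2 : Type := EuclideanSpace ℝ (Fin 2)

/-- Complexified values, in which Fourier coefficients live. -/
abbrev C2 : Type := EuclideanSpace ℂ (Fin 2)

/-- Frequencies `k ∈ ℤ³`. -/
abbrev Freq : Type := Fin 3 → ℤ

/-- `Ω = (0,1) × (0,1) × (-1,1)`. -/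
def Omega : Set Pt := {p | p 0 ∈ Ioo (0 : ℝ) 1 ∧ p 1 ∈ Ioo (0 : ℝ) 1 ∧ p 2 ∈ Ioo (-1 : ℝ) 1}

/-- The periods `1, 1, 2` of the three coordinates. -/
def period : Fin 3 → ℝ := ![1, 1, 2]

/-- Smooth functions that are periodic in all three directions. -/
def SmoothPeriodic {E : Type*} [NormedAddCommGroup E] [NormedSpace ℝ E] (φ : Pt → E) : Prop :=
  ContDiff ℝ ∞ φ ∧ ∀ (j : Fin 3) (p : Pt), φ (p + Pi.single j (period j)) = φ p

/-- The classical partial derivative `∂_j φ`. -/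
def partialDeriv {E : Type*} [NormedAddCommGroup E] [NormedSpace ℝ E] (j : Fin 3) (φ : Pt → E)
    (p : Pt) : E :=
  fderiv ℝ φ p (Pi.single j 1)

/-- The vertical average `½ ∫_{-1}^{1} v(x, y, ζ) dζ`, seen as a function of `(x, y, z)` that
does not depend on `z`. -/
def verticalMean (v : Pt → V2) (p : Pt) : V2 :=
  (1 / 2 : ℝ) • ∫ ζ in (-1 : ℝ)..1, v (Function.update p 2 ζ)

/-- Smooth periodic fields, even in `z`, whose vertical average is horizontally divergence free. -/
def IsSolenoidalTestField (v : Pt → V2) : Prop :=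
  SmoothPeriodic v ∧
  (∀ p : Pt, v (Function.update p 2 (-p 2)) = v p) ∧
  ∀ p : Pt, ∑ i : Fin 2, (partialDeriv i.castSucc (verticalMean v) p) i = 0

/-! ### `L²(Ω)²` and its solenoidal subspace -/

/-- The real Hilbert space `L²(Ω)²`. -/
abbrev L2 : Type := Lp V2 2 (volume.restrict Omega)

/-- `L²_σ̄(Ω)`: the closure in `L²(Ω)²` of the solenoidal test fields. -/
def L2sol : Set L2 :=
  closure {u : L2 | ∃ v : Pt → V2, IsSolenoidalTestField v ∧ (u : Pt → V2) =ᵐ[volume.restrict Omega] v}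

/-- `g` is the `j`-th weak derivative of `u` in the periodic sense. -/
def IsWeakDeriv (j : Fin 3) (u g : L2) : Prop :=
  ∀ φ : Pt → ℝ, SmoothPeriodic φ →
    ∫ p in Omega, partialDeriv j φ p • (u : Pt → V2) p = -∫ p in Omega, φ p • (g : Pt → V2) p

open Classical in
/-- The `j`-th weak derivative of `u` if there is one in `L²(Ω)²` (it is then unique),
otherwise `0`. -/
def weakDeriv (j : Fin 3) (u : L2) : L2 :=
  if h : ∃ g : L2, IsWeakDeriv j u g then h.choose else 0

/-! ### Fourier coefficients

Periodic vector fields and vector distributions are described by their Fourier coefficients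
`c : ℤ³ → ℂ²`, with respect to the functions `exp (i (2π k₁ x + 2π k₂ y + π k₃ z))`. -/

/-- The wave vector `ξ(k) = (2π k₁, 2π k₂, π k₃)`. -/
def wave (k : Freq) (j : Fin 3) : ℝ := 2 * Real.pi / period j * (k j : ℝ)

/-- Fourier coefficients `½ ∫_Ω exp (-i ξ(k)·p) u(p) dp` (note `|Ω| = 2`). -/
def fourierCoeff (u : Pt → V2) (k : Freq) : C2 :=
  WithLp.toLp 2 fun i : Fin 2 =>
    (1 / 2 : ℂ) * ∫ p in Omega,
      Complex.exp (-Complex.I * ((∑ j : Fin 3, wave k j * p j : ℝ) : ℂ)) * ((u p i : ℝ) : ℂ)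

/-- Fourier coefficients of an element of `L²(Ω)²`. -/
def coeff (u : L2) : Freq → C2 := fourierCoeff (u : Pt → V2)

/-- The hydrostatic Helmholtz projection: the two-dimensional Helmholtz projection applied to the
vertical average (the modes with `k₃ = 0`) and the identity on the remaining modes. The mode
`k = 0` is left unchanged. -/
def hydroProj (c : Freq → C2) (k : Freq) : C2 :=
  if k 2 = 0 then
    c k - WithLp.toLp 2 fun i : Fin 2 =>
      ((k i.castSucc : ℂ) * ∑ j : Fin 2, (k j.castSucc : ℂ) * c k j) /
        ((k 0 : ℂ) ^ 2 + (k 1 : ℂ) ^ 2)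
  else c k

/-- The `L²(Ω)` duality pairing `∫_Ω f · v` in terms of Fourier coefficients (Parseval, `|Ω| = 2`). -/
def pairing (f v : Freq → C2) : ℝ := 2 * ∑' k : Freq, (inner ℂ (v k) (f k)).re

/-- The square of the `L²(Ω)` norm in terms of Fourier coefficients. -/
def normSq (c : Freq → C2) : ℝ := 2 * ∑' k : Freq, ‖c k‖ ^ 2

/-! ### The operators and their scales -/

/-- The symbol of `A = ν (-Δ) + ε (-Δ)^{8/5}`. -/
def symbolFull (ν ε : ℝ) (k : Freq) : ℝ :=
  ν * (wave k 0 ^ 2 + wave k 1 ^ 2 + wave k 2 ^ 2) +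
    ε * (wave k 0 ^ 2 + wave k 1 ^ 2 + wave k 2 ^ 2) ^ (8 / 5 : ℝ)

/-- The symbol of `A = ν (-Δ) + ε (-Δ_H)²`. -/
def symbolHoriz (ν ε : ℝ) (k : Freq) : ℝ :=
  ν * (wave k 0 ^ 2 + wave k 1 ^ 2 + wave k 2 ^ 2) + ε * (wave k 0 ^ 2 + wave k 1 ^ 2) ^ 2

/-- `A^s` for the operator `A` with symbol `a`. -/
def opPow (a : Freq → ℝ) (s : ℝ) (c : Freq → C2) (k : Freq) : C2 := (a k ^ s) • c k

/-- The square summable sequences `ℓ²(ℤ³; ℂ²)`. -/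
abbrev Ell2 : Type := lp (fun _ : Freq => C2) 2

/-- `D(A^s)`, `s ∈ ℝ`: (the Fourier coefficients of) the real-valued vector fields or distributions
`c`, even in `z`, with `P_σ̄ c = c` and `(1 + A)^s c` square summable. -/
def DA (a : Freq → ℝ) (s : ℝ) : Set (Freq → C2) :=
  {c | Memℓp (opPow (fun k => 1 + a k) s c) 2 ∧
    hydroProj c = c ∧
    (∀ k : Freq, c (Function.update k 2 (-k 2)) = c k) ∧
    ∀ (k : Freq) (i : Fin 2), c (-k) i = (starRingEnd ℂ) (c k i)}

open Classical in
/-- The isometry `c ↦ (1 + A)^s c` from `D(A^s)`, with its graph norm, into `ℓ²`. It is `0` on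
sequences for which `(1 + A)^s c` is not square summable. -/
def toEll2 (a : Freq → ℝ) (s : ℝ) (c : Freq → C2) : Ell2 :=
  if h : Memℓp (opPow (fun k => 1 + a k) s c) 2 then ⟨opPow (fun k => 1 + a k) s c, h⟩ else 0

/-- `u ∈ L²(0,T; D(A^s))` in the sense of Bochner. -/
def MemL2 (a : Freq → ℝ) (s T : ℝ) (u : ℝ → Freq → C2) : Prop :=
  (∀ᵐ t ∂volume.restrict (Ioo 0 T), u t ∈ DA a s) ∧
  MemLp (fun t => toEll2 a s (u t)) 2 (volume.restrict (Ioo 0 T))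

/-- `g = ∂_t u` on `(0,T)` in the sense of `D(A^s)`-valued distributions. -/
def IsWeakTimeDeriv (a : Freq → ℝ) (s T : ℝ) (u g : ℝ → Freq → C2) : Prop :=
  ∀ φ : ℝ → ℝ, ContDiff ℝ ∞ φ → HasCompactSupport φ → tsupport φ ⊆ Ioo 0 T →
    ∫ t in Ioo 0 T, deriv φ t • toEll2 a s (u t) = -∫ t in Ioo 0 T, φ t • toEll2 a s (g t)

/-- The function `u ∈ H¹(0,T; D(A^s))` has initial value `u₀`, i.e. its continuous
`D(A^s)`-valued representative takes the value `u₀` at time `0`. -/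
def HasInitialValue (a : Freq → ℝ) (s T : ℝ) (u : ℝ → Freq → C2) (u₀ : Freq → C2) : Prop :=
  ∃ r : ℝ → Ell2, ContinuousOn r (Icc 0 T) ∧
    (∀ᵐ t ∂volume.restrict (Ioo 0 T), r t = toEll2 a s (u t)) ∧ r 0 = toEll2 a s u₀

/-! ### The nonlinearity and strong solutions -/

/-- The vertical velocity `w(v)(x,y,z) = -∫_{-1}^z div_H v(x,y,ζ) dζ`. -/
def vertVel (v : L2) (p : Pt) : ℝ :=
  -∫ ζ in (-1 : ℝ)..(p 2),
    ∑ i : Fin 2, ((weakDeriv i.castSucc v : L2) : Pt → V2) (Function.update p 2 ζ) i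

/-- `w(v) ∂_z v' + v · ∇_H v'`. -/
def convection (v v' : L2) (p : Pt) : V2 :=
  vertVel v p • ((weakDeriv 2 v' : L2) : Pt → V2) p +
    ∑ i : Fin 2, ((v : Pt → V2) p i) • ((weakDeriv i.castSucc v' : L2) : Pt → V2) p

/-- `F(v, v') = P_σ̄ (w(v) ∂_z v' + v · ∇_H v')`. -/
def nonlin (v v' : L2) : Freq → C2 := hydroProj (fourierCoeff (convection v v'))

/-- `v` is a strong solution on `(0,T)` of the hyper-viscous primitive equations
`∂_t v + A v + F(v,v) = f`, `v(0) = v₀`: it belongs to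
`L²(0,T; D(A^{1/2})) ∩ H¹(0,T; D(A^{-1/2}))`, the equation holds for almost every `t` in
`D(A^{-1/2})`, and the initial condition is satisfied. -/
structure IsStrongSolution (a : Freq → ℝ) (T : ℝ) (v₀ : L2) (f : ℝ → Freq → C2)
    (v : ℝ → L2) : Prop where
  memL2_half : MemL2 a (1 / 2) T (fun t => coeff (v t))
  memL2_neg_half : MemL2 a (-1 / 2) T (fun t => coeff (v t))
  exists_deriv : ∃ g : ℝ → Freq → C2,
    MemL2 a (-1 / 2) T g ∧ IsWeakTimeDeriv a (-1 / 2) T (fun t => coeff (v t)) g ∧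
    ∀ᵐ t ∂volume.restrict (Ioo 0 T),
      g t + opPow a 1 (coeff (v t)) + nonlin (v t) (v t) = f t
  initial : HasInitialValue a (-1 / 2) T (fun t => coeff (v t)) (coeff v₀)

end HPE

end

/-!
Well-posedness of the hyper-viscous primitive equations in the energy space.

In Fourier variables the equations are an evolution equation in `ℓ²(ℤ³; ℂ²)` for the coefficients `u`
of `v`. Put `Λ = 1 + A`, with symbol `q ^ 4`, `q = quarterWeight a`. The proof rests on the trilinear
estimate `|⟨F(v, v'), φ⟩| ≤ C ‖Λ^{1/4} v‖ ‖Λ^{1/4} v'‖ ‖Λ^{1/2} φ‖` for the convection `F`. It says that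
`F = Λ^{1/2} N(Λ^{1/4} v, Λ^{1/4} v')` with a bounded bilinear operator `N` on `ℓ²`
(`exists_nonlinear_operator`). The vertical velocity loses a horizontal derivative, so the estimate is
anisotropic: both symbols dominate the kernel `triKernel` (`controlsConvection_symbolFull`,
`controlsConvection_symbolHoriz`), and convolution with this kernel is bounded on `ℓ²`
(`exists_tsum_bilin_sq_le`).

The energy space is `L^∞(0,T; ℓ²)` with `Λ^{1/2} u ∈ L²`, hence `X = Λ^{1/4} u ∈ L⁴(0,T; ℓ²)` by
interpolation, and then `N(X, X) ∈ L²`. So the problem is a quadratic equation `X = Y - B(X, X)` in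
`L⁴(0,T; ℓ²)`, where `B` is Duhamel's operator after `N`. `B` is causal, and the `L⁴` norm of a fixed
function over short intervals is small; therefore solutions are unique, can be continued by a
contraction, and converge at the end of their interval of existence as long as their norm is bounded
(`IsCausal.exists_solution`). The bound is the energy estimate: the convection by a divergence free
field does no work, `⟨N(X, X), Λ^{1/4} X⟩ = 0` (`inner_transport_self`). Together this is
`exists_unique_nonlinear_term`, in which the solution is described by its nonlinear term
`n = N(X, X) ∈ L²(0,T; ℓ²)`: the linear equation with the forcing `f - n` determines the rest, including
continuity in time and the energy equality (`evol_energy`), to which `n` does not contribute.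

It remains to translate between fields and Fourier coefficients: Parseval's identity, the Riesz–Fischer
theorem and the convolution theorem on `Ω`, weak derivatives (`coeff_weakDeriv`), the vertical velocity
(`scalarCoeff_vertPrimitive`), whence `nonlin_eq` for the convection term, and the constraints encoded in
`Admissible` for the elements of `L2sol` (`admissible_of_mem_L2sol`). Conversely, the weak form in time of
the equations determines each Fourier mode of a strong solution (`modes_of_isStrongSolution`), which gives
uniqueness among all strong solutions.
-/

namespace HPE

/-! ### Absolutely continuous functions of time -/

section Time

variable {E F G : Type*} [NormedAddCommGroup E] [NormedSpace ℝ E]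
  [NormedAddCommGroup F] [NormedSpace ℝ F]
  [NormedAddCommGroup G] [NormedSpace ℝ G] 

/-- Integration by parts for the primitives of two integrable functions, by Fubini's theorem on
the two triangles of `(0,t)²`. -/
theorem integral_bilin_primitive [CompleteSpace E] [CompleteSpace F] [CompleteSpace G]
    (L : E →L[ℝ] F →L[ℝ] G) {φ : ℝ → E} {ψ : ℝ → F} {t : ℝ}
    (ht : 0 ≤ t) (hφ : IntegrableOn φ (Ioc 0 t)) (hψ : IntegrableOn ψ (Ioc 0 t)) :
    L (∫ s in (0 : ℝ)..t, φ s) (∫ s in (0 : ℝ)..t, ψ s) =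
      (∫ s in (0 : ℝ)..t, L (φ s) (∫ r in (0 : ℝ)..s, ψ r)) +
        ∫ s in (0 : ℝ)..t, L (∫ r in (0 : ℝ)..s, φ r) (ψ s) := by
  set μ := (volume : Measure ℝ).restrict (Ioc 0 t) with hμ
  set f : ℝ × ℝ → G := fun z => L (φ z.1) (ψ z.2) with hf
  have hfi : Integrable f (μ.prod μ) :=
    hφ.op_fst_snd (by fun_prop) ⟨‖L‖, L.le_opNorm₂⟩ hψ
  set A : Set (ℝ × ℝ) := {z | z.2 ≤ z.1} with hA
  have hAm : MeasurableSet A := measurableSet_le measurable_snd measurable_fst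
  have h0 : ∫ z, f z ∂(μ.prod μ) = L (∫ s, φ s ∂μ) (∫ s, ψ s ∂μ) :=
    integral_prod_bilin L hφ hψ
  have h1 : ∫ z, f z ∂(μ.prod μ) = (∫ z in A, f z ∂(μ.prod μ)) + ∫ z in Aᶜ, f z ∂(μ.prod μ) :=
    (integral_add_compl hAm hfi).symm
  have h2 : ∫ z in A, f z ∂(μ.prod μ) = ∫ s, L (φ s) (∫ r in (0 : ℝ)..s, ψ r) ∂μ := by
    rw [← integral_indicator hAm, integral_prod _ (hfi.indicator hAm)]
    refine setIntegral_congr_fun measurableSet_Ioc fun s hs => ?_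
    have : ∀ r, A.indicator f (s, r) = (Iic s).indicator (fun r => L (φ s) (ψ r)) r := by
      intro r; simp only [indicator, hA, mem_ofPred_eq, mem_Iic, hf]
    simp only [this]
    rw [integral_indicator measurableSet_Iic, hμ, Measure.restrict_restrict measurableSet_Iic,
      intervalIntegral.integral_of_le hs.1.le]
    have : Iic s ∩ Ioc 0 t = Ioc 0 s := by
      ext r; simp only [mem_inter_iff, mem_Iic, mem_Ioc]; constructor
      · rintro ⟨a, b, c⟩; exact ⟨b, a⟩
      · rintro ⟨a, b⟩; exact ⟨b, a, b.trans hs.2⟩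
    rw [this]
    exact (L (φ s)).integral_comp_comm (hψ.mono_set (Ioc_subset_Ioc_right hs.2))
  have h3 : ∫ z in Aᶜ, f z ∂(μ.prod μ) = ∫ s, L (∫ r in (0 : ℝ)..s, φ r) (ψ s) ∂μ := by
    rw [← integral_indicator hAm.compl, integral_prod_symm _ (hfi.indicator hAm.compl)]
    refine setIntegral_congr_fun measurableSet_Ioc fun s hs => ?_
    have : ∀ r, Aᶜ.indicator f (r, s) = (Iio s).indicator (fun r => L (φ r) (ψ s)) r := by
      intro r; simp only [indicator, hA, mem_ofPred_eq, mem_Iio, hf, mem_compl_iff, not_le]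
    simp only [this]
    rw [integral_indicator measurableSet_Iio, hμ, Measure.restrict_restrict measurableSet_Iio,
      intervalIntegral.integral_of_le hs.1.le, integral_Ioc_eq_integral_Ioo]
    have : Iio s ∩ Ioc 0 t = Ioo 0 s := by
      ext r; simp only [mem_inter_iff, mem_Iio, mem_Ioc, mem_Ioo]; constructor
      · rintro ⟨a, b, c⟩; exact ⟨b, a⟩
      · rintro ⟨a, b⟩; exact ⟨b, a, b.le.trans hs.2⟩
    rw [this]
    exact (L.flip (ψ s)).integral_comp_comm
      (hφ.mono_set (Ioo_subset_Ioc_self.trans (Ioc_subset_Ioc_right hs.2)))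
  rw [intervalIntegral.integral_of_le ht, intervalIntegral.integral_of_le ht,
    intervalIntegral.integral_of_le ht, intervalIntegral.integral_of_le ht, ← h2, ← h3, ← h1, h0]

theorem continuousOn_add_primitive {u φ : ℝ → E} {u₀ : E} {T : ℝ}
    (hφ : IntegrableOn φ (Ioc 0 T)) (hu : ∀ t ∈ Icc 0 T, u t = u₀ + ∫ s in (0 : ℝ)..t, φ s) :
    ContinuousOn u (Icc 0 T) := by
  rcases le_or_gt 0 T with hT | hT
  · have := intervalIntegral.continuousOn_primitive_interval (μ := volume) (f := φ) (a := 0) (b := T)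
      (by rwa [uIcc_of_le hT, integrableOn_Icc_iff_integrableOn_Ioc])
    rw [uIcc_of_le hT] at this
    exact (continuousOn_const.add this).congr hu
  · simp [Icc_eq_empty hT.not_ge]

/-- The product rule, in integral form, for functions which are primitives. -/
theorem bilin_add_primitive [CompleteSpace E] [CompleteSpace F] [CompleteSpace G]
    (L : E →L[ℝ] F →L[ℝ] G) {u φ : ℝ → E} {v ψ : ℝ → F} {u₀ : E} {v₀ : F} {T : ℝ}
    (hφ : IntegrableOn φ (Ioc 0 T)) (hψ : IntegrableOn ψ (Ioc 0 T))
    (hu : ∀ t ∈ Icc 0 T, u t = u₀ + ∫ s in (0 : ℝ)..t, φ s)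
    (hv : ∀ t ∈ Icc 0 T, v t = v₀ + ∫ s in (0 : ℝ)..t, ψ s) :
    ∀ t ∈ Icc 0 T, IntegrableOn (fun s => L (φ s) (v s) + L (u s) (ψ s)) (Ioc 0 t) ∧
      L (u t) (v t) = L u₀ v₀ + ∫ s in (0 : ℝ)..t, (L (φ s) (v s) + L (u s) (ψ s)) := by
  intro t ht
  have hφt : IntegrableOn φ (Ioc 0 t) := hφ.mono_set (Ioc_subset_Ioc_right ht.2)
  have hψt : IntegrableOn ψ (Ioc 0 t) := hψ.mono_set (Ioc_subset_Ioc_right ht.2)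
  have sub : Icc 0 t ⊆ Icc 0 T := Icc_subset_Icc_right ht.2
  have hΦ : ContinuousOn (fun t => ∫ s in (0 : ℝ)..t, φ s) (Icc 0 t) :=
    continuousOn_add_primitive hφt (u₀ := 0) (by simp)
  have hΨ : ContinuousOn (fun t => ∫ s in (0 : ℝ)..t, ψ s) (Icc 0 t) :=
    continuousOn_add_primitive hψt (u₀ := 0) (by simp)
  obtain ⟨C₁, hC₁⟩ := isCompact_Icc.exists_bound_of_continuousOn hΦ
  obtain ⟨C₂, hC₂⟩ := isCompact_Icc.exists_bound_of_continuousOn hΨ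
  have i1 : IntegrableOn (fun s => L (φ s) (∫ r in (0 : ℝ)..s, ψ r)) (Ioc 0 t) :=
    L.integrable_of_bilin_of_bdd_right C₂ hφt
      ((hΨ.mono Ioc_subset_Icc_self).aestronglyMeasurable measurableSet_Ioc)
      ((ae_restrict_iff' measurableSet_Ioc).2 (.of_forall fun s hs => hC₂ s (Ioc_subset_Icc_self hs)))
  have i2 : IntegrableOn (fun s => L (∫ r in (0 : ℝ)..s, φ r) (ψ s)) (Ioc 0 t) :=
    L.integrable_of_bilin_of_bdd_left C₁
      ((hΦ.mono Ioc_subset_Icc_self).aestronglyMeasurable measurableSet_Ioc)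
      ((ae_restrict_iff' measurableSet_Ioc).2 (.of_forall fun s hs => hC₁ s (Ioc_subset_Icc_self hs)))
      hψt
  have i3 : IntegrableOn (fun s => L (φ s) v₀) (Ioc 0 t) := (L.flip v₀).integrable_comp hφt
  have i4 : IntegrableOn (fun s => L u₀ (ψ s)) (Ioc 0 t) := (L u₀).integrable_comp hψt
  have i34 : IntegrableOn (fun s => L (φ s) v₀ + L u₀ (ψ s)) (Ioc 0 t) := i3.add i4
  have i12 : IntegrableOn (fun s => L (φ s) (∫ r in (0 : ℝ)..s, ψ r) +
      L (∫ r in (0 : ℝ)..s, φ r) (ψ s)) (Ioc 0 t) := i1.add i2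
  have e : EqOn (fun s => L (φ s) (v s) + L (u s) (ψ s)) (fun s => (L (φ s) v₀ + L u₀ (ψ s)) +
      (L (φ s) (∫ r in (0 : ℝ)..s, ψ r) + L (∫ r in (0 : ℝ)..s, φ r) (ψ s))) (Ioc 0 t) := by
    intro s hs
    have hs' := sub (Ioc_subset_Icc_self hs)
    simp only [hu s hs', hv s hs', map_add, add_apply]
    abel
  refine ⟨(i34.add i12).congr_fun e.symm measurableSet_Ioc, ?_⟩
  rw [intervalIntegral.integral_of_le ht.1, setIntegral_congr_fun measurableSet_Ioc e,
    integral_add i34 i12, integral_add i3 i4, integral_add i1 i2,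
    ← intervalIntegral.integral_of_le ht.1, ← intervalIntegral.integral_of_le ht.1,
    ← intervalIntegral.integral_of_le ht.1, ← intervalIntegral.integral_of_le ht.1,
    ← integral_bilin_primitive L ht.1 hφt hψt, hu t ht, hv t ht]
  have e3 : ∫ s in (0 : ℝ)..t, L (φ s) v₀ = L (∫ s in (0 : ℝ)..t, φ s) v₀ := by
    rw [intervalIntegral.integral_of_le ht.1, intervalIntegral.integral_of_le ht.1]
    exact (L.flip v₀).integral_comp_comm hφt
  have e4 : ∫ s in (0 : ℝ)..t, L u₀ (ψ s) = L u₀ (∫ s in (0 : ℝ)..t, ψ s) := by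
    rw [intervalIntegral.integral_of_le ht.1, intervalIntegral.integral_of_le ht.1]
    exact (L u₀).integral_comp_comm hψt
  rw [e3, e4]
  simp only [map_add, add_apply]
  abel

/-- Integral form of Grönwall's inequality. -/
theorem le_mul_exp_of_le_add_integral {y : ℝ → ℝ} {K C T : ℝ} (hC : 0 ≤ C)
    (hy : ContinuousOn y (Icc 0 T)) (h : ∀ t ∈ Icc 0 T, y t ≤ K + C * ∫ s in (0 : ℝ)..t, y s) :
    ∀ t ∈ Icc 0 T, y t ≤ K * Real.exp (C * t) := by
  intro t ht
  have hcont : ContinuousOn (fun t => ∫ s in (0 : ℝ)..t, y s) (Icc 0 T) := by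
    have := intervalIntegral.continuousOn_primitive_interval (μ := volume) (f := y) (a := 0) (b := T)
      (by rw [uIcc_of_le (ht.1.trans ht.2)]; exact hy.integrableOn_Icc)
    rwa [uIcc_of_le (ht.1.trans ht.2)] at this
  have hgr := le_gronwallBound_of_liminf_deriv_right_le (f := fun t => ∫ s in (0 : ℝ)..t, y s)
    (f' := y) (δ := 0) (K := C) (ε := K) (a := 0) (b := T) hcont ?_ (by simp)
    (fun x hx => by linarith [h x ⟨hx.1, hx.2.le⟩]) t ht
  · rcases eq_or_lt_of_le hC with hC0 | hC0
    · have := h t ht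
      simp only [← hC0] at this ⊢
      simpa using this
    · rw [gronwallBound_of_K_ne_0 hC0.ne'] at hgr
      have h1 := h t ht
      have h2 : C * ∫ s in (0 : ℝ)..t, y s ≤ K * (Real.exp (C * t) - 1) := by
        calc _ ≤ C * (0 * Real.exp (C * (t - 0)) + K / C * (Real.exp (C * (t - 0)) - 1)) := by
              gcongr
          _ = _ := by field_simp; ring_nf
      linarith
  · intro x hx r hr
    have hd : HasDerivWithinAt (fun t => ∫ s in (0 : ℝ)..t, y s) (y x) (Ici x) x := by
      have hT : x < T := hx.2
      apply intervalIntegral.integral_hasDerivWithinAt_right (t := Ioi x)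
      · apply ContinuousOn.intervalIntegrable
        rw [uIcc_of_le hx.1]
        exact hy.mono (Icc_subset_Icc_right hT.le)
      · refine ⟨Ioc x T, Ioc_mem_nhdsGT hT, ?_⟩
        exact ((hy.mono fun z hz => ⟨hx.1.trans hz.1.le, hz.2⟩).aestronglyMeasurable measurableSet_Ioc)
      · have := hy x ⟨hx.1, hT.le⟩
        refine (this.mono_of_mem_nhdsWithin ?_)
        refine mem_of_superset (Ioc_mem_nhdsGT hT) fun z hz => ⟨hx.1.trans hz.1.le, hz.2⟩
    exact hd.liminf_right_slope_le hr

/-- A function with an integrable weak derivative `g` on `(0,T)` agrees almost everywhere with a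
primitive of `g`. -/
theorem exists_ae_eq_add_primitive [CompleteSpace E] {u g : ℝ → E} {T : ℝ} (hT : 0 < T)
    (hu : IntegrableOn u (Ioo 0 T)) (hg : IntegrableOn g (Ioo 0 T))
    (h : ∀ φ : ℝ → ℝ, ContDiff ℝ ∞ φ → HasCompactSupport φ → tsupport φ ⊆ Ioo 0 T →
      ∫ t in Ioo 0 T, deriv φ t • u t = -∫ t in Ioo 0 T, φ t • g t) :
    ∃ c : E, ∀ᵐ t ∂volume.restrict (Ioo 0 T), u t = c + ∫ s in (0 : ℝ)..t, g s := by
  obtain ⟨ψ, hψs, hψc, hψd, hψr, hψ1⟩ := exists_contDiff_tsupport_subset (n := ⊤)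
    (Ioo_mem_nhds (half_pos hT) (half_lt_self hT))
  have hψi : 0 < ∫ t, ψ t :=
    hψd.continuous.integral_pos_of_hasCompactSupport_nonneg_nonzero hψc
      (fun x => (hψr (mem_range_self x)).1) (x := T / 2) (by simp [hψ1])
  set J : ℝ := ∫ t, ψ t with hJ
  set w : ℝ → E := fun t => u t - ∫ s in (0 : ℝ)..t, g s with hw
  set c : E := J⁻¹ • ∫ t in Ioo 0 T, ψ t • w t with hc
  have hg' : IntegrableOn g (Ioc 0 T) := by rwa [integrableOn_Ioc_iff_integrableOn_Ioo]
  have hGc : ContinuousOn (fun t => ∫ s in (0 : ℝ)..t, g s) (Icc 0 T) :=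
    continuousOn_add_primitive hg' (u₀ := 0) (by simp)
  have hGi : IntegrableOn (fun t => ∫ s in (0 : ℝ)..t, g s) (Ioo 0 T) :=
    hGc.integrableOn_Icc.mono_set Ioo_subset_Icc_self
  have hwi : IntegrableOn w (Ioo 0 T) := hu.sub hGi
  have hmul : ∀ {θ : ℝ → ℝ} {z : ℝ → E}, Continuous θ → HasCompactSupport θ →
      IntegrableOn z (Ioo 0 T) → IntegrableOn (fun t => θ t • z t) (Ioo 0 T) := by
    intro θ z hθ hθc hz
    obtain ⟨M, hM⟩ := hθc.exists_bound_of_continuous hθ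
    exact Integrable.bdd_smul hz M hθ.aestronglyMeasurable (.of_forall hM)
  -- `w` is orthogonal to all derivatives of test functions
  have hort : ∀ φ : ℝ → ℝ, ContDiff ℝ ∞ φ → HasCompactSupport φ → tsupport φ ⊆ Ioo 0 T →
      ∫ t in Ioo 0 T, deriv φ t • w t = 0 := by
    intro φ h1 h2 h3
    have hd : Continuous (deriv φ) := h1.continuous_deriv (by simp)
    have hdi : IntegrableOn (deriv φ) (Ioc 0 T) :=
      (hd.continuousOn.integrableOn_Icc (a := 0) (b := T)).mono_set Ioc_subset_Icc_self
    have hφ0 : φ 0 = 0 := image_eq_zero_of_notMem_tsupport fun hh => (h3 hh).1.false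
    have hφT : φ T = 0 := image_eq_zero_of_notMem_tsupport fun hh => (h3 hh).2.false
    obtain ⟨hi, hp⟩ := bilin_add_primitive (ContinuousLinearMap.lsmul ℝ ℝ : ℝ →L[ℝ] E →L[ℝ] E)
      (u := φ) (v := fun t => ∫ s in (0 : ℝ)..t, g s) (u₀ := 0) (v₀ := 0) hdi hg'
      (fun t ht => by
        rw [intervalIntegral.integral_deriv_eq_sub (fun x _ => h1.differentiable (by simp) x)
          (hd.intervalIntegrable _ _), hφ0]; simp) (fun t ht => by simp) T ⟨hT.le, le_rfl⟩
    simp only [hφT, ContinuousLinearMap.lsmul_apply, zero_smul, zero_add] at hp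
    rw [intervalIntegral.integral_of_le hT.le, integral_Ioc_eq_integral_Ioo, integral_add
      (hmul hd h2.deriv hGi) (hmul h1.continuous h2 hg)] at hp
    have h5 : ∫ t in Ioo 0 T, deriv φ t • w t = (∫ t in Ioo 0 T, deriv φ t • u t) -
        ∫ t in Ioo 0 T, deriv φ t • ∫ s in (0 : ℝ)..t, g s := by
      rw [← integral_sub (hmul hd h2.deriv hu) (hmul hd h2.deriv hGi)]
      simp only [hw, smul_sub]
    rw [h5, h φ h1 h2 h3, ← neg_add', add_comm, ← hp, neg_zero]
  refine ⟨c, ?_⟩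
  have key : ∀ᵐ t, t ∈ Ioo 0 T → w t - c = 0 := by
    refine isOpen_Ioo.ae_eq_zero_of_integral_contDiff_smul_eq_zero
      (hwi.sub (integrableOn_const (by simp))).locallyIntegrableOn ?_
    intro χ hχd hχc hχs
    set I : ℝ := ∫ t, χ t with hI
    -- `χ - (I / J) ψ` has mean zero, so its primitive is a test function
    set η : ℝ → ℝ := fun t => χ t - I / J * ψ t with hη
    have hηd : ContDiff ℝ ∞ η := hχd.sub (contDiff_const.mul hψd)
    have hηc : HasCompactSupport η := hχc.sub (hψc.mul_left)
    have hηs : tsupport η ⊆ Ioo 0 T := by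
      refine (closure_mono (t := tsupport χ ∪ tsupport ψ) ?_).trans ?_
      · intro t ht
        by_contra hcon
        rw [mem_union, not_or] at hcon
        exact ht (by simp [hη, image_eq_zero_of_notMem_tsupport hcon.1,
          image_eq_zero_of_notMem_tsupport hcon.2])
      · rw [((isClosed_tsupport χ).union (isClosed_tsupport ψ)).closure_eq]
        exact union_subset hχs hψs
    have hηi : Integrable η := hηd.continuous.integrable_of_hasCompactSupport hηc
    have hη0 : ∫ t, η t = 0 := by
      rw [hη, integral_sub (hχd.continuous.integrable_of_hasCompactSupport hχc)
        ((hψd.continuous.integrable_of_hasCompactSupport hψc).const_mul _), integral_const_mul,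
        ← hI, ← hJ, div_mul_cancel₀ _ hψi.ne', sub_self]
    set Θ : ℝ → ℝ := fun t => ∫ s in (0 : ℝ)..t, η s with hΘ
    have hΘ' : ∀ t, HasDerivAt Θ (η t) t := fun t =>
      intervalIntegral.integral_hasDerivAt_right (hηd.continuous.intervalIntegrable _ _)
        (hηd.continuous.stronglyMeasurableAtFilter _ _) hηd.continuous.continuousAt
    have hΘd : deriv Θ = η := funext fun t => (hΘ' t).deriv
    have hΘs : ContDiff ℝ ∞ Θ := by
      rw [contDiff_infty_iff_deriv]
      exact ⟨fun t => (hΘ' t).differentiableAt, hΘd ▸ hηd⟩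
    have hΘt : tsupport Θ ⊆ Ioo 0 T := by
      rcases (tsupport η).eq_empty_or_nonempty with he | hne
      · have : η = 0 := by rwa [tsupport_eq_empty_iff] at he
        have : Θ = 0 := by ext t; simp [hΘ, this]
        simp [this, tsupport]
      obtain ⟨α, hα⟩ := hηc.exists_isLeast hne
      obtain ⟨β, hβ⟩ := hηc.exists_isGreatest hne
      have hα0 := hηs hα.1
      have hβ0 := hηs hβ.1
      refine (closure_minimal (t := Icc α β) ?_ isClosed_Icc).trans
        fun t ht => ⟨hα0.1.trans_le ht.1, ht.2.trans_lt hβ0.2⟩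
      intro t ht
      by_contra hcon
      apply ht
      have hz : ∀ s, s < α ∨ β < s → η s = 0 := by
        intro s hs
        refine image_eq_zero_of_notMem_tsupport fun hh => ?_
        rcases hs with hs | hs
        · exact (hα.2 hh).not_gt hs
        · exact (hβ.2 hh).not_gt hs
      rw [mem_Icc, not_and_or, not_le, not_le] at hcon
      rcases hcon with hlt | hlt
      · refine intervalIntegral.integral_zero_ae (.of_forall fun s hs => hz s (Or.inl ?_))
        rcases le_total 0 t with h0 | h0
        · rw [uIoc_of_le h0] at hs; exact hs.2.trans_lt hlt
        · rw [uIoc_of_ge h0] at hs; exact hs.2.trans_lt hα0.1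
      · have h0t : 0 ≤ t := (hβ0.1.trans hlt).le
        simp only [hΘ]
        rw [intervalIntegral.integral_of_le h0t]
        refine Eq.trans ?_ hη0
        refine setIntegral_eq_integral_of_forall_compl_eq_zero fun s hs => hz s ?_
        rw [mem_Ioc, not_and_or, not_lt, not_le] at hs
        exact hs.imp (fun hs => hs.trans_lt hα0.1) fun hs => hlt.trans hs
    have hΘc : HasCompactSupport Θ :=
      HasCompactSupport.intro (K := Icc 0 T) isCompact_Icc fun t ht => image_eq_zero_of_notMem_tsupport
        fun hh => ht (Ioo_subset_Icc_self (hΘt hh))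
    have h6 := hort Θ hΘs hΘc hΘt
    rw [hΘd] at h6
    have hχI : ∫ t in Ioo 0 T, χ t = I := setIntegral_eq_integral_of_forall_compl_eq_zero
      fun s hs => image_eq_zero_of_notMem_tsupport fun hh => hs (hχs hh)
    have h7 : ∫ t in Ioo 0 T, η t • w t = (∫ t in Ioo 0 T, χ t • w t) - (I / J) •
        ∫ t in Ioo 0 T, ψ t • w t := by
      rw [← integral_smul]
      refine Eq.trans ?_ (integral_sub (hmul hχd.continuous hχc hwi) (Integrable.smul (I / J) (hmul hψd.continuous hψc hwi)))
      simp only [hη, sub_smul, mul_smul]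
    have h8 : ∫ t in Ioo 0 T, χ t • (w t - c) = (∫ t in Ioo 0 T, χ t • w t) - I • c := by
      rw [← hχI, ← integral_smul_const, ← integral_sub (hmul hχd.continuous hχc hwi)
        (hmul hχd.continuous hχc (integrableOn_const (by simp)))]
      simp only [smul_sub]
    have h9 : ∫ t, χ t • (w t - c) = ∫ t in Ioo 0 T, χ t • (w t - c) :=
      (setIntegral_eq_integral_of_forall_compl_eq_zero fun s hs => by
        rw [image_eq_zero_of_notMem_tsupport fun hh => hs (hχs hh), zero_smul]).symm
    rw [h9, h8, hc, smul_smul, ← div_eq_mul_inv, ← h7, h6]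
  rw [ae_restrict_iff' measurableSet_Ioo]
  filter_upwards [key] with t ht hmem
  have := ht hmem
  rw [sub_eq_zero] at this
  simp only [hw] at this
  rw [← this, sub_add_cancel]

end Time

/-! ### A single damped mode -/

section Mode

section

variable {E : Type*} [NormedAddCommGroup E] [NormedSpace ℝ E]

/-- The solution of `u' + α u = h`, `u(0) = e₀`, given by Duhamel's formula. -/
noncomputable def modeSol (α : ℝ) (e₀ : E) (h : ℝ → E) (t : ℝ) : E :=
  Real.exp (-α * t) • (e₀ + ∫ s in (0 : ℝ)..t, Real.exp (α * s) • h s)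

theorem continuousOn_modeSol {α T : ℝ} {e₀ : E} {h : ℝ → E} (hh : IntegrableOn h (Ioc 0 T)) :
    ContinuousOn (modeSol α e₀ h) (Icc 0 T) := by
  have hc : Continuous fun s : ℝ => Real.exp (α * s) := by fun_prop
  have hi : IntegrableOn (fun s => Real.exp (α * s) • h s) (Ioc 0 T) :=
    (((integrableOn_Icc_iff_integrableOn_Ioc (μ := volume)).2 hh).continuousOn_smul
      hc.continuousOn isCompact_Icc).mono_set Ioc_subset_Icc_self
  exact ContinuousOn.smul (by fun_prop) (continuousOn_add_primitive hi fun t _ => rfl)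

end

variable {E : Type*} [NormedAddCommGroup E] [InnerProductSpace ℝ E] [CompleteSpace E]

theorem norm_sq_add_primitive {u φ : ℝ → E} {u₀ : E} {T : ℝ}
    (hφ : IntegrableOn φ (Ioc 0 T)) (hu : ∀ t ∈ Icc 0 T, u t = u₀ + ∫ s in (0 : ℝ)..t, φ s) :
    ∀ t ∈ Icc 0 T, IntegrableOn (fun s => inner ℝ (φ s) (u s)) (Ioc 0 t) ∧
      ‖u t‖ ^ 2 = ‖u₀‖ ^ 2 + 2 * ∫ s in (0 : ℝ)..t, inner ℝ (φ s) (u s) := by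
  intro t ht
  have hL : ∀ x y, (innerSL ℝ : E →L[ℝ] E →L[ℝ] ℝ) x y = inner ℝ x y := fun _ _ => rfl
  obtain ⟨hi, h⟩ := bilin_add_primitive (innerSL ℝ : E →L[ℝ] E →L[ℝ] ℝ) hφ hφ hu hu t ht
  have e : ∀ s, inner ℝ (φ s) (u s) + inner ℝ (u s) (φ s) = 2 * inner ℝ (φ s) (u s) := by
    intro s
    rw [real_inner_comm (φ s) (u s)]; ring
  simp only [hL, e, real_inner_self_eq_norm_sq, intervalIntegral.integral_const_mul] at h hi
  refine ⟨(Integrable.const_mul hi (1 / 2 : ℝ)).congr (.of_forall fun s => ?_), h⟩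
  simp

theorem modeSol_eq {α T : ℝ} {e₀ : E} {h : ℝ → E} (hh : IntegrableOn h (Ioc 0 T)) :
    ∀ t ∈ Icc 0 T, modeSol α e₀ h t = e₀ + ∫ s in (0 : ℝ)..t, (h s - α • modeSol α e₀ h s) := by
  intro t ht
  have hc : Continuous fun s : ℝ => Real.exp (α * s) := by fun_prop
  have hi : IntegrableOn (fun s => Real.exp (α * s) • h s) (Ioc 0 T) :=
    (((integrableOn_Icc_iff_integrableOn_Ioc (μ := volume)).2 hh).continuousOn_smul
      hc.continuousOn isCompact_Icc).mono_set Ioc_subset_Icc_self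
  have hd : ∀ x, HasDerivAt (fun t => Real.exp (-α * t)) (-α * Real.exp (-α * x)) x := by
    intro x
    have := ((hasDerivAt_id x).const_mul (-α)).exp
    simpa [mul_comm] using this
  have hd' : Continuous fun x => -α * Real.exp (-α * x) := by fun_prop
  obtain ⟨-, h1⟩ := bilin_add_primitive (ContinuousLinearMap.lsmul ℝ ℝ : ℝ →L[ℝ] E →L[ℝ] E)
    (u := fun t => Real.exp (-α * t)) (φ := fun t => -α * Real.exp (-α * t)) (u₀ := 1)
    (v := fun t => e₀ + ∫ s in (0 : ℝ)..t, Real.exp (α * s) • h s) (v₀ := e₀)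
    ((hd'.continuousOn.integrableOn_Icc (a := 0) (b := T)).mono_set Ioc_subset_Icc_self) hi
    (fun t ht => by
      rw [intervalIntegral.integral_eq_sub_of_hasDerivAt (fun x _ => hd x)
        (hd'.intervalIntegrable _ _)]; simp) (fun t ht => rfl) t ht
  simp only [ContinuousLinearMap.lsmul_apply, one_smul, smul_smul] at h1
  rw [modeSol, h1]
  congr 2 with s
  simp only [modeSol, smul_smul, ← Real.exp_add]
  simp only [neg_mul, neg_add_cancel, Real.exp_zero, one_smul, neg_smul]
  abel

/-- The energy equality for one mode: pair the equation with `u`. -/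
theorem mode_energy {α T : ℝ} {e₀ : E} {h u : ℝ → E} (hh : IntegrableOn h (Ioc 0 T))
    (hc : ContinuousOn u (Icc 0 T))
    (hu : ∀ t ∈ Icc 0 T, u t = e₀ + ∫ s in (0 : ℝ)..t, (h s - α • u s)) :
    ∀ t ∈ Icc 0 T, IntegrableOn (fun s => inner ℝ (h s) (u s)) (Ioc 0 t) ∧
      ‖u t‖ ^ 2 + 2 * (α * ∫ s in (0 : ℝ)..t, ‖u s‖ ^ 2) =
        ‖e₀‖ ^ 2 + 2 * ∫ s in (0 : ℝ)..t, inner ℝ (h s) (u s) := by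
  intro t ht
  have hui : IntegrableOn u (Ioc 0 T) := hc.integrableOn_Icc.mono_set Ioc_subset_Icc_self
  obtain ⟨hi, h1⟩ := norm_sq_add_primitive (Integrable.sub hh (Integrable.smul α hui)) hu t ht
  have hni : IntegrableOn (fun s => ‖u s‖ ^ 2) (Ioc 0 t) :=
    ((hc.norm.pow 2).integrableOn_Icc).mono_set
      (Ioc_subset_Icc_self.trans (Icc_subset_Icc_right ht.2))
  have e : ∀ s, inner ℝ (h s - α • u s) (u s) = inner ℝ (h s) (u s) - α * ‖u s‖ ^ 2 := by
    intro s; rw [inner_sub_left, real_inner_smul_left, real_inner_self_eq_norm_sq]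
  simp only [Pi.sub_apply, Pi.smul_apply, e] at hi h1
  have hi2 : IntegrableOn (fun s => inner ℝ (h s) (u s)) (Ioc 0 t) := by
    have := Integrable.add hi (Integrable.const_mul hni α)
    refine this.congr (.of_forall fun s => ?_)
    simp
  refine ⟨hi2, ?_⟩
  rw [h1, intervalIntegral.integral_of_le ht.1, integral_sub hi2 (Integrable.const_mul hni α),
    ← intervalIntegral.integral_of_le ht.1, ← intervalIntegral.integral_of_le ht.1,
    intervalIntegral.integral_const_mul]
  ring

theorem mode_unique {α T : ℝ} (hα : 0 ≤ α) {e₀ : E} {h u v : ℝ → E}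
    (hh : IntegrableOn h (Ioc 0 T))
    (huc : ContinuousOn u (Icc 0 T)) (hvc : ContinuousOn v (Icc 0 T))
    (hu : ∀ t ∈ Icc 0 T, u t = e₀ + ∫ s in (0 : ℝ)..t, (h s - α • u s))
    (hv : ∀ t ∈ Icc 0 T, v t = e₀ + ∫ s in (0 : ℝ)..t, (h s - α • v s)) :
    EqOn u v (Icc 0 T) := by
  intro t ht
  have hui : IntegrableOn u (Ioc 0 T) := huc.integrableOn_Icc.mono_set Ioc_subset_Icc_self
  have hvi : IntegrableOn v (Ioc 0 T) := hvc.integrableOn_Icc.mono_set Ioc_subset_Icc_self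
  obtain ⟨-, h1⟩ := mode_energy (α := α) (e₀ := (0 : E)) (h := fun _ => 0) (u := fun t => u t - v t)
    (integrableOn_zero) (huc.sub hvc) (fun t ht => by
      have i1 : IntegrableOn (fun s => h s - α • u s) (Ioc 0 t) :=
        IntegrableOn.mono_set (Integrable.sub hh (Integrable.smul α hui)) (Ioc_subset_Ioc_right ht.2)
      have i2 : IntegrableOn (fun s => h s - α • v s) (Ioc 0 t) :=
        IntegrableOn.mono_set (Integrable.sub hh (Integrable.smul α hvi)) (Ioc_subset_Ioc_right ht.2)
      rw [hu t ht, hv t ht, add_sub_add_left_eq_sub, intervalIntegral.integral_of_le ht.1,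
        intervalIntegral.integral_of_le ht.1, ← integral_sub i1 i2,
        intervalIntegral.integral_of_le ht.1, zero_add]
      congr 1 with s
      rw [smul_sub]; abel) t ht
  have h2 : 0 ≤ ∫ s in (0 : ℝ)..t, ‖u s - v s‖ ^ 2 :=
    intervalIntegral.integral_nonneg ht.1 fun s _ => by positivity
  simp only [inner_zero_left, intervalIntegral.integral_zero, norm_zero] at h1
  have h3 : ‖u t - v t‖ ^ 2 ≤ 0 := by
    have := mul_nonneg hα h2
    linarith
  exact sub_eq_zero.1 (norm_eq_zero.1 (pow_eq_zero_iff (two_ne_zero) |>.1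
    (le_antisymm h3 (by positivity))))

/-- The energy estimate for one mode; the constant does not depend on the damping `β ^ 2 - 1`. -/
theorem mode_bound {β T : ℝ} {e₀ : E} {g u : ℝ → E}
    (hg : IntegrableOn g (Ioc 0 T)) (hg2 : IntegrableOn (fun s => ‖g s‖ ^ 2) (Ioc 0 T))
    (hc : ContinuousOn u (Icc 0 T))
    (hu : ∀ t ∈ Icc 0 T, u t = e₀ + ∫ s in (0 : ℝ)..t, (β • g s - (β ^ 2 - 1) • u s)) :
    ∀ t ∈ Icc 0 T, ‖u t‖ ^ 2 + β ^ 2 * ∫ s in (0 : ℝ)..t, ‖u s‖ ^ 2 ≤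
      (1 + 2 * T * Real.exp (2 * T)) * (‖e₀‖ ^ 2 + ∫ s in (0 : ℝ)..T, ‖g s‖ ^ 2) := by
  set M := ‖e₀‖ ^ 2 + ∫ s in (0 : ℝ)..T, ‖g s‖ ^ 2 with hM
  have step : ∀ t ∈ Icc 0 T, ‖u t‖ ^ 2 + β ^ 2 * ∫ s in (0 : ℝ)..t, ‖u s‖ ^ 2 ≤
      M + 2 * ∫ s in (0 : ℝ)..t, ‖u s‖ ^ 2 := by
    intro t ht
    obtain ⟨hi, h1⟩ := mode_energy (Integrable.smul β hg) hc hu t ht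
    simp only [Pi.smul_apply] at hi h1
    have hni : IntegrableOn (fun s => ‖u s‖ ^ 2) (Ioc 0 t) :=
      ((hc.norm.pow 2).integrableOn_Icc).mono_set
        (Ioc_subset_Icc_self.trans (Icc_subset_Icc_right ht.2))
    have hgi : IntegrableOn (fun s => ‖g s‖ ^ 2) (Ioc 0 t) :=
      hg2.mono_set (Ioc_subset_Ioc_right ht.2)
    have h2 : 2 * ∫ s in (0 : ℝ)..t, inner ℝ (β • g s) (u s) ≤
        (∫ s in (0 : ℝ)..t, ‖g s‖ ^ 2) + β ^ 2 * ∫ s in (0 : ℝ)..t, ‖u s‖ ^ 2 := by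
      simp only [intervalIntegral.integral_of_le ht.1]
      rw [← integral_const_mul, ← integral_const_mul,
        ← integral_add hgi (Integrable.const_mul hni (β ^ 2))]
      refine integral_mono (Integrable.const_mul hi 2) (hgi.add (Integrable.const_mul hni (β ^ 2))) fun s => ?_
      have h3 : inner ℝ (β • g s) (u s) = inner ℝ (g s) (β • u s) := by
        rw [real_inner_smul_left, real_inner_smul_right]
      have h4 := real_inner_le_norm (g s) (β • u s)
      have h5 : ‖β • u s‖ ^ 2 = β ^ 2 * ‖u s‖ ^ 2 := by
        rw [norm_smul, mul_pow, Real.norm_eq_abs, sq_abs]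
      simp only [h3]
      nlinarith [sq_nonneg (‖g s‖ - ‖β • u s‖)]
    have h6 : ∫ s in (0 : ℝ)..t, ‖g s‖ ^ 2 ≤ ∫ s in (0 : ℝ)..T, ‖g s‖ ^ 2 := by
      rw [intervalIntegral.integral_of_le ht.1, intervalIntegral.integral_of_le (ht.1.trans ht.2)]
      exact setIntegral_mono_set hg2 (.of_forall fun s => by positivity)
        (Ioc_subset_Ioc_right ht.2).eventuallyLE
    linarith
  have hpos : ∀ t ∈ Icc 0 T, 0 ≤ ∫ s in (0 : ℝ)..t, ‖u s‖ ^ 2 := fun t ht =>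
    intervalIntegral.integral_nonneg ht.1 fun s _ => by positivity
  have hgr := le_mul_exp_of_le_add_integral (y := fun t => ‖u t‖ ^ 2) (K := M) (C := 2) (T := T)
    (by norm_num) (hc.norm.pow 2) (fun t ht => by
      have := step t ht
      nlinarith [hpos t ht, mul_nonneg (sq_nonneg β) (hpos t ht)])
  intro t ht
  have hM0 : 0 ≤ M := by
    have : 0 ≤ ∫ s in (0 : ℝ)..T, ‖g s‖ ^ 2 :=
      intervalIntegral.integral_nonneg (ht.1.trans ht.2) fun s _ => by positivity
    positivity
  have h7 : ∫ s in (0 : ℝ)..t, ‖u s‖ ^ 2 ≤ T * (M * Real.exp (2 * T)) := by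
    calc ∫ s in (0 : ℝ)..t, ‖u s‖ ^ 2 ≤ ∫ s in (0 : ℝ)..t, M * Real.exp (2 * T) := by
          refine intervalIntegral.integral_mono_on ht.1 ?_ (by simp) fun s hs => ?_
          · apply ContinuousOn.intervalIntegrable
            rw [uIcc_of_le ht.1]
            exact (hc.norm.pow 2).mono (Icc_subset_Icc_right ht.2)
          · refine (hgr s ⟨hs.1, hs.2.trans ht.2⟩).trans ?_
            have := hs.2.trans ht.2
            gcongr
      _ = t * (M * Real.exp (2 * T)) := by simp; ring
      _ ≤ _ := by
          have := ht.2
          gcongr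
  have := step t ht
  nlinarith

end Mode

/-! ### Square summable sequences depending on time -/

section Seq

variable {ι E : Type*} [NormedAddCommGroup E]

theorem memlp_two_iff {c : ι → E} : Memℓp c 2 ↔ Summable fun k => ‖c k‖ ^ 2 := by
  rw [memℓp_gen_iff (by norm_num)]
  simp

theorem hasSum_norm_sq (x : lp (fun _ : ι => E) 2) : HasSum (fun k => ‖x k‖ ^ 2) (‖x‖ ^ 2) := by
  simpa using lp.hasSum_norm (p := 2) (by norm_num) x

open Classical in
/-- A sequence as an element of `ℓ²`; it is `0` if the sequence is not square summable. -/
noncomputable def mkSeq (c : ι → E) : lp (fun _ : ι => E) 2 := if h : Memℓp c 2 then ⟨c, h⟩ else 0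

theorem mkSeq_apply {c : ι → E} (h : Memℓp c 2) (k : ι) : mkSeq c k = c k := by
  rw [mkSeq, dif_pos h]

theorem mkSeq_coe (x : lp (fun _ : ι => E) 2) : mkSeq (fun k => x k) = x := by
  ext k; exact mkSeq_apply (lp.memℓp x) k

theorem norm_mkSeq_sq {c : ι → E} (h : Memℓp c 2) : ‖mkSeq c‖ ^ 2 = ∑' k, ‖c k‖ ^ 2 := by
  rw [← (hasSum_norm_sq (mkSeq c)).tsum_eq]
  simp only [mkSeq_apply h]

theorem aestronglyMeasurable_seq {α : Type*} [MeasurableSpace α] {μ : Measure α} [Countable ι]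
    {x : α → lp (fun _ : ι => E) 2} (h : ∀ k, AEStronglyMeasurable (fun t => x t k) μ) :
    AEStronglyMeasurable x μ := by
  classical
  refine aestronglyMeasurable_of_tendsto_ae (atTop : Filter (Finset ι))
    (f := fun s t => ∑ k ∈ s, lp.single 2 k (x t k)) (fun s => ?_)
    (.of_forall fun t => lp.hasSum_single (by norm_num) (x t))
  have : (fun t => ∑ k ∈ s, lp.single 2 k (x t k)) =
      ∑ k ∈ s, fun t => (lp.single 2 k (x t k) : lp (fun _ : ι => E) 2) := by
    ext1 t; simp
  rw [this]
  refine Finset.aestronglyMeasurable_sum _ fun k _ => ?_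
  have hc : Continuous fun e : E => (lp.single 2 k e : lp (fun _ : ι => E) 2) := by
    refine (Isometry.of_dist_eq fun a b => ?_).continuous
    rw [dist_eq_norm, dist_eq_norm, ← lp.single_sub, lp.norm_single (by norm_num)]
  exact hc.comp_aestronglyMeasurable (h k)

theorem continuous_seq_apply (k : ι) : Continuous fun x : lp (fun _ : ι => E) 2 => x k := by
  refine (LipschitzWith.of_dist_le_mul (K := 1) fun x y => ?_).continuous
  rw [dist_eq_norm, dist_eq_norm, NNReal.coe_one, one_mul]
  exact lp.norm_apply_le_norm (by norm_num) (x - y) k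

/-- Tonelli's theorem for square integrable functions with values in `ℓ²`. -/
theorem hasSum_integral_norm_sq {α : Type*} [MeasurableSpace α] {μ : Measure α} [Countable ι]
    {x : α → lp (fun _ : ι => E) 2} (hx : MemLp x 2 μ) :
    (∀ k, MemLp (fun t => x t k) 2 μ) ∧
      HasSum (fun k => ∫ t, ‖x t k‖ ^ 2 ∂μ) (∫ t, ‖x t‖ ^ 2 ∂μ) := by
  have h1 : ∀ k, MemLp (fun t => x t k) 2 μ := fun k =>
    hx.mono ((continuous_seq_apply k).comp_aestronglyMeasurable hx.1)
      (.of_forall fun t => lp.norm_apply_le_norm (by norm_num) (x t) k)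
  refine ⟨h1, ?_⟩
  have h2 : ∀ k, Integrable (fun t => ‖x t k‖ ^ 2) μ := fun k => (h1 k).integrable_norm_pow (by norm_num)
  have h3 : Integrable (fun t => ‖x t‖ ^ 2) μ := hx.integrable_norm_pow (by norm_num)
  have h4 := hasSum_integral_of_summable_integral_norm h2 ?_
  · simpa only [(hasSum_norm_sq (x _)).tsum_eq] using h4
  · refine summable_of_sum_le (c := ∫ t, ‖x t‖ ^ 2 ∂μ) (fun k => by positivity) fun s => ?_
    rw [← integral_finsetSum _ fun k _ => (h2 k).norm]
    refine integral_mono (integrable_finsetSum _ fun k _ => (h2 k).norm) h3 fun t => ?_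
    simp only [norm_pow, norm_norm]
    exact sum_le_hasSum s (fun k _ => by positivity) (hasSum_norm_sq (x t))

/-- The converse of Tonelli's theorem: square integrable coordinates with summable `L²` norms
define a square integrable function with values in `ℓ²`. -/
theorem memLp_mkSeq {α : Type*} [MeasurableSpace α] {μ : Measure α} [Countable ι]
    {c : α → ι → E} (hc : ∀ k, MemLp (fun t => c t k) 2 μ) {F : ι → ℝ} (hF : Summable F)
    (hcF : ∀ k, ∫ t, ‖c t k‖ ^ 2 ∂μ ≤ F k) :
    (∀ᵐ t ∂μ, Memℓp (c t) 2) ∧ MemLp (fun t => mkSeq (c t)) 2 μ ∧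
      ∫ t, ‖mkSeq (c t)‖ ^ 2 ∂μ ≤ ∑' k, F k := by
  have hi : ∀ k, Integrable (fun t => ‖c t k‖ ^ 2) μ := fun k => (hc k).integrable_norm_pow (by norm_num)
  have hs : Summable fun k => ∫ t, ‖c t k‖ ^ 2 ∂μ :=
    .of_nonneg_of_le (fun k => integral_nonneg fun t => by positivity) hcF hF
  have h0 : ∀ k, ∫⁻ t, ENNReal.ofReal (‖c t k‖ ^ 2) ∂μ = ENNReal.ofReal (∫ t, ‖c t k‖ ^ 2 ∂μ) :=
    fun k => (ofReal_integral_eq_lintegral_ofReal (hi k) (.of_forall fun t => by positivity)).symm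
  have h1 : ∫⁻ t, ∑' k, ENNReal.ofReal (‖c t k‖ ^ 2) ∂μ ≠ ⊤ := by
    rw [lintegral_tsum fun k => (hi k).1.aemeasurable.ennreal_ofReal]
    simp only [h0]
    exact hs.tsum_ofReal_ne_top
  have h2 : ∀ᵐ t ∂μ, Memℓp (c t) 2 := by
    filter_upwards [ae_lt_top' (AEMeasurable.tsum fun k =>
      (hi k).1.aemeasurable.ennreal_ofReal) h1] with t ht
    rw [memlp_two_iff]
    have := ENNReal.summable_toReal ht.ne
    simpa [ENNReal.toReal_ofReal, sq_nonneg] using this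
  have h3 : AEStronglyMeasurable (fun t => mkSeq (c t)) μ := by
    refine aestronglyMeasurable_seq fun k => (hc k).1.congr ?_
    filter_upwards [h2] with t ht using (mkSeq_apply ht k).symm
  have h4 : HasSum (fun k => ∫ t, ‖c t k‖ ^ 2 ∂μ) (∫ t, ∑' k, ‖c t k‖ ^ 2 ∂μ) :=
    hasSum_integral_of_summable_integral_norm hi (by simpa using hs)
  have h6 : (fun t => ‖mkSeq (c t)‖ ^ 2) =ᵐ[μ] fun t => ∑' k, ‖c t k‖ ^ 2 := by
    filter_upwards [h2] with t ht using norm_mkSeq_sq ht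
  have h5 : Integrable (fun t => ‖mkSeq (c t)‖ ^ 2) μ := by
    refine ⟨(h3.norm.pow 2), ?_⟩
    refine lt_of_le_of_lt (lintegral_mono_ae (g := fun t => ∑' k, ENNReal.ofReal (‖c t k‖ ^ 2)) ?_)
      h1.lt_top
    filter_upwards [h6, h2] with t ht ht2
    rw [ht, ← ENNReal.ofReal_tsum_of_nonneg (fun k => by positivity) (memlp_two_iff.1 ht2),
      Real.enorm_eq_ofReal (tsum_nonneg fun k => by positivity)]
  refine ⟨h2, (memLp_two_iff_integrable_sq_norm h3).2 h5, ?_⟩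
  rw [integral_congr_ae h6, ← h4.tsum_eq]
  exact hs.tsum_le_tsum hcF hF

/-- Reduces integrals of inner products to integrals of squares of norms. -/
theorem integral_inner_eq_polarization {F : Type*} [NormedAddCommGroup F] [InnerProductSpace ℝ F]
    {α : Type*} [MeasurableSpace α] {μ : Measure α} {u v : α → F}
    (hu : MemLp u 2 μ) (hv : MemLp v 2 μ) : ∫ t, inner ℝ (u t) (v t) ∂μ =
      (1 / 2) * ((∫ t, ‖u t + v t‖ ^ 2 ∂μ) - (∫ t, ‖u t‖ ^ 2 ∂μ) - ∫ t, ‖v t‖ ^ 2 ∂μ) := by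
  have i1 := hu.integrable_norm_pow (p := 2) (by norm_num)
  have i2 := hv.integrable_norm_pow (p := 2) (by norm_num)
  have i3 := (hu.add hv).integrable_norm_pow (p := 2) (by norm_num)
  simp only [Pi.add_apply] at i3
  have i4 : Integrable (fun x => ‖u x + v x‖ ^ 2 - ‖u x‖ ^ 2) μ := i3.sub i1
  rw [← integral_sub i3 i1, ← integral_sub i4 i2, ← integral_const_mul]
  congr 1 with t
  rw [real_inner_eq_norm_add_mul_self_sub_norm_mul_self_sub_norm_mul_self_div_two]
  ring

theorem hasSum_integral_inner {E : Type*} [NormedAddCommGroup E] [InnerProductSpace ℝ E]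
    {α : Type*} [MeasurableSpace α] {μ : Measure α} [Countable ι]
    {x y : α → lp (fun _ : ι => E) 2} (hx : MemLp x 2 μ) (hy : MemLp y 2 μ) :
    HasSum (fun k => ∫ t, inner ℝ (x t k) (y t k) ∂μ) (∫ t, inner ℝ (x t) (y t) ∂μ) := by
  have h1 := hasSum_integral_norm_sq hx
  have h2 := hasSum_integral_norm_sq hy
  have h3 := hasSum_integral_norm_sq (hx.add hy)
  rw [integral_inner_eq_polarization hx hy]
  have e := funext fun k => integral_inner_eq_polarization (h1.1 k) (h2.1 k)
  rw [e]
  exact ((h3.2.sub h1.2).sub h2.2).mul_left (1 / 2)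

theorem integrableOn_coord [Countable ι] {T : ℝ} {g : ℝ → lp (fun _ : ι => E) 2}
    (hg : MemLp g 2 (volume.restrict (Ioo 0 T))) (k : ι) :
    IntegrableOn (fun s => g s k) (Ioc 0 T) := by
  rw [integrableOn_Ioc_iff_integrableOn_Ioo]
  exact ((hasSum_integral_norm_sq hg).1 k).integrable (by norm_num)

theorem MemLp.norm_pow_eq_integral {α : Type*} [MeasurableSpace α] {μ : Measure α}
    {F : Type*} [NormedAddCommGroup F] {f : α → F} {n : ℕ} (hn : n ≠ 0) (hf : MemLp f n μ) :
    (eLpNorm f n μ).toReal ^ n = ∫ t, ‖f t‖ ^ n ∂μ := by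
  have hn' : (n : ℝ) ≠ 0 := by exact_mod_cast hn
  have h0 : 0 ≤ ∫ t, ‖f t‖ ^ n ∂μ := integral_nonneg fun t => by positivity
  rw [MemLp.eLpNorm_eq_integral_rpow_norm (by exact_mod_cast hn) (by simp) hf]
  simp only [ENNReal.toReal_natCast, Real.rpow_natCast]
  rw [ENNReal.toReal_ofReal (by positivity), ← Real.rpow_natCast, ← Real.rpow_mul h0,
    inv_mul_cancel₀ hn', Real.rpow_one]

end Seq

/-! ### The linear evolution equation -/

section Evolution

variable {ι E : Type*} [NormedAddCommGroup E] [InnerProductSpace ℝ E]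

/-- The coordinates of the solution of `u' + A u = Λ^{1/2} g`, `u(0) = u₀`, where `Λ = 1 + A` is the
diagonal operator with symbol `q ^ 4`. -/
noncomputable def evolMode (q : ι → ℝ) (u₀ : lp (fun _ : ι => E) 2)
    (g : ℝ → lp (fun _ : ι => E) 2) (t : ℝ) (k : ι) : E :=
  modeSol (q k ^ 4 - 1) (u₀ k) (fun s => q k ^ 2 • g s k) t

/-- The constant in the energy estimate on `(0,T)`, as Grönwall's inequality gives it: the modes
are damped by `q ^ 4 - 1` only, and the missing `1` costs a factor `exp (2 T)`. -/
noncomputable def energyConst (T : ℝ) : ℝ := 1 + 2 * T * Real.exp (2 * T)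

theorem energyConst_nonneg {T : ℝ} (hT : 0 ≤ T) : 0 ≤ energyConst T := by
  unfold energyConst; positivity

variable {q : ι → ℝ} {T : ℝ} {u₀ : lp (fun _ : ι => E) 2} {g : ℝ → lp (fun _ : ι => E) 2}

theorem continuousOn_evolMode (hg : ∀ k, IntegrableOn (fun s => g s k) (Ioc 0 T)) (k : ι) :
    ContinuousOn (fun t => evolMode q u₀ g t k) (Icc 0 T) :=
  continuousOn_modeSol (Integrable.smul (q k ^ 2) (hg k))

/-- The squared norm of the data `(u₀, g)` in the mode `k`. -/
noncomputable def modeData (T : ℝ) (u₀ : lp (fun _ : ι => E) 2) (g : ℝ → lp (fun _ : ι => E) 2)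
    (k : ι) : ℝ := ‖u₀ k‖ ^ 2 + ∫ s in Ioo 0 T, ‖g s k‖ ^ 2

omit [InnerProductSpace ℝ E] in
theorem hasSum_modeData [Countable ι] (hg : MemLp g 2 (volume.restrict (Ioo 0 T))) :
    HasSum (modeData T u₀ g) (‖u₀‖ ^ 2 + ∫ s in Ioo 0 T, ‖g s‖ ^ 2) :=
  (hasSum_norm_sq u₀).add (hasSum_integral_norm_sq hg).2

variable [CompleteSpace E]

theorem evolMode_eq (hg : ∀ k, IntegrableOn (fun s => g s k) (Ioc 0 T)) (k : ι) :
    ∀ t ∈ Icc 0 T, evolMode q u₀ g t k =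
      u₀ k + ∫ s in (0 : ℝ)..t, (q k ^ 2 • g s k - (q k ^ 4 - 1) • evolMode q u₀ g s k) :=
  modeSol_eq (Integrable.smul (q k ^ 2) (hg k))

theorem evolMode_bound [Countable ι] (hg : MemLp g 2 (volume.restrict (Ioo 0 T))) (k : ι) :
    ∀ t ∈ Icc 0 T, ‖evolMode q u₀ g t k‖ ^ 2 +
      q k ^ 4 * ∫ s in (0 : ℝ)..t, ‖evolMode q u₀ g s k‖ ^ 2 ≤ energyConst T * modeData T u₀ g k := by
  intro t ht
  have hgk := integrableOn_coord hg
  have h2 : IntegrableOn (fun s => ‖g s k‖ ^ 2) (Ioc 0 T) := by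
    rw [integrableOn_Ioc_iff_integrableOn_Ioo]
    exact ((hasSum_integral_norm_sq hg).1 k).integrable_norm_pow (by norm_num)
  have := mode_bound (β := q k ^ 2) (hgk k) h2 (continuousOn_evolMode (q := q) (u₀ := u₀) hgk k)
    (fun t ht => by rw [← pow_mul]; exact evolMode_eq hgk k t ht) t ht
  rwa [intervalIntegral.integral_of_le (ht.1.trans ht.2), integral_Ioc_eq_integral_Ioo, ← pow_mul]
    at this

/-- The solution of the linear equation, with values in `ℓ²`. -/
noncomputable def evol (q : ι → ℝ) (u₀ : lp (fun _ : ι => E) 2)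
    (g : ℝ → lp (fun _ : ι => E) 2) (t : ℝ) : lp (fun _ : ι => E) 2 :=
  mkSeq (evolMode q u₀ g t)

theorem memlp_evolMode [Countable ι] (hg : MemLp g 2 (volume.restrict (Ioo 0 T))) {t : ℝ}
    (ht : t ∈ Icc 0 T) : Memℓp (evolMode q u₀ g t) 2 := by
  rw [memlp_two_iff]
  refine .of_nonneg_of_le (fun k => by positivity) (fun k => ?_)
    ((hasSum_modeData (u₀ := u₀) hg).summable.mul_left (energyConst T))
  have h1 := evolMode_bound (q := q) (u₀ := u₀) hg k t ht
  have h2 : 0 ≤ q k ^ 4 * ∫ s in (0 : ℝ)..t, ‖evolMode q u₀ g s k‖ ^ 2 :=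
    mul_nonneg (by positivity) (intervalIntegral.integral_nonneg ht.1 fun s _ => by positivity)
  linarith

theorem evol_apply [Countable ι] (hg : MemLp g 2 (volume.restrict (Ioo 0 T))) {t : ℝ}
    (ht : t ∈ Icc 0 T) (k : ι) : evol q u₀ g t k = evolMode q u₀ g t k :=
  mkSeq_apply (memlp_evolMode hg ht) k

theorem norm_evol_sq_le [Countable ι] (hg : MemLp g 2 (volume.restrict (Ioo 0 T))) {t : ℝ}
    (ht : t ∈ Icc 0 T) : ‖evol q u₀ g t‖ ^ 2 ≤
      energyConst T * (‖u₀‖ ^ 2 + ∫ s in Ioo 0 T, ‖g s‖ ^ 2) := by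
  refine hasSum_le (fun k => ?_) (hasSum_norm_sq _)
    ((hasSum_modeData (u₀ := u₀) hg).mul_left (energyConst T))
  rw [evol_apply hg ht]
  have h1 := evolMode_bound (q := q) (u₀ := u₀) hg k t ht
  have h2 : 0 ≤ q k ^ 4 * ∫ s in (0 : ℝ)..t, ‖evolMode q u₀ g s k‖ ^ 2 :=
    mul_nonneg (by positivity) (intervalIntegral.integral_nonneg ht.1 fun s _ => by positivity)
  linarith

theorem evol_zero [Countable ι] (hT : 0 ≤ T) (hg : MemLp g 2 (volume.restrict (Ioo 0 T))) :
    evol q u₀ g 0 = u₀ := by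
  ext k
  rw [evol_apply hg ⟨le_rfl, hT⟩, evolMode_eq (integrableOn_coord hg) k 0 ⟨le_rfl, hT⟩]
  simp

theorem continuousOn_evol [Countable ι] (hg : MemLp g 2 (volume.restrict (Ioo 0 T))) :
    ContinuousOn (evol q u₀ g) (Icc 0 T) := by
  intro t₀ ht₀
  have hb : ∀ t ∈ Icc 0 T, ∀ k, ‖evolMode q u₀ g t k‖ ^ 2 ≤ energyConst T * modeData T u₀ g k := by
    intro t ht k
    have h1 := evolMode_bound (q := q) (u₀ := u₀) hg k t ht
    have h2 : 0 ≤ q k ^ 4 * ∫ s in (0 : ℝ)..t, ‖evolMode q u₀ g s k‖ ^ 2 :=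
      mul_nonneg (by positivity) (intervalIntegral.integral_nonneg ht.1 fun s _ => by positivity)
    linarith
  have hc : ContinuousOn (fun t => ∑' k, ‖evolMode q u₀ g t k - evolMode q u₀ g t₀ k‖ ^ 2)
      (Icc 0 T) := by
    refine continuousOn_tsum (u := fun k => 4 * (energyConst T * modeData T u₀ g k)) (fun k => ?_)
      ((((hasSum_modeData (u₀ := u₀) hg).summable.mul_left _)).mul_left _) fun k t ht => ?_
    · exact ((continuousOn_evolMode (integrableOn_coord hg) k).sub continuousOn_const).norm.pow 2
    · have h1 := hb t ht k
      have h2 := hb t₀ ht₀ k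
      have h3 := norm_sub_le (evolMode q u₀ g t k) (evolMode q u₀ g t₀ k)
      rw [Real.norm_of_nonneg (by positivity)]
      nlinarith [norm_nonneg (evolMode q u₀ g t k - evolMode q u₀ g t₀ k),
        sq_nonneg (‖evolMode q u₀ g t k‖ - ‖evolMode q u₀ g t₀ k‖)]
  have h1 : Tendsto (fun t => ‖evol q u₀ g t - evol q u₀ g t₀‖ ^ 2) (𝓝[Icc 0 T] t₀) (𝓝 0) := by
    have h2 := hc t₀ ht₀
    simp only [ContinuousWithinAt, sub_self, norm_zero, ne_eq, OfNat.ofNat_ne_zero,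
      not_false_eq_true, zero_pow, tsum_zero] at h2
    refine h2.congr' ?_
    filter_upwards [self_mem_nhdsWithin] with t ht
    rw [← (hasSum_norm_sq _).tsum_eq]
    simp only [lp.coeFn_sub, Pi.sub_apply, evol_apply hg ht, evol_apply hg ht₀]
  rw [ContinuousWithinAt, tendsto_iff_norm_sub_tendsto_zero]
  have := h1.sqrt
  simpa using this

/-- `Λ^{1/2} u` for the solution `u` of the linear equation. -/
noncomputable def evolHalf (q : ι → ℝ) (u₀ : lp (fun _ : ι => E) 2)
    (g : ℝ → lp (fun _ : ι => E) 2) (t : ℝ) : lp (fun _ : ι => E) 2 :=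
  mkSeq fun k => q k ^ 2 • evolMode q u₀ g t k

/-- `Λ^{1/4} u` for the solution `u` of the linear equation. -/
noncomputable def evolQuarter (q : ι → ℝ) (u₀ : lp (fun _ : ι => E) 2)
    (g : ℝ → lp (fun _ : ι => E) 2) (t : ℝ) : lp (fun _ : ι => E) 2 :=
  mkSeq fun k => q k • evolMode q u₀ g t k

theorem memLp_evolHalf [Countable ι] (hT : 0 ≤ T) (hg : MemLp g 2 (volume.restrict (Ioo 0 T))) :
    (∀ᵐ t ∂volume.restrict (Ioo 0 T), Memℓp (fun k => q k ^ 2 • evolMode q u₀ g t k) 2) ∧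
      MemLp (evolHalf q u₀ g) 2 (volume.restrict (Ioo 0 T)) ∧
      ∫ t in Ioo 0 T, ‖evolHalf q u₀ g t‖ ^ 2 ≤
        energyConst T * (‖u₀‖ ^ 2 + ∫ s in Ioo 0 T, ‖g s‖ ^ 2) := by
  have hgk := integrableOn_coord hg
  have hc : ∀ k, ContinuousOn (fun t => q k ^ 2 • evolMode q u₀ g t k) (Icc 0 T) := fun k =>
    (continuousOn_evolMode hgk k).const_smul _
  have h := memLp_mkSeq (μ := volume.restrict (Ioo 0 T))
    (c := fun t k => q k ^ 2 • evolMode q u₀ g t k) (fun k => ?_)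
    ((hasSum_modeData (u₀ := u₀) hg).mul_left (energyConst T)).summable (fun k => ?_)
  · rwa [((hasSum_modeData (u₀ := u₀) hg).mul_left (energyConst T)).tsum_eq] at h
  · rw [memLp_two_iff_integrable_sq_norm
      (((hc k).mono Ioo_subset_Icc_self).aestronglyMeasurable measurableSet_Ioo)]
    exact ((hc k).norm.pow 2).integrableOn_Icc.mono_set Ioo_subset_Icc_self
  · have h1 := evolMode_bound (q := q) (u₀ := u₀) hg k T ⟨hT, le_rfl⟩
    rw [intervalIntegral.integral_of_le hT, integral_Ioc_eq_integral_Ioo, ← integral_const_mul] at h1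
    refine le_trans (le_of_eq ?_) ((le_add_of_nonneg_left (by positivity)).trans h1)
    congr 1 with t
    rw [norm_smul, mul_pow, Real.norm_eq_abs, sq_abs]
    ring

theorem evolHalf_ae [Countable ι] (hT : 0 ≤ T) (hg : MemLp g 2 (volume.restrict (Ioo 0 T))) :
    ∀ᵐ t ∂volume.restrict (Ioo 0 T), ∀ k, evolHalf q u₀ g t k = q k ^ 2 • evolMode q u₀ g t k := by
  filter_upwards [(memLp_evolHalf (q := q) (u₀ := u₀) hT hg).1] with t ht k
  exact mkSeq_apply ht k

/-- For almost every `t`, `Λ^{1/4} u` is given by its modes and is bounded by interpolation between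
`u` and `Λ^{1/2} u`. -/
theorem evolQuarter_ae [Countable ι] (hT : 0 ≤ T) (hg : MemLp g 2 (volume.restrict (Ioo 0 T))) :
    ∀ᵐ t ∂volume.restrict (Ioo 0 T),
      (∀ k, evolQuarter q u₀ g t k = q k • evolMode q u₀ g t k) ∧
      ‖evolQuarter q u₀ g t‖ ^ 2 ≤ ‖evol q u₀ g t‖ * ‖evolHalf q u₀ g t‖ := by
  filter_upwards [evolHalf_ae (q := q) (u₀ := u₀) hT hg, ae_restrict_mem measurableSet_Ioo] with t h1 ht
  have h2 := evol_apply (q := q) (u₀ := u₀) hg (Ioo_subset_Icc_self ht)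
  have h3 : HasSum (fun k => ‖q k • evolMode q u₀ g t k‖ ^ 2)
      (inner ℝ (evol q u₀ g t) (evolHalf q u₀ g t)) := by
    have e : (fun k => ‖q k • evolMode q u₀ g t k‖ ^ 2) =
        fun k => inner ℝ (evol q u₀ g t k) (evolHalf q u₀ g t k) := by
      funext k
      rw [h1, h2, real_inner_smul_right, real_inner_self_eq_norm_sq, norm_smul, mul_pow,
        Real.norm_eq_abs, sq_abs]
    rw [e]
    exact lp.hasSum_inner (𝕜 := ℝ) (evol q u₀ g t) (evolHalf q u₀ g t)
  have h4 : Memℓp (fun k => q k • evolMode q u₀ g t k) 2 := memlp_two_iff.2 h3.summable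
  refine ⟨fun k => mkSeq_apply h4 k, ?_⟩
  rw [evolQuarter, norm_mkSeq_sq h4, h3.tsum_eq]
  exact real_inner_le_norm _ _

/-- Interpolation between `L^∞` and `L²` in time: `Λ^{1/4} u` is in `L⁴`. -/
theorem memLp_evolQuarter [Countable ι] (hT : 0 ≤ T) (hg : MemLp g 2 (volume.restrict (Ioo 0 T))) :
    MemLp (evolQuarter q u₀ g) 4 (volume.restrict (Ioo 0 T)) ∧
      (eLpNorm (evolQuarter q u₀ g) 4 (volume.restrict (Ioo 0 T))).toReal ^ 2 ≤
        energyConst T * (‖u₀‖ ^ 2 + ∫ s in Ioo 0 T, ‖g s‖ ^ 2) := by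
  set K := energyConst T * (‖u₀‖ ^ 2 + ∫ s in Ioo 0 T, ‖g s‖ ^ 2) with hK
  obtain ⟨-, hV, hVK⟩ := memLp_evolHalf (q := q) (u₀ := u₀) hT hg
  rw [← hK] at hVK
  have hK0 : 0 ≤ K := le_trans (integral_nonneg fun t => by positivity) hVK
  have hX := evolQuarter_ae (q := q) (u₀ := u₀) hT hg
  have hm : AEStronglyMeasurable (evolQuarter q u₀ g) (volume.restrict (Ioo 0 T)) := by
    refine aestronglyMeasurable_seq fun k => ?_
    refine ((((continuousOn_evolMode (q := q) (u₀ := u₀) (integrableOn_coord hg) k).const_smul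
      (q k)).mono Ioo_subset_Icc_self).aestronglyMeasurable measurableSet_Ioo).congr ?_
    filter_upwards [hX] with t ht using (ht.1 k).symm
  have hb : ∀ᵐ t ∂volume.restrict (Ioo 0 T),
      ‖evolQuarter q u₀ g t‖ ^ 4 ≤ K * ‖evolHalf q u₀ g t‖ ^ 2 := by
    filter_upwards [hX, ae_restrict_mem measurableSet_Ioo] with t h1 ht
    have h2 := norm_evol_sq_le (q := q) (u₀ := u₀) hg (Ioo_subset_Icc_self ht)
    calc ‖evolQuarter q u₀ g t‖ ^ 4 = (‖evolQuarter q u₀ g t‖ ^ 2) ^ 2 := by ring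
      _ ≤ (‖evol q u₀ g t‖ * ‖evolHalf q u₀ g t‖) ^ 2 := by gcongr; exact h1.2
      _ = ‖evol q u₀ g t‖ ^ 2 * ‖evolHalf q u₀ g t‖ ^ 2 := by ring
      _ ≤ _ := by gcongr
  have hVi : Integrable (fun t => K * ‖evolHalf q u₀ g t‖ ^ 2) (volume.restrict (Ioo 0 T)) :=
    (hV.integrable_norm_pow (by norm_num)).const_mul K
  have hXi : Integrable (fun t => ‖evolQuarter q u₀ g t‖ ^ 4) (volume.restrict (Ioo 0 T)) := by
    refine hVi.mono (hm.norm.pow 4) ?_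
    filter_upwards [hb] with t ht
    rw [Real.norm_of_nonneg (by positivity), Real.norm_of_nonneg (by positivity)]
    exact ht
  have hX4 : MemLp (evolQuarter q u₀ g) 4 (volume.restrict (Ioo 0 T)) := by
    rw [← integrable_norm_rpow_iff hm (by norm_num) (by norm_num)]
    simpa only [show (4 : ENNReal).toReal = ((4 : ℕ) : ℝ) by norm_num, Real.rpow_natCast] using hXi
  refine ⟨hX4, ?_⟩
  have h4 := MemLp.norm_pow_eq_integral (n := 4) (by norm_num) hX4
  have h5 : ∫ t in Ioo 0 T, ‖evolQuarter q u₀ g t‖ ^ 4 ≤ K ^ 2 := by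
    refine (integral_mono_ae hXi hVi hb).trans ?_
    rw [integral_const_mul, sq]
    gcongr
  rw [← h4] at h5
  refine le_of_sq_le_sq ?_ hK0
  calc _ = (eLpNorm (evolQuarter q u₀ g) ((4 : ℕ) : ENNReal) (volume.restrict (Ioo 0 T))).toReal ^ 4 := by
        norm_num; ring
    _ ≤ _ := h5

/-- The energy equality for the linear equation. -/
theorem evol_energy [Countable ι] (hg : MemLp g 2 (volume.restrict (Ioo 0 T))) {t : ℝ}
    (ht : t ∈ Icc 0 T) :
    ‖evol q u₀ g t‖ ^ 2 + 2 * ((∫ s in Ioo 0 t, ‖evolHalf q u₀ g s‖ ^ 2) -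
        ∫ s in Ioo 0 t, ‖evol q u₀ g s‖ ^ 2) =
      ‖u₀‖ ^ 2 + 2 * ∫ s in Ioo 0 t, inner ℝ (g s) (evolHalf q u₀ g s) := by
  have hT : 0 ≤ T := ht.1.trans ht.2
  have hsub : Ioo 0 t ⊆ Ioo 0 T := Ioo_subset_Ioo_right ht.2
  have hgt : MemLp g 2 (volume.restrict (Ioo 0 t)) := hg.mono_measure (Measure.restrict_mono hsub le_rfl)
  have hV : MemLp (evolHalf q u₀ g) 2 (volume.restrict (Ioo 0 t)) :=
    (memLp_evolHalf hT hg).2.1.mono_measure (Measure.restrict_mono hsub le_rfl)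
  have hu : MemLp (evol q u₀ g) 2 (volume.restrict (Ioo 0 t)) := by
    have hc := (continuousOn_evol (q := q) (u₀ := u₀) hg)
    rw [memLp_two_iff_integrable_sq_norm ((hc.mono
      (hsub.trans Ioo_subset_Icc_self)).aestronglyMeasurable measurableSet_Ioo)]
    exact (hc.norm.pow 2).integrableOn_Icc.mono_set (hsub.trans Ioo_subset_Icc_self)
  have hVae : ∀ᵐ s ∂volume.restrict (Ioo 0 t), ∀ k,
      evolHalf q u₀ g s k = q k ^ 2 • evolMode q u₀ g s k :=
    ae_restrict_of_ae_restrict_of_subset hsub (evolHalf_ae hT hg)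
  have e1 := (hasSum_norm_sq (evol q u₀ g t)).add
    (((hasSum_integral_norm_sq hV).2.sub (hasSum_integral_norm_sq hu).2).mul_left 2)
  have e2 := (hasSum_norm_sq u₀).add ((hasSum_integral_inner hgt hV).mul_left 2)
  refine e1.unique ?_
  convert e2 using 1
  funext k
  obtain ⟨-, h⟩ := mode_energy (Integrable.smul (q k ^ 2) (integrableOn_coord hg k))
    (continuousOn_evolMode (q := q) (u₀ := u₀) (integrableOn_coord hg) k)
    (evolMode_eq (integrableOn_coord hg) k) t ht
  simp only [Pi.smul_apply] at h
  rw [intervalIntegral.integral_of_le ht.1, intervalIntegral.integral_of_le ht.1,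
    integral_Ioc_eq_integral_Ioo, integral_Ioc_eq_integral_Ioo] at h
  have e3 : ∫ s in Ioo 0 t, ‖evolHalf q u₀ g s k‖ ^ 2 =
      q k ^ 4 * ∫ s in Ioo 0 t, ‖evolMode q u₀ g s k‖ ^ 2 := by
    rw [← integral_const_mul]
    refine integral_congr_ae ?_
    filter_upwards [hVae] with s hs
    rw [hs, norm_smul, mul_pow, Real.norm_eq_abs, sq_abs]; ring
  have e4 : ∫ s in Ioo 0 t, ‖evol q u₀ g s k‖ ^ 2 = ∫ s in Ioo 0 t, ‖evolMode q u₀ g s k‖ ^ 2 := by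
    refine setIntegral_congr_fun measurableSet_Ioo fun s hs => ?_
    simp only [evol_apply hg (Ioo_subset_Icc_self (hsub hs))]
  have e5 : ∫ s in Ioo 0 t, inner ℝ (g s k) (evolHalf q u₀ g s k) =
      ∫ s in Ioo 0 t, inner ℝ (q k ^ 2 • g s k) (evolMode q u₀ g s k) := by
    refine integral_congr_ae ?_
    filter_upwards [hVae] with s hs
    rw [hs, real_inner_smul_left, real_inner_smul_right]
  rw [e3, e4, e5, evol_apply hg ht, ← h]
  ring

omit [CompleteSpace E] in
theorem evolMode_congr {g' : ℝ → lp (fun _ : ι => E) 2} {τ : ℝ}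
    (h : ∀ᵐ s ∂volume.restrict (Ioo 0 τ), g s = g' s) {t : ℝ} (ht : t ∈ Icc 0 τ) :
    evolMode q u₀ g t = evolMode q u₀ g' t := by
  funext k
  simp only [evolMode, modeSol]
  congr 2
  rw [intervalIntegral.integral_of_le ht.1, intervalIntegral.integral_of_le ht.1,
    integral_Ioc_eq_integral_Ioo, integral_Ioc_eq_integral_Ioo]
  refine integral_congr_ae ?_
  filter_upwards [ae_restrict_of_ae_restrict_of_subset (Ioo_subset_Ioo_right ht.2) h] with s hs
  rw [hs]

omit [CompleteSpace E] in
theorem evolMode_add_smul {u₀' : lp (fun _ : ι => E) 2} {g' : ℝ → lp (fun _ : ι => E) 2} (c : ℝ)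
    (hg : ∀ k, IntegrableOn (fun s => g s k) (Ioc 0 T))
    (hg' : ∀ k, IntegrableOn (fun s => g' s k) (Ioc 0 T)) {t : ℝ} (ht : t ∈ Icc 0 T) :
    evolMode q (u₀ + c • u₀') (fun s => g s + c • g' s) t =
      evolMode q u₀ g t + c • evolMode q u₀' g' t := by
  funext k
  have hc : Continuous fun s : ℝ => Real.exp ((q k ^ 4 - 1) * s) := by fun_prop
  have hi : ∀ {g : ℝ → lp (fun _ : ι => E) 2}, (∀ k, IntegrableOn (fun s => g s k) (Ioc 0 T)) →
      IntegrableOn (fun s => Real.exp ((q k ^ 4 - 1) * s) • (q k ^ 2 • g s k)) (Ioc 0 t) := by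
    intro g hg
    exact ((((integrableOn_Icc_iff_integrableOn_Ioc (μ := volume)).2
      (Integrable.smul (q k ^ 2) (hg k))).continuousOn_smul
      hc.continuousOn isCompact_Icc).mono_set Ioc_subset_Icc_self).mono_set
        (Ioc_subset_Ioc_right ht.2)
  simp only [evolMode, modeSol, Pi.add_apply, Pi.smul_apply]
  rw [intervalIntegral.integral_of_le ht.1, intervalIntegral.integral_of_le ht.1,
    intervalIntegral.integral_of_le ht.1, smul_comm c, ← smul_add]
  congr 1
  have e : ∀ s, Real.exp ((q k ^ 4 - 1) * s) • (q k ^ 2 • (g s + c • g' s : lp (fun _ : ι => E) 2) k) =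
      Real.exp ((q k ^ 4 - 1) * s) • (q k ^ 2 • g s k) +
        c • (Real.exp ((q k ^ 4 - 1) * s) • (q k ^ 2 • g' s k)) := by
    intro s
    simp only [lp.coeFn_add, lp.coeFn_smul, Pi.add_apply, Pi.smul_apply, smul_add]
    rw [smul_comm (q k ^ 2) c, smul_comm _ c]
  simp only [e]
  refine (congrArg _ (integral_add (hi hg) (Integrable.smul c (hi hg')))).trans ?_
  simp only [Pi.smul_apply, integral_smul, lp.coeFn_add, lp.coeFn_smul, Pi.add_apply, Pi.smul_apply, smul_add]
  abel

end Evolution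

/-! ### Causal quadratic equations in Banach spaces -/

section Quadratic

variable {𝓧 : Type*} [NormedAddCommGroup 𝓧] [NormedSpace ℝ 𝓧]

/-- The factorisation of a difference of squares, for bilinear operators. -/
theorem bilin_self_sub (B : 𝓧 →L[ℝ] 𝓧 →L[ℝ] 𝓧) (x y : 𝓧) :
    B x x - B y y = B (x - y) x + B y (x - y) := by
  simp only [map_sub, sub_apply]; abel

/-- A quadratic equation with small data has a solution. -/
theorem exists_eq_sub_quadratic [CompleteSpace 𝓧] (B : 𝓧 →L[ℝ] 𝓧 →L[ℝ] 𝓧) (J : 𝓧 →L[ℝ] 𝓧)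
    (hJ : ‖J‖ ≤ 1) {y : 𝓧} (hy : 4 * ‖B‖ * ‖y‖ < 1) : ∃ z, z = y - J (B z z) := by
  set R := 2 * ‖y‖ with hR
  have hR0 : 0 ≤ R := by positivity
  set F : 𝓧 → 𝓧 := fun z => y - J (B z z) with hF
  have hJB : ∀ x, ‖J x‖ ≤ ‖x‖ := fun x =>
    (J.le_opNorm x).trans (by nlinarith [norm_nonneg x, norm_nonneg J])
  have hmaps : MapsTo F (Metric.closedBall 0 R) (Metric.closedBall 0 R) := by
    intro z hz
    rw [mem_closedBall_zero_iff] at hz ⊢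
    have h1 : ‖B z z‖ ≤ ‖B‖ * R * R := (B.le_opNorm₂ z z).trans (by gcongr)
    calc ‖F z‖ ≤ ‖y‖ + ‖J (B z z)‖ := norm_sub_le _ _
      _ ≤ ‖y‖ + ‖B‖ * R * R := by gcongr; exact (hJB _).trans h1
      _ ≤ R := by rw [hR] at *; nlinarith [norm_nonneg y, norm_nonneg B]
  have hK0 : 0 ≤ 2 * ‖B‖ * R := by positivity
  obtain ⟨κ, hκ⟩ : ∃ κ : NNReal, (κ : ℝ) = 2 * ‖B‖ * R := ⟨⟨_, hK0⟩, rfl⟩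
  have hcontr : ContractingWith κ (hmaps.restrict F _ _) := by
    refine ⟨?_, LipschitzWith.of_dist_le_mul fun x z => ?_⟩
    · rw [← NNReal.coe_lt_coe]
      rw [hκ, hR, NNReal.coe_one]
      linarith
    · rw [Subtype.dist_eq, Subtype.dist_eq]
      simp only [MapsTo.val_restrict_apply, hF, dist_eq_norm, hκ]
      have hx := mem_closedBall_zero_iff.1 x.2
      have hz := mem_closedBall_zero_iff.1 z.2
      rw [sub_sub_sub_cancel_left, ← map_sub, bilin_self_sub, norm_sub_rev (x : 𝓧)]
      refine (hJB _).trans ((norm_add_le _ _).trans ?_)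
      have h1 := B.le_opNorm₂ ((z : 𝓧) - x) z
      have h2 := B.le_opNorm₂ (x : 𝓧) ((z : 𝓧) - x)
      have h3 : ‖B‖ * ‖(z : 𝓧) - x‖ * ‖(z : 𝓧)‖ ≤ ‖B‖ * ‖(z : 𝓧) - x‖ * R := by gcongr
      have h4 : ‖B‖ * ‖(x : 𝓧)‖ * ‖(z : 𝓧) - x‖ ≤ ‖B‖ * R * ‖(z : 𝓧) - x‖ := by gcongr
      linarith
  obtain ⟨z, -, hz, -⟩ := hcontr.exists_fixedPoint' Metric.isClosed_closedBall.isComplete hmaps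
    (x := 0) (by simpa using hR0) (edist_ne_top _ _)
  exact ⟨z, hz.symm⟩

/-- A causal structure on a Banach space of functions on `(0,T)`, as for an `L⁴` space: `D σ` is
the restriction of functions to `(0,σ)`, and `B` is a bilinear operator whose values on `(0,σ)`
only depend on the values of its arguments on `(0,σ)`, and which vanishes on functions with disjoint
supports. -/
structure IsCausal (T : ℝ) (D : ℝ → 𝓧 →L[ℝ] 𝓧) (B : 𝓧 →L[ℝ] 𝓧 →L[ℝ] 𝓧) : Prop where
  zero : ∀ x, D 0 x = 0
  top : ∀ x, D T x = x
  comp : ∀ σ τ x, D σ (D τ x) = D (min σ τ) x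
  norm_pow : ∀ σ τ x, σ ≤ τ → ‖D τ x - D σ x‖ ^ 4 + ‖D σ x‖ ^ 4 = ‖D τ x‖ ^ 4
  cont : ∀ x, ContinuousOn (fun σ => ‖D σ x‖ ^ 4) (Icc 0 T)
  causal : ∀ σ x y, D σ (B x y) = D σ (B (D σ x) (D σ y))
  disj : ∀ σ x z, D σ x = x → D σ z = 0 → B x z = 0 ∧ B z x = 0

namespace IsCausal

variable {T : ℝ} {D : ℝ → 𝓧 →L[ℝ] 𝓧} {B : 𝓧 →L[ℝ] 𝓧 →L[ℝ] 𝓧} (h : IsCausal T D B)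
include h

theorem comm (σ τ : ℝ) (x : 𝓧) : D σ (D τ x) = D τ (D σ x) := by
  rw [h.comp, h.comp, min_comm]

theorem comp_of_le {σ τ : ℝ} (hστ : σ ≤ τ) (x : 𝓧) : D σ (D τ x) = D σ x := by
  rw [h.comp, min_eq_left hστ]

theorem idem (σ : ℝ) (x : 𝓧) : D σ (D σ x) = D σ x := h.comp_of_le le_rfl x

theorem norm_le {σ : ℝ} (hσ : σ ≤ T) (x : 𝓧) : ‖D σ x‖ ≤ ‖x‖ := by
  have := h.norm_pow σ T x hσ
  rw [h.top] at this
  refine le_of_pow_le_pow_left₀ (n := 4) (by norm_num) (norm_nonneg _) ?_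
  rw [← this]
  exact le_add_of_nonneg_left (by positivity)

theorem norm_sub_le_norm {σ τ : ℝ} (hστ : σ ≤ τ) (hτ : τ ≤ T) (x : 𝓧) :
    ‖D τ x - D σ x‖ ≤ ‖x‖ := by
  refine le_of_pow_le_pow_left₀ (n := 4) (by norm_num) (norm_nonneg _) ?_
  have h1 := h.norm_pow σ τ x hστ
  have h2 : ‖D τ x‖ ^ 4 ≤ ‖x‖ ^ 4 := by gcongr; exact h.norm_le hτ x
  have h3 : 0 ≤ ‖D σ x‖ ^ 4 := by positivity
  linarith

theorem continuousOn (x : 𝓧) : ContinuousOn (fun σ => D σ x) (Icc 0 T) := by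
  intro σ hσ
  have h1 : Tendsto (fun τ => |‖D τ x‖ ^ 4 - ‖D σ x‖ ^ 4|) (𝓝[Icc 0 T] σ) (𝓝 0) := by
    have := (Tendsto.sub (h.cont x σ hσ) (tendsto_const_nhds (x := ‖D σ x‖ ^ 4))).abs
    simpa using this
  have h2 : ∀ τ, ‖D τ x - D σ x‖ ^ 4 = |‖D τ x‖ ^ 4 - ‖D σ x‖ ^ 4| := by
    intro τ
    rcases le_total σ τ with hle | hle
    · rw [← h.norm_pow σ τ x hle, add_sub_cancel_right, abs_of_nonneg (by positivity)]
    · rw [← h.norm_pow τ σ x hle, norm_sub_rev, abs_sub_comm, add_sub_cancel_right,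
        abs_of_nonneg (by positivity)]
  rw [ContinuousWithinAt, tendsto_iff_norm_sub_tendsto_zero]
  have h3 : Tendsto (fun τ => ‖D τ x - D σ x‖ ^ 4) (𝓝[Icc 0 T] σ) (𝓝 0) := by
    simpa only [h2] using h1
  have h4 := h3.sqrt.sqrt
  simp only [Real.sqrt_zero] at h4
  refine h4.congr fun τ => ?_
  rw [show ‖D τ x - D σ x‖ ^ 4 = (‖D τ x - D σ x‖ ^ 2) ^ 2 by ring, Real.sqrt_sq (by positivity),
    Real.sqrt_sq (norm_nonneg _)]

/-- The variation of `σ ↦ D σ x` is small on the right of `σ`. -/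
theorem eventually_small (x : 𝓧) {σ : ℝ} (hσ : σ ∈ Ico 0 T) {δ : ℝ} (hδ : 0 < δ) :
    ∀ᶠ τ in 𝓝[>] σ, ‖D τ x - D σ x‖ < δ := by
  have h1 := (h.continuousOn x σ ⟨hσ.1, hσ.2.le⟩).mono_of_mem_nhdsWithin
    (t := Icc 0 T) (s := Ioi σ) (mem_of_superset (Ioc_mem_nhdsGT hσ.2)
      fun z hz => ⟨hσ.1.trans hz.1.le, hz.2⟩)
  rw [ContinuousWithinAt, tendsto_iff_norm_sub_tendsto_zero] at h1
  exact h1.eventually_lt_const hδ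

/-- Two solutions up to time `τ` coincide. If their difference vanishes on `(0,σ)`, then on a slightly
longer interval it only interacts with the increments of the solutions after `σ`, which are small, so
that it is bounded by a fraction of itself. Hence the times up to which it vanishes form a set which
is closed and open to the right. -/
theorem unique {Y X₁ X₂ : 𝓧} {τ : ℝ} (hτ : τ ≤ T) (h₁ : X₁ = D τ (Y - B X₁ X₁))
    (h₂ : X₂ = D τ (Y - B X₂ X₂)) : X₁ = X₂ := by
  set W := X₁ - X₂ with hW
  have hWeq : W = -D τ (B W X₁ + B X₂ W) := by
    rw [hW, ← bilin_self_sub, ← map_neg, neg_sub]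
    conv_lhs => rw [h₁, h₂]
    rw [← map_sub]
    congr 1
    abel
  rcases lt_or_ge T 0 with hT | hT
  · have h0 := h.comp_of_le hT.le X₁
    have h0' := h.comp_of_le hT.le X₂
    simp only [h.zero, h.top] at h0 h0'
    rw [← h0, ← h0']
  suffices hs : Icc 0 T ⊆ {σ | D σ W = 0} by
    have := hs ⟨hT, le_rfl⟩
    rw [mem_ofPred_eq, h.top, hW, sub_eq_zero] at this
    exact this
  refine IsClosed.Icc_subset_of_forall_mem_nhdsWithin ?_ (h.zero W) ?_
  · rw [inter_comm]
    exact (h.continuousOn W).preimage_isClosed_of_isClosed isClosed_Icc isClosed_singleton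
  · rintro σ ⟨hσ, hσT⟩
    change D σ W = 0 at hσ
    have hδ : 0 < 1 / (2 * (‖B‖ + 1)) := by positivity
    filter_upwards [h.eventually_small X₁ hσT hδ, h.eventually_small X₂ hσT hδ,
      Ioc_mem_nhdsGT hσT.2] with σ' s1 s2 hσ'
    set w := D σ' W with hw
    have hσw : D σ w = 0 := by rw [hw, h.comp_of_le hσ'.1.le, hσ]
    have e1 : B w (D σ' X₁) = B w (D σ' X₁ - D σ X₁) := by
      rw [map_sub, (h.disj σ (D σ X₁) w (h.idem _ _) hσw).2, sub_zero]
    have e2 : B (D σ' X₂) w = B (D σ' X₂ - D σ X₂) w := by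
      rw [map_sub, sub_apply, (h.disj σ (D σ X₂) w (h.idem _ _) hσw).1, sub_zero]
    have e3 : w = -D τ (D σ' (B w (D σ' X₁ - D σ X₁) + B (D σ' X₂ - D σ X₂) w)) := by
      rw [← e1, ← e2, map_add (D σ'), ← h.causal σ', ← h.causal σ', ← map_add (D σ'), h.comm τ σ',
        ← map_neg, ← hWeq]
    have e4 : ‖w‖ ≤ ‖B w (D σ' X₁ - D σ X₁) + B (D σ' X₂ - D σ X₂) w‖ := by
      conv_lhs => rw [e3, norm_neg]
      exact (h.norm_le hτ _).trans (h.norm_le hσ'.2 _)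
    have e5 : ‖w‖ ≤ ‖B‖ * ‖w‖ * (1 / (2 * (‖B‖ + 1))) + ‖B‖ * (1 / (2 * (‖B‖ + 1))) * ‖w‖ := by
      refine e4.trans ((norm_add_le _ _).trans (add_le_add ?_ ?_))
      · exact (B.le_opNorm₂ _ _).trans (by gcongr)
      · exact (B.le_opNorm₂ _ _).trans (by gcongr)
    have e6 : ‖B‖ * ‖w‖ * (1 / (2 * (‖B‖ + 1))) + ‖B‖ * (1 / (2 * (‖B‖ + 1))) * ‖w‖ =
        ‖w‖ * (‖B‖ / (‖B‖ + 1)) := by field_simp; ring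
    have e7 : ‖B‖ / (‖B‖ + 1) < 1 := by
      rw [div_lt_one (by positivity)]; linarith
    rw [e6] at e5
    by_contra hne
    have : 0 < ‖w‖ := norm_pos_iff.2 hne
    nlinarith

theorem restrict {Y X : 𝓧} {σ τ : ℝ} (hσ : σ ≤ τ) (hX : X = D τ (Y - B X X)) :
    D σ X = D σ (Y - B (D σ X) (D σ X)) := by
  conv_lhs => rw [hX]
  rw [h.comp_of_le hσ, map_sub, map_sub, h.causal σ X X]

/-- Local solvability: a solution up to time `τ` extends beyond `τ`. The equation for the
increment `z`, which lives on `(τ,σ)`, has small data if `σ` is close to `τ`, and no linear terms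
because `B` vanishes on `X` and `z`, whose supports are disjoint. -/
theorem extend [CompleteSpace 𝓧] {Y X : 𝓧} {τ : ℝ} (hτ : τ ∈ Ico 0 T)
    (hX : X = D τ (Y - B X X)) : ∃ τ' ∈ Ioc τ T, ∃ X', X' = D τ' (Y - B X' X') := by
  set y := Y - B X X with hy
  have hδ : 0 < 1 / (4 * (‖B‖ + 1)) := by positivity
  obtain ⟨σ, hs, hσ⟩ := ((h.eventually_small y hτ hδ).and (Ioc_mem_nhdsGT hτ.2)).exists
  refine ⟨σ, hσ, ?_⟩
  have hJ : ‖D σ - D τ‖ ≤ 1 := ContinuousLinearMap.opNorm_le_bound _ zero_le_one fun x => by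
    rw [one_mul]; exact h.norm_sub_le_norm hσ.1.le hσ.2 x
  obtain ⟨z, hz⟩ := exists_eq_sub_quadratic B (D σ - D τ) hJ (y := D σ y - D τ y) (by
    have h1 : ‖B‖ * ‖D σ y - D τ y‖ ≤ ‖B‖ * (1 / (4 * (‖B‖ + 1))) := by gcongr
    have h2 : ‖B‖ * (1 / (4 * (‖B‖ + 1))) < 1 / 4 := by
      rw [mul_one_div, div_lt_div_iff₀ (by positivity) (by norm_num)]; linarith
    linarith)
  have hzJ : z = (D σ - D τ) (y - B z z) := by rw [map_sub (D σ - D τ)]; exact hz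
  rw [sub_apply] at hzJ
  have hz0 : D τ z = 0 := by
    rw [hzJ, map_sub, h.comp_of_le hσ.1.le, h.idem, sub_self]
  have hX1 : D τ X = X := by conv_lhs => rw [hX, h.idem, ← hX]
  obtain ⟨d1, d2⟩ := h.disj τ X z hX1 hz0
  have d3 : D τ (B z z) = 0 := by rw [h.causal, hz0]; simp
  refine ⟨X + z, ?_⟩
  have e1 : Y - B (X + z) (X + z) = y - B z z := by
    simp only [map_add, add_apply, d1, d2, hy]; abel
  rw [e1]
  have e2 : D τ (y - B z z) = X := by rw [map_sub, d3, sub_zero, ← hX]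
  conv_lhs => rw [hzJ, e2]
  abel

/-- Global solvability of a causal quadratic equation under an a priori bound: the solutions on
shorter intervals are restrictions of the solutions on longer ones, so that they converge at the
end `s` of the maximal interval, and `s < T` contradicts local solvability. -/
theorem exists_solution [CompleteSpace 𝓧] (hT : 0 ≤ T) {Y : 𝓧} {K : ℝ}
    (hK : ∀ τ ∈ Icc 0 T, ∀ X, X = D τ (Y - B X X) → ‖X‖ ≤ K) : ∃ X, X = Y - B X X := by
  set A : Set ℝ := {τ | τ ∈ Icc 0 T ∧ ∃ X, X = D τ (Y - B X X)} with hA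
  have hA0 : (0 : ℝ) ∈ A := ⟨⟨le_rfl, hT⟩, 0, by rw [h.zero]⟩
  have hAb : BddAbove A := ⟨T, fun τ hτ => hτ.1.2⟩
  set s := sSup A with hs
  have hsI : s ∈ Icc 0 T := ⟨le_csSup hAb hA0, csSup_le ⟨0, hA0⟩ fun τ hτ => hτ.1.2⟩
  obtain ⟨τ, hτm, hτs, hτA⟩ := exists_seq_tendsto_sSup ⟨0, hA0⟩ hAb
  have hτI : ∀ n, τ n ∈ Icc 0 T := fun n => (hτA n).1
  choose X hX using fun n => (hτA n).2
  have hcompat : ∀ n m, n ≤ m → D (τ n) (X m) = X n := fun n m hnm =>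
    h.unique (hτI n).2 (h.restrict (hτm hnm) (hX m)) (hX n)
  have hDX : ∀ n, D (τ n) (X n) = X n := fun n => hcompat n n le_rfl
  -- the fourth powers of the norms add up over disjoint intervals, so bounded means Cauchy
  have hdiff : ∀ n m, n ≤ m → ‖X m - X n‖ ^ 4 = ‖X m‖ ^ 4 - ‖X n‖ ^ 4 := by
    intro n m hnm
    have := h.norm_pow (τ n) (τ m) (X m) (hτm hnm)
    rw [hcompat n m hnm, hDX] at this
    linarith
  have hmono : Monotone fun n => ‖X n‖ ^ 4 := fun n m hnm => by
    have h1 := hdiff n m hnm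
    have h2 : 0 ≤ ‖X m - X n‖ ^ 4 := by positivity
    simp only; linarith
  have hbdd : BddAbove (range fun n => ‖X n‖ ^ 4) := ⟨K ^ 4, by
    rintro _ ⟨n, rfl⟩
    have := hK _ (hτI n) _ (hX n)
    simp only; gcongr⟩
  have hcau : CauchySeq X := by
    have h1 := (tendsto_atTop_ciSup hmono hbdd).cauchySeq
    rw [Metric.cauchySeq_iff'] at h1 ⊢
    intro ε hε
    obtain ⟨N, hN⟩ := h1 (ε ^ 4) (by positivity)
    refine ⟨N, fun n hn => ?_⟩
    have h2 := hN n hn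
    rw [Real.dist_eq, ← hdiff N n hn, abs_of_nonneg (by positivity)] at h2
    rw [dist_eq_norm]
    exact lt_of_pow_lt_pow_left₀ 4 hε.le h2
  obtain ⟨Z, hZ⟩ := cauchySeq_tendsto_of_complete hcau
  have hZeq : Z = D s (Y - B Z Z) := by
    have hΦ : Tendsto (fun n => Y - B (X n) (X n)) atTop (𝓝 (Y - B Z Z)) :=
      tendsto_const_nhds.sub ((B.continuous₂.tendsto (Z, Z)).comp (hZ.prodMk_nhds hZ))
    have h1 : Tendsto (fun n => D (τ n) (Y - B Z Z)) atTop (𝓝 (D s (Y - B Z Z))) := by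
      refine (h.continuousOn (Y - B Z Z) s hsI).tendsto.comp ?_
      exact tendsto_nhdsWithin_iff.2 ⟨hτs, .of_forall hτI⟩
    have h2 : Tendsto (fun n => D (τ n) (Y - B (X n) (X n) - (Y - B Z Z))) atTop (𝓝 0) := by
      refine squeeze_zero_norm (fun n => h.norm_le (hτI n).2 _) ?_
      have := (hΦ.sub_const (Y - B Z Z)).norm
      simpa using this
    refine tendsto_nhds_unique hZ ?_
    have h3 := h2.add h1
    rw [zero_add] at h3
    refine h3.congr fun n => ?_
    conv_rhs => rw [hX n]
    rw [← map_add, sub_add_cancel]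
  rcases eq_or_lt_of_le hsI.2 with hsT | hsT
  · exact ⟨Z, by rw [hsT, h.top] at hZeq; exact hZeq⟩
  · obtain ⟨τ', hτ', X', hX'⟩ := h.extend ⟨hsI.1, hsT⟩ hZeq
    exact absurd (le_csSup hAb ⟨⟨hsI.1.trans hτ'.1.le, hτ'.2⟩, X', hX'⟩) hτ'.1.not_ge

end IsCausal

end Quadratic

/-! ### The abstract hyper-viscous evolution equation -/

section Cut

instance : Fact ((1 : ENNReal) ≤ 4) := ⟨by norm_num⟩

theorem Lp_norm_pow_four {F : Type*} [NormedAddCommGroup F] {α : Type*} [MeasurableSpace α] {μ : Measure α} (x : Lp F 4 μ) :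
    Integrable (fun t => ‖x t‖ ^ 4) μ ∧ ‖x‖ ^ 4 = ∫ t, ‖x t‖ ^ 4 ∂μ := by
  have hx : MemLp x ((4 : ℕ) : ENNReal) μ := Lp.memLp x
  exact ⟨hx.integrable_norm_pow (by norm_num), by
    rw [← MemLp.norm_pow_eq_integral (by norm_num) hx, Lp.norm_def]; rfl⟩

variable {F : Type*} [NormedAddCommGroup F] [NormedSpace ℝ F]

/-- Restriction of functions on `(0,T)` to `(0,σ)`, extended by zero. -/
noncomputable def cut (F : Type*) [NormedAddCommGroup F] [NormedSpace ℝ F] (T σ : ℝ) :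
    Lp F 4 (volume.restrict (Ioo (0 : ℝ) T)) →L[ℝ] Lp F 4 (volume.restrict (Ioo (0 : ℝ) T)) :=
  LinearMap.mkContinuous
    { toFun := fun x => ((Lp.memLp x).indicator (measurableSet_Iio (a := σ))).toLp
      map_add' := fun x y => by
        ext1
        filter_upwards [((Lp.memLp (x + y)).indicator (measurableSet_Iio (a := σ))).coeFn_toLp,
          ((Lp.memLp x).indicator (measurableSet_Iio (a := σ))).coeFn_toLp,
          ((Lp.memLp y).indicator (measurableSet_Iio (a := σ))).coeFn_toLp, Lp.coeFn_add x y,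
          Lp.coeFn_add ((Lp.memLp x).indicator (measurableSet_Iio (a := σ))).toLp
            ((Lp.memLp y).indicator (measurableSet_Iio (a := σ))).toLp] with t h1 h2 h3 h4 h5
        rw [h1, h5, Pi.add_apply, h2, h3]
        by_cases ht : t ∈ Iio σ
        · simp only [indicator_of_mem ht]; exact h4
        · simp only [indicator_of_notMem ht, add_zero]
      map_smul' := fun c x => by
        ext1
        filter_upwards [((Lp.memLp (c • x)).indicator (measurableSet_Iio (a := σ))).coeFn_toLp,
          ((Lp.memLp x).indicator (measurableSet_Iio (a := σ))).coeFn_toLp, Lp.coeFn_smul c x,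
          Lp.coeFn_smul c ((Lp.memLp x).indicator (measurableSet_Iio (a := σ))).toLp] with t h1 h2 h3 h4
        rw [h1, RingHom.id_apply, h4, Pi.smul_apply, h2]
        by_cases ht : t ∈ Iio σ
        · simp only [indicator_of_mem ht]; exact h3
        · simp only [indicator_of_notMem ht, smul_zero] } 1
    fun x => by
      rw [one_mul]
      refine Lp.norm_le_norm_of_ae_le ?_
      filter_upwards [((Lp.memLp x).indicator (measurableSet_Iio (a := σ))).coeFn_toLp] with t h1
      rw [LinearMap.coe_mk, AddHom.coe_mk, h1]
      exact norm_indicator_le_norm_self _ _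

theorem coeFn_cut {T : ℝ} (σ : ℝ) (x : Lp F 4 (volume.restrict (Ioo (0 : ℝ) T))) :
    cut F T σ x =ᵐ[volume.restrict (Ioo 0 T)] (Iio σ).indicator x :=
  ((Lp.memLp x).indicator (measurableSet_Iio (a := σ))).coeFn_toLp

theorem norm_cut_pow_four {T σ : ℝ} (hσ : σ ≤ T) (x : Lp F 4 (volume.restrict (Ioo (0 : ℝ) T))) :
    ‖cut F T σ x‖ ^ 4 = ∫ t in Ioo 0 σ, ‖x t‖ ^ 4 := by
  rw [(Lp_norm_pow_four _).2]
  have h1 : ∫ t in Ioo 0 T, ‖cut F T σ x t‖ ^ 4 = ∫ t in Ioo 0 T, (Iio σ).indicator (fun t => ‖x t‖ ^ 4) t := by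
    refine integral_congr_ae ?_
    filter_upwards [coeFn_cut σ x] with t ht
    rw [ht]
    by_cases h : t ∈ Iio σ <;> simp [h]
  rw [h1, integral_indicator measurableSet_Iio, Measure.restrict_restrict measurableSet_Iio]
  congr 2
  ext t
  simp only [mem_inter_iff, mem_Iio, mem_Ioo]
  constructor
  · rintro ⟨a, b, -⟩; exact ⟨b, a⟩
  · rintro ⟨a, b⟩; exact ⟨b, a, b.trans_le hσ⟩

end Cut

section Abstract

variable {ι E : Type*} [Countable ι] [NormedAddCommGroup E] [InnerProductSpace ℝ E] [CompleteSpace E]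
  {q : ι → ℝ} {T : ℝ}

theorem evolQuarter_add_smul (hT : 0 ≤ T) {u₀ u₀' : lp (fun _ : ι => E) 2}
    {g g' : ℝ → lp (fun _ : ι => E) 2} (c : ℝ)
    (hg : MemLp g 2 (volume.restrict (Ioo 0 T))) (hg' : MemLp g' 2 (volume.restrict (Ioo 0 T))) :
    ∀ᵐ t ∂volume.restrict (Ioo 0 T), evolQuarter q (u₀ + c • u₀') (fun s => g s + c • g' s) t =
      evolQuarter q u₀ g t + c • evolQuarter q u₀' g' t := by
  filter_upwards [evolQuarter_ae (q := q) (u₀ := u₀) hT hg, evolQuarter_ae (q := q) (u₀ := u₀') hT hg',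
    evolQuarter_ae (q := q) (u₀ := u₀ + c • u₀') hT (hg.add (hg'.const_smul c)),
    ae_restrict_mem measurableSet_Ioo] with t h1 h2 h3 ht
  ext k
  have h4 := congrFun (evolMode_add_smul (q := q) (u₀ := u₀) (u₀' := u₀') c (integrableOn_coord hg)
    (integrableOn_coord hg') (Ioo_subset_Icc_self ht)) k
  refine (h3.1 k).trans ?_
  refine (congrArg (fun e => q k • e) h4).trans ?_
  rw [lp.coeFn_add, lp.coeFn_smul]
  simp only [Pi.add_apply, Pi.smul_apply]
  rw [h1.1, h2.1, smul_add, smul_comm c]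

omit [Countable ι] [CompleteSpace E] in
theorem evolQuarter_congr {u₀ : lp (fun _ : ι => E) 2}
    {g g' : ℝ → lp (fun _ : ι => E) 2} {τ : ℝ}
    (h : ∀ᵐ s ∂volume.restrict (Ioo 0 τ), g s = g' s) {t : ℝ} (ht : t ∈ Icc 0 τ) :
    evolQuarter q u₀ g t = evolQuarter q u₀ g' t := by
  simp only [evolQuarter, evolMode_congr h ht]

/-- Duhamel's operator `g ↦ Λ^{1/4} u`, where `u' + A u = Λ^{1/2} g` and `u(0) = 0`. -/
noncomputable def duhamel (q : ι → ℝ) (hT : 0 ≤ T) :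
    Lp (lp (fun _ : ι => E) 2) 2 (volume.restrict (Ioo 0 T)) →L[ℝ]
      Lp (lp (fun _ : ι => E) 2) 4 (volume.restrict (Ioo 0 T)) :=
  have key : ∀ (c : ℝ) (x y : Lp (lp (fun _ : ι => E) 2) 2 (volume.restrict (Ioo 0 T))),
      (memLp_evolQuarter (q := q) (u₀ := 0) hT (Lp.memLp (x + c • y))).1.toLp =
      (memLp_evolQuarter (q := q) (u₀ := 0) hT (Lp.memLp x)).1.toLp +
        c • (memLp_evolQuarter (q := q) (u₀ := 0) hT (Lp.memLp y)).1.toLp := by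
    intro c x y
    rw [← MemLp.toLp_const_smul, ← MemLp.toLp_add, MemLp.toLp_eq_toLp_iff]
    have h1 : ∀ᵐ t ∂volume.restrict (Ioo 0 T), (x + c • y : Lp (lp (fun _ : ι => E) 2) 2
        (volume.restrict (Ioo 0 T))) t = x t + c • y t := by
      filter_upwards [Lp.coeFn_add x (c • y), Lp.coeFn_smul c y] with t h1 h2
      rw [h1, Pi.add_apply, h2, Pi.smul_apply]
    filter_upwards [evolQuarter_add_smul (q := q) (u₀ := 0) (u₀' := 0) hT c (Lp.memLp x) (Lp.memLp y),
      ae_restrict_mem measurableSet_Ioo] with t h2 ht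
    rw [evolQuarter_congr h1 (Ioo_subset_Icc_self ht)]
    simpa using h2
  LinearMap.mkContinuous
    { toFun := fun g => (memLp_evolQuarter (q := q) (u₀ := 0) hT (Lp.memLp g)).1.toLp
      map_add' := fun x y => by simpa using key 1 x y
      map_smul' := fun c y => by
        have h0 := key 1 0 0
        simp only [one_smul, add_zero, left_eq_add] at h0
        have := key c 0 y
        rw [h0, zero_add] at this
        simpa using this } (√(energyConst T))
    fun g => by
      have h1 := (memLp_evolQuarter (q := q) (u₀ := 0) hT (Lp.memLp g)).2
      have h2 := MemLp.norm_pow_eq_integral (n := 2) (by norm_num) (Lp.memLp g)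
      simp only [LinearMap.coe_mk, AddHom.coe_mk]
      rw [Lp.norm_toLp, Lp.norm_def]
      rw [← h2, norm_zero, zero_pow (by norm_num), zero_add] at h1
      refine le_of_pow_le_pow_left₀ (n := 2) (by norm_num) (by positivity) (h1.trans ?_)
      rw [mul_pow, Real.sq_sqrt (energyConst_nonneg hT)]
      rfl

theorem coeFn_duhamel (hT : 0 ≤ T) (g : Lp (lp (fun _ : ι => E) 2) 2 (volume.restrict (Ioo 0 T))) :
    duhamel q hT g =ᵐ[volume.restrict (Ioo 0 T)] evolQuarter q 0 g :=
  (memLp_evolQuarter (q := q) (u₀ := 0) hT (Lp.memLp g)).1.coeFn_toLp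

instance : ENNReal.HolderTriple 4 4 2 where
  inv_add_inv_eq_inv := by
    rw [show (4 : ENNReal) = 2 * 2 by norm_num, ENNReal.mul_inv (by simp) (by simp), ← mul_add,
      ENNReal.inv_two_add_inv_two, mul_one]

variable (N : lp (fun _ : ι => E) 2 →L[ℝ] lp (fun _ : ι => E) 2 →L[ℝ] lp (fun _ : ι => E) 2)

/-- The bilinear operator of the mild formulation: Duhamel's operator applied to `N (x, y)`. -/
noncomputable def mildBilin (q : ι → ℝ) (hT : 0 ≤ T) :
    Lp (lp (fun _ : ι => E) 2) 4 (volume.restrict (Ioo 0 T)) →L[ℝ]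
      Lp (lp (fun _ : ι => E) 2) 4 (volume.restrict (Ioo 0 T)) →L[ℝ]
      Lp (lp (fun _ : ι => E) 2) 4 (volume.restrict (Ioo 0 T)) :=
  (ContinuousLinearMap.compL ℝ _ _ _ (duhamel q hT)) ∘L
    (N.holderL (volume.restrict (Ioo 0 T)) 4 4 2)

theorem mildBilin_apply (hT : 0 ≤ T)
    (x y : Lp (lp (fun _ : ι => E) 2) 4 (volume.restrict (Ioo 0 T))) :
    mildBilin N q hT x y = duhamel q hT (N.holder 2 x y) := rfl

theorem coeFn_mildBilin (hT : 0 ≤ T)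
    (x y : Lp (lp (fun _ : ι => E) 2) 4 (volume.restrict (Ioo 0 T))) :
    ∀ᵐ t ∂volume.restrict (Ioo 0 T), mildBilin N q hT x y t =
      evolQuarter q 0 (fun s => N (x s) (y s)) t := by
  rw [mildBilin_apply]
  filter_upwards [coeFn_duhamel (q := q) hT (N.holder 2 x y), ae_restrict_mem measurableSet_Ioo]
    with t h1 ht
  rw [h1, evolQuarter_congr (N.coeFn_holder x y) (Ioo_subset_Icc_self ht)]

theorem isCausal_mildBilin (hT : 0 ≤ T) :
    IsCausal T (cut (lp (fun _ : ι => E) 2) T) (mildBilin N q hT) where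
  zero x := by
    ext1
    filter_upwards [coeFn_cut 0 x, Lp.coeFn_zero (lp (fun _ : ι => E) 2) 4
      (volume.restrict (Ioo 0 T)), ae_restrict_mem measurableSet_Ioo] with t h1 h2 ht
    rw [h1, h2, indicator_of_notMem (by simp [ht.1.le]), Pi.zero_apply]
  top x := by
    ext1
    filter_upwards [coeFn_cut T x, ae_restrict_mem measurableSet_Ioo] with t h1 ht
    rw [h1, indicator_of_mem (by simp [ht.2])]
  comp σ τ x := by
    ext1
    filter_upwards [coeFn_cut σ (cut _ T τ x), coeFn_cut τ x, coeFn_cut (min σ τ) x] with t h1 h2 h3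
    rw [h1, h3]
    by_cases h4 : t < σ <;> by_cases h5 : t < τ <;> simp [h4, h5, h2]
  norm_pow σ τ x hστ := by
    have i1 := Lp_norm_pow_four (cut (lp (fun _ : ι => E) 2) T τ x - cut _ T σ x)
    have i2 := Lp_norm_pow_four (cut (lp (fun _ : ι => E) 2) T σ x)
    have i3 := Lp_norm_pow_four (cut (lp (fun _ : ι => E) 2) T τ x)
    rw [i1.2, i2.2, i3.2, ← integral_add i1.1 i2.1]
    refine integral_congr_ae ?_
    filter_upwards [coeFn_cut σ x, coeFn_cut τ x, Lp.coeFn_sub (cut _ T τ x) (cut _ T σ x)]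
      with t h1 h2 h3
    rw [h3, Pi.sub_apply, h1, h2]
    by_cases h4 : t < σ
    · simp [h4, h4.trans_le hστ]
    · simp [h4]
  cont x := by
    have h1 : ContinuousOn (fun σ => ∫ t in (0 : ℝ)..σ, ‖x t‖ ^ 4) (Icc 0 T) :=
      continuousOn_add_primitive (u₀ := 0) (φ := fun t => ‖x t‖ ^ 4)
        (by rw [integrableOn_Ioc_iff_integrableOn_Ioo]; exact (Lp_norm_pow_four x).1) (by simp)
    refine h1.congr fun σ hσ => ?_
    refine (norm_cut_pow_four hσ.2 x).trans ?_
    rw [← integral_Ioc_eq_integral_Ioo, ← intervalIntegral.integral_of_le hσ.1]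
  causal σ x y := by
    ext1
    filter_upwards [coeFn_cut σ (mildBilin N q hT x y),
      coeFn_cut σ (mildBilin N q hT (cut _ T σ x) (cut _ T σ y)),
      coeFn_mildBilin N (q := q) hT x y, coeFn_mildBilin N (q := q) hT (cut _ T σ x) (cut _ T σ y),
      ae_restrict_mem measurableSet_Ioo] with t h1 h2 h3 h4 ht
    rw [h1, h2]
    by_cases htσ : t < σ
    · rw [indicator_of_mem (mem_Iio.2 htσ), indicator_of_mem (mem_Iio.2 htσ), h3, h4]
      refine evolQuarter_congr (τ := t) ?_ ⟨ht.1.le, le_rfl⟩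
      filter_upwards [ae_restrict_of_ae_restrict_of_subset (Ioo_subset_Ioo_right ht.2.le) (coeFn_cut σ x),
        ae_restrict_of_ae_restrict_of_subset (Ioo_subset_Ioo_right ht.2.le) (coeFn_cut σ y),
        ae_restrict_mem measurableSet_Ioo] with s h5 h6 hs
      rw [h5, h6, indicator_of_mem (show s ∈ Iio σ from hs.2.trans htσ),
        indicator_of_mem (show s ∈ Iio σ from hs.2.trans htσ)]
    · rw [indicator_of_notMem (by simpa using htσ), indicator_of_notMem (by simpa using htσ)]
  disj σ x z hx hz := by
    have hd : ∀ᵐ t ∂volume.restrict (Ioo 0 T), x t = 0 ∨ z t = 0 := by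
      filter_upwards [coeFn_cut σ x, coeFn_cut σ z, Lp.coeFn_zero (lp (fun _ : ι => E) 2) 4
        (volume.restrict (Ioo 0 T))] with t h1 h2 h3
      rw [hx] at h1
      rw [hz, h3, Pi.zero_apply] at h2
      by_cases htσ : t < σ
      · rw [indicator_of_mem (mem_Iio.2 htσ)] at h2
        exact Or.inr h2.symm
      · rw [indicator_of_notMem (by simpa using htσ)] at h1
        exact Or.inl h1
    have e1 : N.holder 2 x z = (0 : Lp (lp (fun _ : ι => E) 2) 2 (volume.restrict (Ioo 0 T))) := by
      ext1
      filter_upwards [hd, N.coeFn_holder (r := 2) x z, Lp.coeFn_zero (lp (fun _ : ι => E) 2) 2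
        (volume.restrict (Ioo 0 T))] with t h1 h2 h3
      rw [h2, h3, Pi.zero_apply]
      rcases h1 with h1 | h1 <;> simp [h1]
    have e2 : N.holder 2 z x = (0 : Lp (lp (fun _ : ι => E) 2) 2 (volume.restrict (Ioo 0 T))) := by
      ext1
      filter_upwards [hd, N.coeFn_holder (r := 2) z x, Lp.coeFn_zero (lp (fun _ : ι => E) 2) 2
        (volume.restrict (Ioo 0 T))] with t h1 h2 h3
      rw [h2, h3, Pi.zero_apply]
      rcases h1 with h1 | h1 <;> simp [h1]
    rw [mildBilin_apply, mildBilin_apply, e1, e2, map_zero]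
    exact ⟨rfl, rfl⟩

omit [Countable ι] in
theorem energyConst_mul_of_gronwall {y v : ℝ → ℝ} {M τ : ℝ} (hτT : τ ≤ T) (hM : 0 ≤ M)
    (hy : ContinuousOn y (Icc 0 τ)) (hv : ∀ t, 0 ≤ v t)
    (h : ∀ t ∈ Icc 0 τ, y t + v t ≤ M + 2 * ∫ s in (0 : ℝ)..t, y s) :
    ∀ t ∈ Icc 0 τ, y t + v t ≤ energyConst T * M := by
  have hgr := le_mul_exp_of_le_add_integral (y := y) (K := M) (C := 2) (T := τ)
    (by norm_num) hy (fun t ht => by linarith [h t ht, hv t])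
  intro t ht
  have h7 : ∫ s in (0 : ℝ)..t, y s ≤ T * (M * Real.exp (2 * T)) := by
    calc ∫ s in (0 : ℝ)..t, y s ≤ ∫ s in (0 : ℝ)..t, M * Real.exp (2 * T) := by
          refine intervalIntegral.integral_mono_on ht.1 ?_ (by simp) fun s hs => ?_
          · apply ContinuousOn.intervalIntegrable
            rw [uIcc_of_le ht.1]
            exact hy.mono (Icc_subset_Icc_right ht.2)
          · refine (hgr s ⟨hs.1, hs.2.trans ht.2⟩).trans ?_
            have := hs.2.trans (ht.2.trans hτT)
            gcongr
      _ = t * (M * Real.exp (2 * T)) := by simp; ring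
      _ ≤ _ := by
          have := ht.2.trans hτT
          gcongr
  have := h t ht
  unfold energyConst
  nlinarith

variable {u₀ : lp (fun _ : ι => E) 2} {f : ℝ → lp (fun _ : ι => E) 2}

/-- The a priori bound: a part `n` of the forcing that does no work does not enter the energy
estimate. -/
theorem energy_le_of_no_work (hf : MemLp f 2 (volume.restrict (Ioo 0 T)))
    {n : ℝ → lp (fun _ : ι => E) 2} (hn2 : MemLp n 2 (volume.restrict (Ioo 0 T)))
    {τ : ℝ} (hτ : τ ∈ Icc 0 T)
    (hwork : ∀ᵐ t ∂volume.restrict (Ioo 0 T), t < τ →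
      inner ℝ (n t) (evolHalf q u₀ (fun s => f s + (-1 : ℝ) • n s) t) = 0)
    {t : ℝ} (ht : t ∈ Icc 0 τ) :
    ‖evol q u₀ (fun s => f s + (-1 : ℝ) • n s) t‖ ^ 2 +
        ∫ s in Ioo 0 t, ‖evolHalf q u₀ (fun s => f s + (-1 : ℝ) • n s) s‖ ^ 2 ≤
      energyConst T * (‖u₀‖ ^ 2 + ∫ s in Ioo 0 T, ‖f s‖ ^ 2) := by
  have hT : 0 ≤ T := hτ.1.trans hτ.2
  have hM0 : 0 ≤ ‖u₀‖ ^ 2 + ∫ s in Ioo 0 T, ‖f s‖ ^ 2 :=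
    add_nonneg (by positivity) (integral_nonneg fun t => by positivity)
  have hh2 : MemLp (fun s => f s + (-1 : ℝ) • n s) 2 (volume.restrict (Ioo 0 T)) :=
    hf.add (hn2.const_smul (-1 : ℝ))
  have hVm := (memLp_evolHalf (q := q) (u₀ := u₀) hT hh2).2.1
  have huc := (continuousOn_evol (q := q) (u₀ := u₀) hh2).mono (Icc_subset_Icc_right hτ.2)
  have hen := fun t (ht : t ∈ Icc 0 T) => evol_energy (q := q) (u₀ := u₀) hh2 ht
  generalize evolHalf q u₀ (fun s => f s + (-1 : ℝ) • n s) = V at *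
  generalize evol q u₀ (fun s => f s + (-1 : ℝ) • n s) = u at *
  refine energyConst_mul_of_gronwall (T := T) (y := fun t => ‖u t‖ ^ 2)
    (v := fun t => ∫ s in Ioo 0 t, ‖V s‖ ^ 2) hτ.2 hM0 (huc.norm.pow 2)
    (fun t => integral_nonneg fun s => by positivity) ?_ t ht
  intro t ht
  have hsub : Ioo 0 t ⊆ Ioo 0 T := Ioo_subset_Ioo_right (ht.2.trans hτ.2)
  have hres := Measure.restrict_mono hsub (le_refl (volume : Measure ℝ))
  have h1 := hen t ⟨ht.1, ht.2.trans hτ.2⟩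
  have h2 : 2 * ∫ s in Ioo 0 t, inner ℝ (f s + (-1 : ℝ) • n s) (V s) ≤
      (∫ s in Ioo 0 t, ‖f s‖ ^ 2) + ∫ s in Ioo 0 t, ‖V s‖ ^ 2 := by
    have i1 : Integrable (fun s => ‖f s‖ ^ 2) (volume.restrict (Ioo 0 t)) :=
      (hf.mono_measure hres).integrable_norm_pow (by norm_num)
    have i2 : Integrable (fun s => ‖V s‖ ^ 2) (volume.restrict (Ioo 0 t)) :=
      (hVm.mono_measure hres).integrable_norm_pow (by norm_num)
    have i3 : Integrable (fun s => inner ℝ (f s + (-1 : ℝ) • n s) (V s))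
        (volume.restrict (Ioo 0 t)) :=
      memLp_one_iff_integrable.1 ((innerSL ℝ).memLp_of_bilin (p := 2) (q := 2) 1
        (hh2.mono_measure hres) (hVm.mono_measure hres))
    rw [← integral_const_mul, ← integral_add i1 i2]
    refine integral_mono_ae (i3.const_mul 2) (i1.add i2) ?_
    filter_upwards [ae_restrict_of_ae_restrict_of_subset hsub hwork,
      ae_restrict_mem measurableSet_Ioo] with s h3 hs
    have h4 : inner ℝ (f s + (-1 : ℝ) • n s) (V s) = inner ℝ (f s) (V s) := by
      rw [inner_add_left, real_inner_smul_left, h3 (hs.2.trans_le ht.2), mul_zero, add_zero]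
    rw [h4]
    nlinarith [real_inner_le_norm (f s) (V s), sq_nonneg (‖f s‖ - ‖V s‖)]
  have h6 : ∫ s in Ioo 0 t, ‖f s‖ ^ 2 ≤ ∫ s in Ioo 0 T, ‖f s‖ ^ 2 :=
    setIntegral_mono_set (hf.integrable_norm_pow (by norm_num)) (.of_forall fun s => by positivity)
      hsub.eventuallyLE
  rw [intervalIntegral.integral_of_le ht.1, integral_Ioc_eq_integral_Ioo]
  linarith

omit [Countable ι] [CompleteSpace E] in
/-- The interpolation inequality `‖Q‖² ≤ ‖u‖ ‖V‖` turns bounds in `L^∞` and `L²` into a bound in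
`L⁴`. -/
theorem Lp_four_norm_le {F : Type*} [NormedAddCommGroup F] {τ K : ℝ} (hτ : τ ∈ Icc 0 T)
    (hK0 : 0 ≤ K) {u V Q : ℝ → F}
    (hVm : MemLp V 2 (volume.restrict (Ioo 0 T)))
    (hQ : ∀ᵐ t ∂volume.restrict (Ioo 0 T), ‖Q t‖ ^ 2 ≤ ‖u t‖ * ‖V t‖)
    (bound : ∀ t ∈ Icc 0 τ, ‖u t‖ ^ 2 + ∫ s in Ioo 0 t, ‖V s‖ ^ 2 ≤ K)
    {X : Lp F 4 (volume.restrict (Ioo 0 T))}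
    (hXQ : ∀ᵐ t ∂volume.restrict (Ioo 0 T), X t = (Iio τ).indicator Q t) :
    ‖X‖ ^ 2 ≤ K := by
  have hVi : Integrable (fun t => K * (Iio τ).indicator (fun t => ‖V t‖ ^ 2) t)
      (volume.restrict (Ioo 0 T)) :=
    ((hVm.integrable_norm_pow (by norm_num)).indicator measurableSet_Iio).const_mul K
  have hX4 : ‖X‖ ^ 4 ≤ K ^ 2 := by
    rw [(Lp_norm_pow_four X).2]
    calc ∫ t in Ioo 0 T, ‖X t‖ ^ 4
        ≤ ∫ t in Ioo 0 T, K * (Iio τ).indicator (fun t => ‖V t‖ ^ 2) t := by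
          refine integral_mono_ae (Lp_norm_pow_four X).1 hVi ?_
          filter_upwards [hXQ, hQ, ae_restrict_mem measurableSet_Ioo] with t h1 h2 ht0
          rw [h1]
          by_cases ht : t ∈ Iio τ
          · rw [indicator_of_mem ht, indicator_of_mem ht]
            have h3 := bound t ⟨ht0.1.le, (mem_Iio.1 ht).le⟩
            have h4 : 0 ≤ ∫ s in Ioo 0 t, ‖V s‖ ^ 2 := integral_nonneg fun s => by positivity
            calc ‖Q t‖ ^ 4 = (‖Q t‖ ^ 2) ^ 2 := by ring
              _ ≤ (‖u t‖ * ‖V t‖) ^ 2 := by gcongr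
              _ = ‖u t‖ ^ 2 * ‖V t‖ ^ 2 := by ring
              _ ≤ K * ‖V t‖ ^ 2 := by gcongr; linarith
          · simp [indicator_of_notMem ht]
      _ = K * ∫ t in Ioo 0 τ, ‖V t‖ ^ 2 := by
          rw [integral_const_mul, integral_indicator measurableSet_Iio,
            Measure.restrict_restrict measurableSet_Iio]
          congr 3
          ext t
          simp only [mem_inter_iff, mem_Iio, mem_Ioo]
          constructor
          · rintro ⟨a, b, -⟩; exact ⟨b, a⟩
          · rintro ⟨a, b⟩; exact ⟨b, a, b.trans_le hτ.2⟩
      _ ≤ K * K := by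
          gcongr
          have := bound τ ⟨hτ.1, le_rfl⟩
          have h5 : 0 ≤ ‖u τ‖ ^ 2 := by positivity
          linarith
      _ = K ^ 2 := by ring
  refine le_of_pow_le_pow_left₀ (n := 2) (by norm_num) hK0 ?_
  rw [← pow_mul]
  exact hX4

/-- The a priori bound: since `N (X, X)` does no work, the energy of a solution on `(0,τ)` is
controlled by the data. -/
theorem norm_le_of_isSolution (hT : 0 ≤ T) (hf : MemLp f 2 (volume.restrict (Ioo 0 T)))
    (hN : ∀ X V : lp (fun _ : ι => E) 2, (∀ k, V k = q k • X k) → inner ℝ (N X X) V = 0)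
    {τ : ℝ} (hτ : τ ∈ Icc 0 T) {X : Lp (lp (fun _ : ι => E) 2) 4 (volume.restrict (Ioo 0 T))}
    (hX : X = cut _ T τ ((memLp_evolQuarter (q := q) (u₀ := u₀) hT hf).1.toLp -
      mildBilin N q hT X X)) :
    ‖X‖ ^ 2 ≤ energyConst T * (‖u₀‖ ^ 2 + ∫ s in Ioo 0 T, ‖f s‖ ^ 2) := by
  have hn2 : MemLp (fun t => N (X t) (X t)) 2 (volume.restrict (Ioo 0 T)) :=
    N.memLp_of_bilin 2 (Lp.memLp X) (Lp.memLp X)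
  have hh2 : MemLp (fun s => f s + (-1 : ℝ) • N (X s) (X s)) 2 (volume.restrict (Ioo 0 T)) :=
    hf.add (hn2.const_smul (-1 : ℝ))
  have hVae := evolHalf_ae (q := q) (u₀ := u₀) hT hh2
  have hQae := evolQuarter_ae (q := q) (u₀ := u₀) hT hh2
  have hXQ : ∀ᵐ t ∂volume.restrict (Ioo 0 T),
      X t = (Iio τ).indicator (evolQuarter q u₀ (fun s => f s + (-1 : ℝ) • N (X s) (X s))) t := by
    have e0 := coeFn_cut τ ((memLp_evolQuarter (q := q) (u₀ := u₀) hT hf).1.toLp -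
      mildBilin N q hT X X)
    rw [← hX] at e0
    filter_upwards [e0, Lp.coeFn_sub (memLp_evolQuarter (q := q) (u₀ := u₀) hT hf).1.toLp
      (mildBilin N q hT X X), (memLp_evolQuarter (q := q) (u₀ := u₀) hT hf).1.coeFn_toLp,
      coeFn_mildBilin N (q := q) hT X X,
      evolQuarter_add_smul (q := q) (u₀ := u₀) (u₀' := 0) hT (-1) hf hn2] with t h1 h2 h3 h4 h5
    rw [h1]
    by_cases ht : t ∈ Iio τ
    · rw [indicator_of_mem ht, indicator_of_mem ht, h2, Pi.sub_apply, h3, h4]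
      rw [smul_zero, add_zero, neg_smul, one_smul, ← sub_eq_add_neg] at h5
      exact h5.symm
    · rw [indicator_of_notMem ht, indicator_of_notMem ht]
  have hwork : ∀ᵐ t ∂volume.restrict (Ioo 0 T), t < τ → inner ℝ (N (X t) (X t))
      (evolHalf q u₀ (fun s => f s + (-1 : ℝ) • N (X s) (X s)) t) = 0 := by
    filter_upwards [hXQ, hVae, hQae] with t h1 h2 h3 ht
    refine hN _ _ fun k => ?_
    rw [h1, indicator_of_mem (mem_Iio.2 ht), h2, h3.1, smul_smul, sq]
  refine Lp_four_norm_le hτ (mul_nonneg (energyConst_nonneg hT)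
    (add_nonneg (by positivity) (integral_nonneg fun t => by positivity)))
    (memLp_evolHalf (q := q) (u₀ := u₀) hT hh2).2.1 (hQae.mono fun t h => h.2)
    (fun t ht => energy_le_of_no_work hf hn2 hτ hwork ht) hXQ

/-- Global well-posedness of `u' + A u + Λ^{1/2} N(Λ^{1/4} u, Λ^{1/4} u) = Λ^{1/2} f`, `u(0) = u₀`,
expressed through the nonlinear term `n`. -/
theorem exists_unique_nonlinear_term (hT : 0 ≤ T) (u₀ : lp (fun _ : ι => E) 2)
    (hf : MemLp f 2 (volume.restrict (Ioo 0 T)))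
    (hN : ∀ X V : lp (fun _ : ι => E) 2, (∀ k, V k = q k • X k) → inner ℝ (N X X) V = 0) :
    ∃ n : ℝ → lp (fun _ : ι => E) 2, MemLp n 2 (volume.restrict (Ioo 0 T)) ∧
      (∀ᵐ t ∂volume.restrict (Ioo 0 T), n t = N (evolQuarter q u₀ (fun s => f s + (-1 : ℝ) • n s) t)
        (evolQuarter q u₀ (fun s => f s + (-1 : ℝ) • n s) t)) ∧
      ∀ n' : ℝ → lp (fun _ : ι => E) 2, MemLp n' 2 (volume.restrict (Ioo 0 T)) →
        (∀ᵐ t ∂volume.restrict (Ioo 0 T), n' t =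
          N (evolQuarter q u₀ (fun s => f s + (-1 : ℝ) • n' s) t)
            (evolQuarter q u₀ (fun s => f s + (-1 : ℝ) • n' s) t)) →
        n' =ᵐ[volume.restrict (Ioo 0 T)] n := by
  have hc := isCausal_mildBilin (q := q) (T := T) N hT
  set Y := (memLp_evolQuarter (q := q) (u₀ := u₀) hT hf).1.toLp with hY
  obtain ⟨X, hX⟩ := hc.exists_solution hT (Y := Y)
    (K := √(energyConst T * (‖u₀‖ ^ 2 + ∫ s in Ioo 0 T, ‖f s‖ ^ 2))) fun τ hτ X hX =>
      Real.le_sqrt_of_sq_le (norm_le_of_isSolution N hT hf hN hτ hX)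
  -- a mild solution `X` and the forcing `N (X, X)` determine each other
  have key : ∀ (n : ℝ → lp (fun _ : ι => E) 2), MemLp n 2 (volume.restrict (Ioo 0 T)) →
      ∀ Z : Lp (lp (fun _ : ι => E) 2) 4 (volume.restrict (Ioo 0 T)),
      n =ᵐ[volume.restrict (Ioo 0 T)] (fun t => N (Z t) (Z t)) →
      ∀ᵐ t ∂volume.restrict (Ioo 0 T), (Y - mildBilin N q hT Z Z : Lp (lp (fun _ : ι => E) 2) 4
        (volume.restrict (Ioo 0 T))) t = evolQuarter q u₀ (fun s => f s + (-1 : ℝ) • n s) t := by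
    intro n hn Z hnZ
    filter_upwards [Lp.coeFn_sub Y (mildBilin N q hT Z Z),
      (memLp_evolQuarter (q := q) (u₀ := u₀) hT hf).1.coeFn_toLp, coeFn_mildBilin N (q := q) hT Z Z,
      evolQuarter_add_smul (q := q) (u₀ := u₀) (u₀' := 0) hT (-1) hf hn,
      ae_restrict_mem measurableSet_Ioo] with t h1 h2 h3 h4 ht
    rw [smul_zero, add_zero, neg_smul, one_smul, ← sub_eq_add_neg] at h4
    rw [h1, Pi.sub_apply, hY, h2, h3, h4, evolQuarter_congr hnZ (Ioo_subset_Icc_self ht)]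
  have hn2 : MemLp (fun t => N (X t) (X t)) 2 (volume.restrict (Ioo 0 T)) :=
    N.memLp_of_bilin 2 (Lp.memLp X) (Lp.memLp X)
  refine ⟨fun t => N (X t) (X t), hn2, ?_, ?_⟩
  · have h1 := key _ hn2 X .rfl
    rw [← hX] at h1
    filter_upwards [h1] with t ht
    rw [← ht]
  · intro n' hn' hn'eq
    have hh' : MemLp (fun s => f s + (-1 : ℝ) • n' s) 2 (volume.restrict (Ioo 0 T)) :=
      hf.add (hn'.const_smul (-1 : ℝ))
    set Z := (memLp_evolQuarter (q := q) (u₀ := u₀) hT hh').1.toLp with hZ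
    have hZc := (memLp_evolQuarter (q := q) (u₀ := u₀) hT hh').1.coeFn_toLp
    have h2 : n' =ᵐ[volume.restrict (Ioo 0 T)] fun t => N (Z t) (Z t) := by
      filter_upwards [hn'eq, hZc] with t h1 h3
      rw [h1, hZ, h3]
    have h3 : Z = Y - mildBilin N q hT Z Z := by
      ext1
      filter_upwards [key n' hn' Z h2, hZc] with t h4 h5
      rw [h4, hZ, h5]
    have h4 : Z = X := hc.unique (τ := T) le_rfl (by rw [hc.top]; exact h3) (by rw [hc.top]; exact hX)
    rw [h4] at h2
    exact h2

end Abstract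

/-! ### The anisotropic trilinear estimate -/

section Sums

open scoped ENNReal

/-- The Cauchy–Schwarz inequality for sums in `[0,∞]`. -/
theorem ennreal_tsum_mul_sq_le {ι : Type*} (f g : ι → ℝ≥0∞) :
    (∑' i, f i * g i) ^ 2 ≤ (∑' i, f i ^ 2) * ∑' i, g i ^ 2 := by
  let : MeasurableSpace ι := ⊤
  have h := ENNReal.lintegral_mul_le_Lp_mul_Lq (Measure.count : Measure ι)
    (p := 2) (q := 2) (f := f) (g := g) Real.HolderConjugate.two_two
    measurable_from_top.aemeasurable measurable_from_top.aemeasurable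
  simp only [Pi.mul_apply, lintegral_count, ENNReal.rpow_two] at h
  calc (∑' i, f i * g i) ^ 2 ≤ ((∑' i, f i ^ 2) ^ (1 / 2 : ℝ) * (∑' i, g i ^ 2) ^ (1 / 2 : ℝ)) ^ 2 := by
        gcongr
    _ = _ := by
        rw [mul_pow, ← ENNReal.rpow_natCast, ← ENNReal.rpow_natCast, ← ENNReal.rpow_mul,
          ← ENNReal.rpow_mul]
        norm_num

theorem tsum_natAbs_le (f : ℕ → ℝ≥0∞) : ∑' n : ℤ, f n.natAbs ≤ 2 * ∑' n, f n := by
  rw [tsum_of_nat_of_neg_add_one ENNReal.summable ENNReal.summable, two_mul]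
  refine add_le_add (by simp) ?_
  · refine (ENNReal.tsum_le_tsum fun n => ?_).trans
      (ENNReal.tsum_comp_le_tsum_of_injective Nat.succ_injective f)
    rw [show (-((n : ℤ) + 1)).natAbs = n.succ by omega]

theorem tsum_freq_mul (A B C : ℤ → ℝ≥0∞) :
    ∑' k : Freq, A (k 0) * (B (k 1) * C (k 2)) = (∑' n, A n) * ((∑' n, B n) * ∑' n, C n) := by
  let e : ℤ × ℤ × ℤ ≃ Freq :=
    { toFun := fun p => ![p.1, p.2.1, p.2.2]
      invFun := fun k => (k 0, k 1, k 2)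
      left_inv := fun p => rfl
      right_inv := fun k => by ext j; fin_cases j <;> rfl }
  have h : ∀ p : ℤ × ℤ × ℤ, A (e p 0) * (B (e p 1) * C (e p 2)) = A p.1 * (B p.2.1 * C p.2.2) :=
    fun _ => rfl
  rw [← e.tsum_eq, tsum_congr h, ENNReal.tsum_prod']
  simp only [ENNReal.tsum_mul_left]
  rw [ENNReal.tsum_mul_right, ENNReal.tsum_prod']
  simp only [ENNReal.tsum_mul_left, ENNReal.tsum_mul_right]

/-- `1 + |n|`. -/
def japV (n : ℤ) : ℝ := 1 + |(n : ℝ)|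

/-- `1 + |k₁| + |k₂|`, the size of the horizontal part of a frequency. -/
def japH (k : Freq) : ℝ := 1 + |(k 0 : ℝ)| + |(k 1 : ℝ)|

theorem one_le_japV (n : ℤ) : 1 ≤ japV n := by
  unfold japV; linarith [abs_nonneg (n : ℝ)]

theorem one_le_japH (k : Freq) : 1 ≤ japH k := by
  unfold japH; linarith [abs_nonneg (k 0 : ℝ), abs_nonneg (k 1 : ℝ)]

/-- The kernel of the trilinear estimate, `(1 + |m₃ - l₃|)^{-3/4}` times the inverse square roots
of the horizontal sizes of `l` and `m`. -/
noncomputable def triKernel (l m : Freq) : ℝ :=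
  (japV (m 2 - l 2) ^ (3 / 4 : ℝ) * japH l ^ (1 / 2 : ℝ) * japH m ^ (1 / 2 : ℝ))⁻¹

theorem triKernel_pos (l m : Freq) : 0 < triKernel l m := by
  have := one_le_japV (m 2 - l 2)
  have := one_le_japH l
  have := one_le_japH m
  unfold triKernel
  positivity

theorem japV_neg (n : ℤ) : japV (-n) = japV n := by simp [japV]

theorem triKernel_comm (l m : Freq) : triKernel l m = triKernel m l := by
  unfold triKernel
  rw [← japV_neg (m 2 - l 2), neg_sub, mul_right_comm]

theorem triKernel_sq (l m : Freq) : triKernel l m ^ 2 =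
    (japV (m 2 - l 2) ^ (3 / 2 : ℝ))⁻¹ * (japH l)⁻¹ * (japH m)⁻¹ := by
  have h1 := one_le_japV (m 2 - l 2)
  have h2 := one_le_japH l
  have h3 := one_le_japH m
  unfold triKernel
  rw [inv_pow, mul_pow, mul_pow, ← Real.rpow_natCast, ← Real.rpow_natCast, ← Real.rpow_natCast,
    ← Real.rpow_mul (by linarith), ← Real.rpow_mul (by linarith), ← Real.rpow_mul (by linarith)]
  norm_num
  ring

/-- The sequence `(1 + n)^{-1/2}`, truncated to `1 + n ≤ R`. -/
noncomputable def truncInvSqrt (R : ℝ) (n : ℕ) : ℝ≥0∞ :=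
  if 1 + (n : ℝ) ≤ R then ENNReal.ofReal (√(1 + (n : ℝ)))⁻¹ else 0

theorem tsum_truncInvSqrt_le (R : ℝ) :
    ∑' n, truncInvSqrt R n ≤ ENNReal.ofReal (2 * √R) := by
  have key : ∀ n : ℕ, ∑ i ∈ Finset.range n, truncInvSqrt R i ≤ ENNReal.ofReal (2 * √(min n R)) := by
    intro n
    induction n with
    | zero => simp
    | succ n ih =>
      rw [Finset.sum_range_succ]
      unfold truncInvSqrt at ih ⊢
      by_cases h : 1 + (n : ℝ) ≤ R
      · rw [if_pos h]
        refine (add_le_add ih le_rfl).trans ?_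
        rw [← ENNReal.ofReal_add (by positivity) (by positivity)]
        apply ENNReal.ofReal_le_ofReal
        rw [min_eq_left (by linarith), min_eq_left (by push_cast; linarith)]
        push_cast
        rw [add_comm (n : ℝ) 1]
        have h1 : 0 < √(1 + (n : ℝ)) := by positivity
        have h2 := Real.sq_sqrt (show (0 : ℝ) ≤ 1 + n by positivity)
        have h3 := Real.sq_sqrt (show (0 : ℝ) ≤ n by positivity)
        have h4 := Real.sqrt_nonneg (n : ℝ)
        rw [← sub_nonneg, show 2 * √(1 + (n : ℝ)) - (2 * √n + (√(1 + (n : ℝ)))⁻¹) =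
          (2 * √(1 + (n : ℝ)) ^ 2 - 2 * √n * √(1 + (n : ℝ)) - 1) / √(1 + (n : ℝ)) by field_simp; ring]
        apply div_nonneg _ h1.le
        nlinarith [sq_nonneg (√(1 + (n : ℝ)) - √n)]
      · rw [if_neg h, add_zero]
        refine ih.trans (ENNReal.ofReal_le_ofReal ?_)
        gcongr
        simp
  refine ENNReal.tsum_le_of_sum_range_le fun n => (key n).trans (ENNReal.ofReal_le_ofReal ?_)
  gcongr
  exact min_le_right _ _

theorem exists_tsum_japV_le : ∃ C : NNReal,
    ∑' n : ℤ, ENNReal.ofReal (japV n ^ (3 / 2 : ℝ))⁻¹ ≤ C := by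
  have h : Summable fun n : ℕ => ((n + 1 : ℝ) ^ (3 / 2 : ℝ))⁻¹ := by
    have := (summable_nat_add_iff 1).2 (Real.summable_nat_rpow_inv (p := 3 / 2) |>.2 (by norm_num))
    exact_mod_cast this
  have h1 := tsum_natAbs_le fun n : ℕ => ENNReal.ofReal ((n + 1 : ℝ) ^ (3 / 2 : ℝ))⁻¹
  rw [← ENNReal.ofReal_tsum_of_nonneg (fun n => by positivity) h] at h1
  refine ⟨2 * (∑' n : ℕ, ((n + 1 : ℝ) ^ (3 / 2 : ℝ))⁻¹).toNNReal, ?_⟩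
  rw [ENNReal.coe_mul]
  refine le_trans (le_of_eq ?_) h1
  refine tsum_congr fun n => ?_
  rw [japV, add_comm, Nat.cast_natAbs, Int.cast_abs]

/-- The summation behind the trilinear estimate, uniform in `c` although it is borderline: the sum
over `p₃` converges since `3 / 2 > 1`, and the sum of `1 / (1 + |p_H|)` over the horizontal
frequencies with `|p_H| ≤ |c_H|` grows like `1 + |c_H|`, which the kernel compensates. -/
theorem exists_tsum_triKernel_le : ∃ C : NNReal, ∀ c : Freq,
    ∑' p : Freq, (if japH p ≤ japH c then ENNReal.ofReal (triKernel p c ^ 2) else 0) ≤ C := by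
  obtain ⟨C, hC⟩ := exists_tsum_japV_le
  refine ⟨16 * C, fun c => ?_⟩
  have hR := one_le_japH c
  set R := japH c with hRdef
  have hG : ∑' n : ℤ, truncInvSqrt R n.natAbs ≤ ENNReal.ofReal (4 * √R) := by
    refine (tsum_natAbs_le _).trans ?_
    rw [show (4 : ℝ) * √R = 2 * (2 * √R) by ring, ENNReal.ofReal_mul (p := 2) (by norm_num)]
    gcongr
    · simp
    · exact tsum_truncInvSqrt_le R
  have hV : ∑' n : ℤ, ENNReal.ofReal (japV (c 2 - n) ^ (3 / 2 : ℝ))⁻¹ ≤ C := by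
    exact ((Equiv.subLeft (c 2)).tsum_eq
      (fun n : ℤ => ENNReal.ofReal (japV n ^ (3 / 2 : ℝ))⁻¹)).trans_le hC
  calc ∑' p : Freq, (if japH p ≤ R then ENNReal.ofReal (triKernel p c ^ 2) else 0)
      ≤ ∑' p : Freq, ENNReal.ofReal R⁻¹ * (truncInvSqrt R (p 0).natAbs *
          (truncInvSqrt R (p 1).natAbs * ENNReal.ofReal (japV (c 2 - p 2) ^ (3 / 2 : ℝ))⁻¹)) := by
        refine ENNReal.tsum_le_tsum fun p => ?_
        by_cases h : japH p ≤ R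
        · have a0 := abs_nonneg (p 0 : ℝ)
          have a1 := abs_nonneg (p 1 : ℝ)
          have hj := one_le_japV (c 2 - p 2)
          rw [if_pos h, triKernel_sq, truncInvSqrt, truncInvSqrt, Nat.cast_natAbs, Nat.cast_natAbs,
            Int.cast_abs, Int.cast_abs,
            if_pos (by unfold japH at h; linarith), if_pos (by unfold japH at h; linarith),
            ← ENNReal.ofReal_mul (by positivity), ← ENNReal.ofReal_mul (by positivity),
            ← ENNReal.ofReal_mul (by positivity)]
          apply ENNReal.ofReal_le_ofReal
          have h1 : (japH p)⁻¹ ≤ (√(1 + |(p 0 : ℝ)|))⁻¹ * (√(1 + |(p 1 : ℝ)|))⁻¹ := by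
            rw [← mul_inv, ← Real.sqrt_mul (by positivity)]
            gcongr
            apply Real.sqrt_le_iff.2
            unfold japH
            constructor
            · positivity
            · nlinarith
          calc (japV (c 2 - p 2) ^ (3 / 2 : ℝ))⁻¹ * (japH p)⁻¹ * R⁻¹
              ≤ (japV (c 2 - p 2) ^ (3 / 2 : ℝ))⁻¹ *
                ((√(1 + |(p 0 : ℝ)|))⁻¹ * (√(1 + |(p 1 : ℝ)|))⁻¹) * R⁻¹ := by gcongr
            _ = _ := by ring
        · rw [if_neg h]; exact zero_le
    _ ≤ ENNReal.ofReal R⁻¹ * (ENNReal.ofReal (4 * √R) * (ENNReal.ofReal (4 * √R) * C)) := by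
        rw [ENNReal.tsum_mul_left, tsum_freq_mul (fun n => truncInvSqrt R n.natAbs)
          (fun n => truncInvSqrt R n.natAbs)
          (fun n => ENNReal.ofReal (japV (c 2 - n) ^ (3 / 2 : ℝ))⁻¹)]
        gcongr
    _ = _ := by
        rw [← mul_assoc, ← mul_assoc, ← ENNReal.ofReal_mul (by positivity),
          ← ENNReal.ofReal_mul (by positivity), show R⁻¹ * (4 * √R) * (4 * √R) = 16 by
            rw [show R⁻¹ * (4 * √R) * (4 * √R) = 16 * R⁻¹ * (√R) ^ 2 by ring,
              Real.sq_sqrt (by linarith)]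
            field_simp]
        simp

/-- The trilinear estimate, in bilinear form. -/
theorem exists_tsum_bilin_sq_le : ∃ C : NNReal, ∀ x y : Freq → ℝ≥0∞,
    ∑' m, (∑' l, ENNReal.ofReal (triKernel l m) * (x (m - l) * y l)) ^ 2 ≤
      C * ((∑' k, x k ^ 2) * ∑' k, y k ^ 2) := by
  obtain ⟨C, hC⟩ := exists_tsum_triKernel_le
  refine ⟨4 * C, fun x y => ?_⟩
  set κ : Freq → Freq → ℝ≥0∞ := fun l m => if japH l ≤ japH m then ENNReal.ofReal (triKernel l m) else 0
    with hκ
  have hκC : ∀ m, ∑' l, κ l m ^ 2 ≤ C := by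
    intro m
    refine (ENNReal.tsum_le_tsum fun l => ?_).trans (hC m)
    simp only [hκ]
    split_ifs
    · rw [ENNReal.ofReal_pow (triKernel_pos l m).le]
    · simp
  have hle : ∀ l m, ENNReal.ofReal (triKernel l m) ≤ κ l m + κ m l := by
    intro l m
    simp only [hκ]
    rcases le_total (japH l) (japH m) with h | h
    · rw [if_pos h]; exact le_self_add
    · rw [if_pos h, triKernel_comm l m]; exact le_add_self
  have hconv : ∑' m, ∑' l, (x (m - l) * y l) ^ 2 = (∑' k, x k ^ 2) * ∑' k, y k ^ 2 := by
    rw [ENNReal.tsum_comm, ← ENNReal.tsum_mul_left]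
    refine tsum_congr fun l => ?_
    simp only [mul_pow]
    rw [ENNReal.tsum_mul_right]
    exact congrArg (· * y l ^ 2) ((Equiv.subRight l).tsum_eq (fun k => x k ^ 2))
  -- where `|l_H| ≤ |m_H|`, Cauchy–Schwarz in `l` separates the kernel from `x` and `y`; elsewhere
  -- the kernel stays with `y`
  have h1 : ∑' m, (∑' l, κ l m * (x (m - l) * y l)) ^ 2 ≤ C * ((∑' k, x k ^ 2) * ∑' k, y k ^ 2) := by
    calc ∑' m, (∑' l, κ l m * (x (m - l) * y l)) ^ 2
        ≤ ∑' m, C * ∑' l, (x (m - l) * y l) ^ 2 := by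
          refine ENNReal.tsum_le_tsum fun m => (ennreal_tsum_mul_sq_le _ _).trans ?_
          gcongr
          exact hκC m
      _ = _ := by rw [ENNReal.tsum_mul_left, hconv]
  have h2 : ∑' m, (∑' l, κ m l * (x (m - l) * y l)) ^ 2 ≤ C * ((∑' k, x k ^ 2) * ∑' k, y k ^ 2) := by
    calc ∑' m, (∑' l, κ m l * (x (m - l) * y l)) ^ 2
        ≤ ∑' m, (∑' k, x k ^ 2) * ∑' l, (κ m l * y l) ^ 2 := by
          refine ENNReal.tsum_le_tsum fun m => ?_
          have := ennreal_tsum_mul_sq_le (fun l => x (m - l)) (fun l => κ m l * y l)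
          rw [show ∑' l, x (m - l) ^ 2 = ∑' k, x k ^ 2 from
            (Equiv.subLeft m).tsum_eq (fun k => x k ^ 2)] at this
          refine le_trans (le_of_eq ?_) this
          congr 1
          exact tsum_congr fun l => by ring
      _ = (∑' k, x k ^ 2) * ∑' l, (∑' m, κ m l ^ 2) * y l ^ 2 := by
          rw [ENNReal.tsum_mul_left, ENNReal.tsum_comm]
          simp only [mul_pow, ENNReal.tsum_mul_right]
      _ ≤ (∑' k, x k ^ 2) * ∑' l, C * y l ^ 2 := by
          gcongr with l
          exact hκC l
      _ = _ := by rw [ENNReal.tsum_mul_left]; ring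
  have hsq : ∀ a b : ℝ≥0∞, (a + b) ^ 2 ≤ 2 * a ^ 2 + 2 * b ^ 2 := by
    intro a b
    have := ENNReal.rpow_add_le_mul_rpow_add_rpow a b (p := 2) (by norm_num)
    norm_num at this
    rwa [mul_add] at this
  calc ∑' m, (∑' l, ENNReal.ofReal (triKernel l m) * (x (m - l) * y l)) ^ 2
      ≤ ∑' m, (2 * (∑' l, κ l m * (x (m - l) * y l)) ^ 2 +
          2 * (∑' l, κ m l * (x (m - l) * y l)) ^ 2) := by
        refine ENNReal.tsum_le_tsum fun m => le_trans ?_ (hsq _ _)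
        rw [← ENNReal.tsum_add]
        gcongr with l
        rw [← add_mul]
        gcongr
        exact hle l m
    _ ≤ 2 * (C * ((∑' k, x k ^ 2) * ∑' k, y k ^ 2)) + 2 * (C * ((∑' k, x k ^ 2) * ∑' k, y k ^ 2)) := by
        rw [ENNReal.tsum_add, ENNReal.tsum_mul_left, ENNReal.tsum_mul_left]
        gcongr
    _ = _ := by
        rw [ENNReal.coe_mul]
        push_cast
        ring

end Sums

/-! ### The symbols dominate the trilinear kernel -/

section Symbol

/-- The weight `(1 + a)^{1/4}`. -/
noncomputable def quarterWeight (a : Freq → ℝ) (k : Freq) : ℝ := (1 + a k) ^ (1 / 4 : ℝ)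

/-- What the convective terms require of the weight `q`. The left-hand side bounds the symbol of
the convection at frequency `m` by the mode `m - l` of the velocity: the horizontal part gives the
first term, and the second one comes from the vertical velocity, which costs a horizontal derivative
of the velocity and gains a vertical one. -/
def ControlsConvection (q : Freq → ℝ) : Prop :=
  ∃ C : ℝ, 0 ≤ C ∧ ∀ l m : Freq, japH m + japH (m - l) * japV (m 2) / japV (m 2 - l 2) ≤
    C * (q (m - l) * q l * q m ^ 2) * triKernel l m

/-- The pointwise inequality for the symbol `ν |ξ|² + ε |ξ_H|⁴`, cleared of fractional powers: for
each frequency, `α` is the vertical size to the power `1 / 4`, `η` the horizontal size to the power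
`1 / 2`, and `ρ` stands for `(1 + a)^{1/8}`, up to a constant. -/
theorem horiz_weight_bound {αk αl αm ηk ηl ηm ρk ρl ρm : ℝ} (hαk : 1 ≤ αk) (hαl : 1 ≤ αl)
    (hαm : 1 ≤ αm) (hηk : 1 ≤ ηk) (hηl : 1 ≤ ηl) (hηm : 1 ≤ ηm)
    (h1 : αk ≤ ρk) (h2 : αl ≤ ρl) (h3 : αm ≤ ρm) (h4 : ηk ≤ ρk) (h5 : ηl ≤ ρl) (h6 : ηm ≤ ρm)
    (h7 : αk ≤ αl + αm) (h8 : αm ≤ αl + αk) :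
    (ηm ^ 2 + ηk ^ 2 * αm ^ 4 / αk ^ 4) * (αk ^ 3 * ηl * ηm) ≤ 4 * (ρk ^ 2 * ρl ^ 2 * ρm ^ 4) := by
  have hk : 1 ≤ ρk := hαk.trans h1
  have hl : 1 ≤ ρl := hαl.trans h2
  have hm : 1 ≤ ρm := hαm.trans h3
  have t1 : ηm ^ 2 * (αk ^ 3 * ηl * ηm) ≤ 2 * (ρk ^ 2 * ρl ^ 2 * ρm ^ 4) := by
    calc ηm ^ 2 * (αk ^ 3 * ηl * ηm) = αk ^ 2 * αk * ηl * ηm ^ 3 := by ring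
      _ ≤ ρk ^ 2 * (2 * (ρl * ρm)) * ρl * ρm ^ 3 := by gcongr; nlinarith
      _ = _ := by ring
  have t2 : ηk ^ 2 * αm ^ 4 / αk ^ 4 * (αk ^ 3 * ηl * ηm) ≤ 2 * (ρk ^ 2 * ρl ^ 2 * ρm ^ 4) := by
    have h9 : αm / αk ≤ 2 * ρl := by
      rw [div_le_iff₀ (by linarith)]
      nlinarith
    calc ηk ^ 2 * αm ^ 4 / αk ^ 4 * (αk ^ 3 * ηl * ηm) = ηk ^ 2 * αm ^ 3 * (αm / αk) * ηl * ηm := by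
          field_simp
      _ ≤ ρk ^ 2 * ρm ^ 3 * (2 * ρl) * ρl * ρm := by gcongr
      _ = _ := by ring
  rw [add_mul]
  linarith

/-- The pointwise inequality for a symbol of order `16 / 5`, cleared of fractional powers: for each
frequency, `α` and `η` are the vertical and the horizontal size to the power `1 / 20`, and `ρ`
stands for `(1 + a)^{1/64}`, up to a constant. -/
theorem full_weight_bound {αk αl αm ηk ηl ηm ρk ρl ρm : ℝ} (hαk : 1 ≤ αk) (hαl : 1 ≤ αl)
    (hαm : 1 ≤ αm) (hηk : 1 ≤ ηk) (hηl : 1 ≤ ηl) (hηm : 1 ≤ ηm)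
    (h1 : αk ≤ ρk) (h2 : αl ≤ ρl) (h3 : αm ≤ ρm) (h4 : ηk ≤ ρk) (h5 : ηl ≤ ρl) (h6 : ηm ≤ ρm)
    (h7 : ηk ≤ ηl + ηm) (h8 : αm ≤ αl + αk) :
    (ηm ^ 20 + ηk ^ 20 * αm ^ 20 / αk ^ 20) * (αk ^ 15 * ηl ^ 10 * ηm ^ 10) ≤
      41 * (ρk ^ 16 * ρl ^ 16 * ρm ^ 32) := by
  have hk : 1 ≤ ρk := hαk.trans h1
  have hl : 1 ≤ ρl := hαl.trans h2
  have hm : 1 ≤ ρm := hαm.trans h3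
  have t1 : ηm ^ 20 * (αk ^ 15 * ηl ^ 10 * ηm ^ 10) ≤ ρk ^ 16 * ρl ^ 16 * ρm ^ 32 := by
    calc ηm ^ 20 * (αk ^ 15 * ηl ^ 10 * ηm ^ 10) = αk ^ 15 * ηl ^ 10 * ηm ^ 30 := by ring
      _ ≤ ρk ^ 15 * ρl ^ 10 * ρm ^ 30 := by gcongr
      _ ≤ ρk ^ 16 * ρl ^ 16 * ρm ^ 32 := by gcongr <;> first | assumption | norm_num
  have t2 : ηk ^ 20 * αm ^ 20 / αk ^ 20 * (αk ^ 15 * ηl ^ 10 * ηm ^ 10) ≤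
      40 * (ρk ^ 16 * ρl ^ 16 * ρm ^ 32) := by
    have h9 : ηk ^ 4 ≤ 8 * (ηl ^ 4 + ηm ^ 4) := by
      calc ηk ^ 4 ≤ (ηl + ηm) ^ 4 := by gcongr
        _ ≤ _ := by nlinarith [sq_nonneg (ηl - ηm), sq_nonneg (ηl + ηm), sq_nonneg (ηl ^ 2 - ηm ^ 2),
                    mul_nonneg (sq_nonneg (ηl - ηm)) (sq_nonneg (ηl + ηm)), sq_nonneg (ηl * ηm),
                    mul_nonneg (sq_nonneg (ηl - ηm)) (sq_nonneg (ηl - ηm)),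
                    mul_nonneg (sq_nonneg (ηl - ηm)) (sq_nonneg ηl),
                    mul_nonneg (sq_nonneg (ηl - ηm)) (sq_nonneg ηm)]
    have h10 : αm ^ 2 / αk ^ 5 ≤ 4 * ρl ^ 2 := by
      rw [div_le_iff₀ (by positivity)]
      have e1 : αm ^ 2 ≤ 2 * (αl ^ 2 + αk ^ 2) := by nlinarith [sq_nonneg (αl - αk)]
      have e2 : αl ^ 2 ≤ ρl ^ 2 * αk ^ 5 := by
        calc αl ^ 2 ≤ ρl ^ 2 * 1 := by rw [mul_one]; gcongr
          _ ≤ _ := by gcongr; exact one_le_pow₀ hαk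
      have e3 : αk ^ 2 ≤ ρl ^ 2 * αk ^ 5 := by
        calc αk ^ 2 ≤ 1 * αk ^ 5 := by rw [one_mul]; gcongr; norm_num
          _ ≤ _ := by gcongr; exact one_le_pow₀ hl
      linarith
    have p1 : αm ^ 20 / αk ^ 5 * ηl ^ 14 * ηm ^ 10 ≤ ρl ^ 16 * ρm ^ 32 := by
      calc αm ^ 20 / αk ^ 5 * ηl ^ 14 * ηm ^ 10 ≤ αm ^ 20 * ηl ^ 14 * ηm ^ 10 := by
            gcongr
            exact div_le_self (by positivity) (one_le_pow₀ hαk)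
        _ ≤ ρm ^ 20 * ρl ^ 14 * ρm ^ 10 := by gcongr
        _ = ρl ^ 14 * ρm ^ 30 := by ring
        _ ≤ _ := by gcongr <;> first | assumption | norm_num
    have p2 : αm ^ 20 / αk ^ 5 * ηl ^ 10 * ηm ^ 14 ≤ 4 * (ρl ^ 16 * ρm ^ 32) := by
      calc αm ^ 20 / αk ^ 5 * ηl ^ 10 * ηm ^ 14 = αm ^ 18 * (αm ^ 2 / αk ^ 5) * ηl ^ 10 * ηm ^ 14 := by
            ring
        _ ≤ ρm ^ 18 * (4 * ρl ^ 2) * ρl ^ 10 * ρm ^ 14 := by gcongr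
        _ = 4 * (ρl ^ 12 * ρm ^ 32) := by ring
        _ ≤ _ := by gcongr; norm_num
    calc ηk ^ 20 * αm ^ 20 / αk ^ 20 * (αk ^ 15 * ηl ^ 10 * ηm ^ 10)
        = ηk ^ 16 * ηk ^ 4 * (αm ^ 20 / αk ^ 5 * ηl ^ 10 * ηm ^ 10) := by field_simp
      _ ≤ ρk ^ 16 * (8 * (ηl ^ 4 + ηm ^ 4)) * (αm ^ 20 / αk ^ 5 * ηl ^ 10 * ηm ^ 10) := by gcongr
      _ = 8 * ρk ^ 16 * (αm ^ 20 / αk ^ 5 * ηl ^ 14 * ηm ^ 10 +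
            αm ^ 20 / αk ^ 5 * ηl ^ 10 * ηm ^ 14) := by ring
      _ ≤ 8 * ρk ^ 16 * (ρl ^ 16 * ρm ^ 32 + 4 * (ρl ^ 16 * ρm ^ 32)) := by gcongr
      _ = _ := by ring
  rw [add_mul]
  linarith

theorem japV_add_le (m n : ℤ) : japV (m + n) ≤ japV m + japV n := by
  unfold japV
  have := abs_add_le (m : ℝ) n
  push_cast
  linarith

theorem japH_neg (k : Freq) : japH (-k) = japH k := by simp [japH]

theorem japH_add_le (k l : Freq) : japH (k + l) ≤ japH k + japH l := by
  unfold japH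
  have := abs_add_le (k 0 : ℝ) (l 0)
  have := abs_add_le (k 1 : ℝ) (l 1)
  simp only [Pi.add_apply]
  push_cast
  linarith

theorem rpow_le_add_rpow {x y z p : ℝ} (hx : 0 ≤ x) (hy : 0 ≤ y) (hz : 0 ≤ z) (h : x ≤ y + z)
    (hp : 0 ≤ p) (hp1 : p ≤ 1) : x ^ p ≤ y ^ p + z ^ p :=
  (Real.rpow_le_rpow hx h hp).trans (Real.rpow_add_le_add_rpow hy hz hp hp1)

theorem rpow_pow {x p r : ℝ} (hx : 0 ≤ x) (n : ℕ) (h : p * n = r) : (x ^ p) ^ n = x ^ r := by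
  rw [← Real.rpow_natCast, ← Real.rpow_mul hx, h]

theorem controlsConvection_of_horiz {a : Freq → ℝ} {δ : ℝ} (hδ : 0 < δ)
    (hH : ∀ k, δ * japH k ^ 4 ≤ 1 + a k) (hV : ∀ k, δ * japV (k 2) ^ 2 ≤ 1 + a k) :
    ControlsConvection (quarterWeight a) := by
  have hρ : ∀ k, japH k ^ (1 / 2 : ℝ) ≤ ((1 + a k) / δ) ^ (1 / 8 : ℝ) := by
    intro k
    have h0 : 0 ≤ japH k := by linarith [one_le_japH k]
    rw [show (1 / 2 : ℝ) = (4 : ℕ) * (1 / 8 : ℝ) by norm_num, Real.rpow_mul h0, Real.rpow_natCast]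
    exact Real.rpow_le_rpow (by positivity) ((le_div_iff₀' hδ).2 (hH k)) (by norm_num)
  have hρ' : ∀ k : Freq, japV (k 2) ^ (1 / 4 : ℝ) ≤ ((1 + a k) / δ) ^ (1 / 8 : ℝ) := by
    intro k
    have h0 : 0 ≤ japV (k 2) := by linarith [one_le_japV (k 2)]
    rw [show (1 / 4 : ℝ) = (2 : ℕ) * (1 / 8 : ℝ) by norm_num, Real.rpow_mul h0, Real.rpow_natCast]
    exact Real.rpow_le_rpow (by positivity) ((le_div_iff₀' hδ).2 (hV k)) (by norm_num)
  have ha : ∀ k, 0 ≤ 1 + a k := fun k => le_trans (by positivity) (hV k)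
  have hw : ∀ k, (((1 + a k) / δ) ^ (1 / 8 : ℝ)) ^ 2 = quarterWeight a k * δ⁻¹ ^ (1 / 4 : ℝ) := by
    intro k
    rw [rpow_pow (r := 1 / 4) (by have := ha k; positivity) 2 (by norm_num), div_eq_mul_inv,
      Real.mul_rpow (ha k) (by positivity), quarterWeight]
  refine ⟨4 * (δ⁻¹ ^ (1 / 4 : ℝ)) ^ 4, by positivity, fun l m => ?_⟩
  have jV : ∀ n, 0 ≤ japV n := fun n => by linarith [one_le_japV n]
  have jH : ∀ n, 0 ≤ japH n := fun n => by linarith [one_le_japH n]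
  have p := horiz_weight_bound
    (Real.one_le_rpow (one_le_japV (m 2 - l 2)) (by norm_num : (0 : ℝ) ≤ 1 / 4))
    (Real.one_le_rpow (one_le_japV (l 2)) (by norm_num : (0 : ℝ) ≤ 1 / 4))
    (Real.one_le_rpow (one_le_japV (m 2)) (by norm_num : (0 : ℝ) ≤ 1 / 4))
    (Real.one_le_rpow (one_le_japH (m - l)) (by norm_num : (0 : ℝ) ≤ 1 / 2))
    (Real.one_le_rpow (one_le_japH l) (by norm_num : (0 : ℝ) ≤ 1 / 2))
    (Real.one_le_rpow (one_le_japH m) (by norm_num : (0 : ℝ) ≤ 1 / 2))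
    (hρ' (m - l)) (hρ' l) (hρ' m) (hρ (m - l)) (hρ l) (hρ m)
    (rpow_le_add_rpow (jV _) (jV _) (jV _) (by
      have := japV_add_le (-l 2) (m 2)
      rwa [japV_neg, neg_add_eq_sub] at this) (by norm_num) (by norm_num))
    (rpow_le_add_rpow (jV _) (jV _) (jV _) (by
      have := japV_add_le (l 2) (m 2 - l 2)
      rwa [add_sub_cancel] at this) (by norm_num) (by norm_num))
  have hw4 : (((1 + a m) / δ) ^ (1 / 8 : ℝ)) ^ 4 =
      (quarterWeight a m * δ⁻¹ ^ (1 / 4 : ℝ)) ^ 2 := by rw [← hw]; ring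
  rw [hw, hw, hw4,
    rpow_pow (r := 1) (jH _) 2 (by norm_num), rpow_pow (r := 1) (jH _) 2 (by norm_num),
    rpow_pow (r := 1) (jV _) 4 (by norm_num),
    rpow_pow (r := 1) (jV _) 4 (by norm_num), rpow_pow (r := 3 / 4) (jV _) 3 (by norm_num)] at p
  simp only [Real.rpow_one] at p
  unfold triKernel
  rw [← div_eq_mul_inv, le_div_iff₀ (by
    have := one_le_japV (m 2 - l 2)
    have := one_le_japH l
    have := one_le_japH m
    positivity)]
  refine p.trans (le_of_eq ?_)
  ring

theorem controlsConvection_of_full {a : Freq → ℝ} {δ : ℝ} (hδ : 0 < δ)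
    (hH : ∀ k, δ * japH k ^ (16 / 5 : ℝ) ≤ 1 + a k)
    (hV : ∀ k, δ * japV (k 2) ^ (16 / 5 : ℝ) ≤ 1 + a k) :
    ControlsConvection (quarterWeight a) := by
  have jV : ∀ n, 0 ≤ japV n := fun n => by linarith [one_le_japV n]
  have jH : ∀ n, 0 ≤ japH n := fun n => by linarith [one_le_japH n]
  have hρ : ∀ k, japH k ^ (1 / 20 : ℝ) ≤ ((1 + a k) / δ) ^ (1 / 64 : ℝ) := by
    intro k
    have h0 := jH k
    rw [show (1 / 20 : ℝ) = (16 / 5) * (1 / 64 : ℝ) by norm_num, Real.rpow_mul h0]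
    exact Real.rpow_le_rpow (by positivity) ((le_div_iff₀' hδ).2 (hH k)) (by norm_num)
  have hρ' : ∀ k : Freq, japV (k 2) ^ (1 / 20 : ℝ) ≤ ((1 + a k) / δ) ^ (1 / 64 : ℝ) := by
    intro k
    have h0 := jV (k 2)
    rw [show (1 / 20 : ℝ) = (16 / 5) * (1 / 64 : ℝ) by norm_num, Real.rpow_mul h0]
    exact Real.rpow_le_rpow (by positivity) ((le_div_iff₀' hδ).2 (hV k)) (by norm_num)
  have ha : ∀ k, 0 ≤ 1 + a k := fun k => by
    have h0 := jV (k 2)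
    exact le_trans (by positivity) (hV k)
  have hw : ∀ k, (((1 + a k) / δ) ^ (1 / 64 : ℝ)) ^ 16 = quarterWeight a k * δ⁻¹ ^ (1 / 4 : ℝ) := by
    intro k
    rw [rpow_pow (r := 1 / 4) (by have := ha k; positivity) 16 (by norm_num), div_eq_mul_inv,
      Real.mul_rpow (ha k) (by positivity), quarterWeight]
  refine ⟨41 * (δ⁻¹ ^ (1 / 4 : ℝ)) ^ 4, by positivity, fun l m => ?_⟩
  have p := full_weight_bound
    (Real.one_le_rpow (one_le_japV (m 2 - l 2)) (by norm_num : (0 : ℝ) ≤ 1 / 20))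
    (Real.one_le_rpow (one_le_japV (l 2)) (by norm_num : (0 : ℝ) ≤ 1 / 20))
    (Real.one_le_rpow (one_le_japV (m 2)) (by norm_num : (0 : ℝ) ≤ 1 / 20))
    (Real.one_le_rpow (one_le_japH (m - l)) (by norm_num : (0 : ℝ) ≤ 1 / 20))
    (Real.one_le_rpow (one_le_japH l) (by norm_num : (0 : ℝ) ≤ 1 / 20))
    (Real.one_le_rpow (one_le_japH m) (by norm_num : (0 : ℝ) ≤ 1 / 20))
    (hρ' (m - l)) (hρ' l) (hρ' m) (hρ (m - l)) (hρ l) (hρ m)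
    (rpow_le_add_rpow (jH _) (jH _) (jH _) (by
      have := japH_add_le (-l) m
      rwa [japH_neg, neg_add_eq_sub] at this) (by norm_num) (by norm_num))
    (rpow_le_add_rpow (jV _) (jV _) (jV _) (by
      have := japV_add_le (l 2) (m 2 - l 2)
      rwa [add_sub_cancel] at this) (by norm_num) (by norm_num))
  rw [hw, hw, show ∀ x : ℝ, x ^ 32 = (x ^ 16) ^ 2 from fun x => by ring, hw,
    rpow_pow (r := 1) (jH _) 20 (by norm_num), rpow_pow (r := 1) (jH _) 20 (by norm_num),
    rpow_pow (r := 1) (jV _) 20 (by norm_num),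
    rpow_pow (r := 1) (jV _) 20 (by norm_num), rpow_pow (r := 3 / 4) (jV _) 15 (by norm_num),
    rpow_pow (r := 1 / 2) (jH _) 10 (by norm_num), rpow_pow (r := 1 / 2) (jH _) 10 (by norm_num)] at p
  simp only [Real.rpow_one] at p
  unfold triKernel
  rw [← div_eq_mul_inv, le_div_iff₀ (by
    have := one_le_japV (m 2 - l 2)
    have := one_le_japH l
    have := one_le_japH m
    positivity)]
  refine p.trans (le_of_eq ?_)
  ring

theorem wave_sq (k : Freq) : wave k 0 ^ 2 = 4 * Real.pi ^ 2 * (k 0 : ℝ) ^ 2 ∧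
    wave k 1 ^ 2 = 4 * Real.pi ^ 2 * (k 1 : ℝ) ^ 2 ∧ wave k 2 ^ 2 = Real.pi ^ 2 * (k 2 : ℝ) ^ 2 := by
  simp only [wave, period, Matrix.cons_val]
  exact ⟨by ring, by ring, by ring⟩

theorem sq_le_wave_sq (k : Freq) (j : Fin 3) : (k j : ℝ) ^ 2 ≤ wave k j ^ 2 := by
  have h := wave_sq k
  have hp : 1 ≤ Real.pi ^ 2 := by nlinarith [Real.pi_gt_three]
  fin_cases j
  · change _ ≤ wave k 0 ^ 2
    rw [h.1]; change (k 0 : ℝ) ^ 2 ≤ _; nlinarith [sq_nonneg (k 0 : ℝ)]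
  · change _ ≤ wave k 1 ^ 2
    rw [h.2.1]; change (k 1 : ℝ) ^ 2 ≤ _; nlinarith [sq_nonneg (k 1 : ℝ)]
  · change _ ≤ wave k 2 ^ 2
    rw [h.2.2]; change (k 2 : ℝ) ^ 2 ≤ _; nlinarith [sq_nonneg (k 2 : ℝ)]

theorem controlsConvection_symbolHoriz {ν ε : ℝ} (hν : 0 < ν) (hε : 0 < ε) :
    ControlsConvection (quarterWeight (symbolHoriz ν ε)) := by
  set δ := min 1 (min ν ε) / 27 with hδ
  have hδ0 : 0 < δ := by positivity
  have d1 : 27 * δ ≤ 1 := by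
    have : min 1 (min ν ε) ≤ 1 := min_le_left _ _
    linarith
  have d2 : 27 * δ ≤ ν := by
    have : min 1 (min ν ε) ≤ ν := (min_le_right _ _).trans (min_le_left _ _)
    linarith
  have d3 : 27 * δ ≤ ε := by
    have : min 1 (min ν ε) ≤ ε := (min_le_right _ _).trans (min_le_right _ _)
    linarith
  refine controlsConvection_of_horiz hδ0 (fun k => ?_) fun k => ?_
  · have h0 := sq_le_wave_sq k 0
    have h1 := sq_le_wave_sq k 1
    have h2 := sq_nonneg (wave k 2)
    have hw : 0 ≤ ν * (wave k 0 ^ 2 + wave k 1 ^ 2 + wave k 2 ^ 2) := by positivity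
    have e1 : japH k ^ 4 ≤ 27 * (1 + (wave k 0 ^ 2 + wave k 1 ^ 2) ^ 2) := by
      have e0 : japH k ^ 2 ≤ 3 * (1 + ((k 0 : ℝ) ^ 2 + (k 1 : ℝ) ^ 2)) := by
        unfold japH
        rw [← sq_abs (k 0 : ℝ), ← sq_abs (k 1 : ℝ)]
        nlinarith [sq_nonneg (|(k 0 : ℝ)| - 1), sq_nonneg (|(k 1 : ℝ)| - 1),
          sq_nonneg (|(k 0 : ℝ)| - |(k 1 : ℝ)|)]
      have e2 : (japH k ^ 2) ^ 2 ≤ (3 * (1 + (wave k 0 ^ 2 + wave k 1 ^ 2))) ^ 2 := by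
        gcongr
        linarith
      nlinarith [sq_nonneg (wave k 0 ^ 2 + wave k 1 ^ 2 - 1)]
    have e3 : 0 ≤ (wave k 0 ^ 2 + wave k 1 ^ 2) ^ 2 := by positivity
    unfold symbolHoriz
    nlinarith
  · have h0 := sq_le_wave_sq k 2
    have e1 : japV (k 2) ^ 2 ≤ 2 * (1 + wave k 2 ^ 2) := by
      unfold japV
      rw [← sq_abs (k 2 : ℝ)] at h0
      nlinarith [sq_nonneg (|(k 2 : ℝ)| - 1)]
    have e2 : 0 ≤ ν * (wave k 0 ^ 2 + wave k 1 ^ 2) := by positivity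
    have e3 : 0 ≤ ε * (wave k 0 ^ 2 + wave k 1 ^ 2) ^ 2 := by positivity
    have e4 := sq_nonneg (wave k 2)
    unfold symbolHoriz
    nlinarith

theorem controlsConvection_symbolFull {ν ε : ℝ} (hν : 0 ≤ ν) (hε : 0 < ε) :
    ControlsConvection (quarterWeight (symbolFull ν ε)) := by
  set δ := min 1 ε / 36 with hδ
  have hδ0 : 0 < δ := by positivity
  have d1 : 36 * δ ≤ 1 := by
    have : min 1 ε ≤ 1 := min_le_left _ _
    linarith
  have d3 : 36 * δ ≤ ε := by
    have : min 1 ε ≤ ε := min_le_right _ _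
    linarith
  have key : ∀ (k : Freq) (x : ℝ), 0 ≤ x →
      x ^ 2 ≤ 3 * (1 + (wave k 0 ^ 2 + wave k 1 ^ 2 + wave k 2 ^ 2)) →
      δ * x ^ (16 / 5 : ℝ) ≤ 1 + symbolFull ν ε k := by
    intro k x hx h
    set s := wave k 0 ^ 2 + wave k 1 ^ 2 + wave k 2 ^ 2 with hs
    have hs0 : 0 ≤ s := by positivity
    have e1 : x ^ (16 / 5 : ℝ) ≤ 36 * (1 + s ^ (8 / 5 : ℝ)) := by
      calc x ^ (16 / 5 : ℝ) = (x ^ 2) ^ (8 / 5 : ℝ) := by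
            rw [← Real.rpow_natCast, ← Real.rpow_mul hx]; norm_num
        _ ≤ (6 * max 1 s) ^ (8 / 5 : ℝ) := by
            gcongr
            have := le_max_left 1 s
            have := le_max_right 1 s
            linarith
        _ = 6 ^ (8 / 5 : ℝ) * (max 1 s) ^ (8 / 5 : ℝ) := Real.mul_rpow (by norm_num) (by positivity)
        _ ≤ 6 ^ (2 : ℝ) * (1 + s ^ (8 / 5 : ℝ)) := by
            gcongr
            · norm_num
            · norm_num
            · have h0 : 0 ≤ s ^ (8 / 5 : ℝ) := by positivity
              rcases le_total 1 s with h1 | h1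
              · rw [max_eq_right h1]; linarith
              · rw [max_eq_left h1, Real.one_rpow]; linarith
        _ = _ := by norm_num
    have e2 : 0 ≤ ν * s := by positivity
    have e3 : 0 ≤ s ^ (8 / 5 : ℝ) := by positivity
    unfold symbolFull
    rw [← hs]
    nlinarith
  refine controlsConvection_of_full hδ0 (fun k => key k _ (by linarith [one_le_japH k]) ?_)
    fun k => key k _ (by linarith [one_le_japV (k 2)]) ?_
  · have h0 := sq_le_wave_sq k 0
    have h1 := sq_le_wave_sq k 1
    have h2 := sq_nonneg (wave k 2)
    have e0 : japH k ^ 2 ≤ 3 * (1 + ((k 0 : ℝ) ^ 2 + (k 1 : ℝ) ^ 2)) := by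
      unfold japH
      rw [← sq_abs (k 0 : ℝ), ← sq_abs (k 1 : ℝ)]
      nlinarith [sq_nonneg (|(k 0 : ℝ)| - 1), sq_nonneg (|(k 1 : ℝ)| - 1),
        sq_nonneg (|(k 0 : ℝ)| - |(k 1 : ℝ)|)]
    linarith
  · have h0 := sq_le_wave_sq k 2
    have h1 := sq_nonneg (wave k 0)
    have h2 := sq_nonneg (wave k 1)
    unfold japV
    rw [← sq_abs (k 2 : ℝ)] at h0
    nlinarith [sq_nonneg (|(k 2 : ℝ)| - 1)]

end Symbol

/-! ### The nonlinearity in frequency space -/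

section Flux

/-- `ξ_H(k) · d`, where `ξ_H(k)` is the horizontal part of the wave vector. -/
noncomputable def waveDot (k : Freq) (d : C2) : ℂ := ∑ i : Fin 2, (wave k i.castSucc : ℂ) * d i

/-- The Fourier coefficients of the vertical velocity of an admissible field. The quotient is `0`
for `k₃ = 0`. -/
noncomputable def vertFreq (k : Freq) (d : C2) : ℂ := -waveDot k d / (wave k 2 : ℂ)

/-- `i U · ξ(m)` for the three-dimensional velocity `U` with horizontal part `d` at frequency `k`. -/
noncomputable def flux (k m : Freq) (d : C2) : ℂ :=
  Complex.I * (waveDot m d + (wave m 2 : ℂ) * vertFreq k d)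

theorem waveDot_add (k : Freq) (d e : C2) : waveDot k (d + e) = waveDot k d + waveDot k e := by
  simp [waveDot]; ring

theorem waveDot_smul (k : Freq) (r : ℝ) (d : C2) : waveDot k (r • d) = r * waveDot k d := by
  simp [waveDot]; ring

theorem flux_add (k m : Freq) (d e : C2) : flux k m (d + e) = flux k m d + flux k m e := by
  simp only [flux, vertFreq, waveDot_add]; ring

theorem flux_smul (k m : Freq) (r : ℝ) (d : C2) : flux k m (r • d) = r * flux k m d := by
  simp only [flux, vertFreq, waveDot_smul]; ring

theorem norm_waveDot_le (k : Freq) (d : C2) : ‖waveDot k d‖ ≤ 8 * japH k * ‖d‖ := by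
  have h0 : ‖d 0‖ ≤ ‖d‖ := PiLp.norm_apply_le d 0
  have h1 : ‖d 1‖ ≤ ‖d‖ := PiLp.norm_apply_le d 1
  have hπ := Real.pi_pos
  have hπ4 := Real.pi_le_four
  have e0 : |wave k 0| = 2 * Real.pi * |(k 0 : ℝ)| := by
    simp [wave, period, abs_mul, abs_of_pos hπ]
  have e1 : |wave k 1| = 2 * Real.pi * |(k 1 : ℝ)| := by
    simp [wave, period, abs_mul, abs_of_pos hπ]
  calc ‖waveDot k d‖ ≤ |wave k 0| * ‖d 0‖ + |wave k 1| * ‖d 1‖ := by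
        rw [waveDot, Fin.sum_univ_two]
        refine (norm_add_le _ _).trans (le_of_eq ?_)
        rw [norm_mul, norm_mul, Complex.norm_real, Complex.norm_real]
        rfl
    _ ≤ 8 * |(k 0 : ℝ)| * ‖d‖ + 8 * |(k 1 : ℝ)| * ‖d‖ := by
        rw [e0, e1]
        gcongr <;> linarith
    _ ≤ 8 * japH k * ‖d‖ := by
        unfold japH
        nlinarith [norm_nonneg d]

theorem norm_flux_le (k m : Freq) (d : C2) :
    ‖flux k m d‖ ≤ 16 * (japH m + japH k * japV (m 2) / japV (k 2)) * ‖d‖ := by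
  have hm := norm_waveDot_le m d
  have hk := norm_waveDot_le k d
  have hπ := Real.pi_pos
  have j1 := one_le_japH m
  have j2 := one_le_japH k
  have j3 := one_le_japV (m 2)
  have j4 := one_le_japV (k 2)
  have hd := norm_nonneg d
  have e : ∀ n : Freq, |wave n 2| = Real.pi * |(n 2 : ℝ)| := fun n => by
    simp only [wave, period, Matrix.cons_val]
    rw [show 2 * Real.pi / 2 = Real.pi by ring, abs_mul, abs_of_pos hπ]
  have h2 : ‖(wave m 2 : ℂ) * vertFreq k d‖ ≤ 16 * (japH k * japV (m 2) / japV (k 2)) * ‖d‖ := by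
    rw [vertFreq, norm_mul, norm_div, norm_neg, Complex.norm_real, Complex.norm_real,
      Real.norm_eq_abs, Real.norm_eq_abs, e, e]
    by_cases hk2 : k 2 = 0
    · have : 0 ≤ 16 * (japH k * japV (m 2) / japV (k 2)) * ‖d‖ := by positivity
      simpa [hk2] using this
    · have h3 : (1 : ℝ) ≤ |(k 2 : ℝ)| := by exact_mod_cast Int.one_le_abs hk2
      have h4 : japV (k 2) ≤ 2 * |(k 2 : ℝ)| := by unfold japV; linarith
      have h5 : |(m 2 : ℝ)| ≤ japV (m 2) := by unfold japV; linarith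
      calc Real.pi * |(m 2 : ℝ)| * (‖waveDot k d‖ / (Real.pi * |(k 2 : ℝ)|))
          = |(m 2 : ℝ)| * ‖waveDot k d‖ / |(k 2 : ℝ)| := by field_simp
        _ ≤ japV (m 2) * (8 * japH k * ‖d‖) / (japV (k 2) / 2) := by
            gcongr
            linarith
        _ = _ := by field_simp; ring
  rw [flux, norm_mul, Complex.norm_I, one_mul]
  refine (norm_add_le _ _).trans ?_
  nlinarith [mul_nonneg (by linarith : 0 ≤ japH m) hd]

end Flux

section Transport

variable {q : Freq → ℝ}

/-- The terms of the convolution which represents `b^{-1/2} (U · ∇) v'` when `x = b^{1/4} v` and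
`y = b^{1/4} v'`, where `q = b^{1/4}`. -/
noncomputable def convTerm (q : Freq → ℝ) (x y : Freq → C2) (m l : Freq) : C2 :=
  ((q m ^ 2)⁻¹ : ℝ) • (flux (m - l) m ((q (m - l))⁻¹ • x (m - l)) • ((q l)⁻¹ • y l))

theorem convTerm_add_left (x x' y : Freq → C2) (m l : Freq) :
    convTerm q (x + x') y m l = convTerm q x y m l + convTerm q x' y m l := by
  simp only [convTerm, Pi.add_apply, smul_add, flux_add, add_smul]

theorem convTerm_add_right (x y y' : Freq → C2) (m l : Freq) :
    convTerm q x (y + y') m l = convTerm q x y m l + convTerm q x y' m l := by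
  simp only [convTerm, Pi.add_apply, smul_add]

theorem convTerm_smul_left (r : ℝ) (x y : Freq → C2) (m l : Freq) :
    convTerm q (r • x) y m l = r • convTerm q x y m l := by
  simp only [convTerm, Pi.smul_apply]
  rw [smul_comm _ r, flux_smul, mul_smul, Complex.coe_smul, smul_comm (_ : ℝ) r]

theorem convTerm_smul_right (r : ℝ) (x y : Freq → C2) (m l : Freq) :
    convTerm q x (r • y) m l = r • convTerm q x y m l := by
  simp only [convTerm, Pi.smul_apply]
  generalize flux (m - l) m ((q (m - l))⁻¹ • x (m - l)) = z
  rw [smul_comm (q l)⁻¹ r, smul_comm z r, smul_comm _ r]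

open scoped ENNReal

theorem exists_norm_convTerm_le (hq : ∀ k, 0 < q k) (h : ControlsConvection q) :
    ∃ C : NNReal, ∀ (x y : Freq → C2) (m l : Freq),
      ‖convTerm q x y m l‖ₑ ≤ C * (ENNReal.ofReal (triKernel l m) * (‖x (m - l)‖ₑ * ‖y l‖ₑ)) := by
  obtain ⟨C, hC0, hC⟩ := h
  refine ⟨(16 * C).toNNReal, fun x y m l => ?_⟩
  have h1 : ‖convTerm q x y m l‖ ≤ (16 * C) * (triKernel l m * (‖x (m - l)‖ * ‖y l‖)) := by
    have q1 := hq m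
    have q2 := hq (m - l)
    have q3 := hq l
    have e := norm_flux_le (m - l) m ((q (m - l))⁻¹ • x (m - l))
    rw [norm_smul, Real.norm_of_nonneg (inv_nonneg.2 q2.le)] at e
    rw [convTerm, norm_smul, norm_smul, norm_smul, Real.norm_of_nonneg (by positivity),
      Real.norm_of_nonneg (inv_nonneg.2 q3.le)]
    calc (q m ^ 2)⁻¹ * (‖flux (m - l) m ((q (m - l))⁻¹ • x (m - l))‖ * ((q l)⁻¹ * ‖y l‖))
        ≤ (q m ^ 2)⁻¹ * ((16 * (japH m + japH (m - l) * japV (m 2) / japV ((m - l) 2)) *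
            ((q (m - l))⁻¹ * ‖x (m - l)‖)) * ((q l)⁻¹ * ‖y l‖)) := by gcongr
      _ ≤ (q m ^ 2)⁻¹ * ((16 * (C * (q (m - l) * q l * q m ^ 2) * triKernel l m) *
            ((q (m - l))⁻¹ * ‖x (m - l)‖)) * ((q l)⁻¹ * ‖y l‖)) := by
          have := hC l m
          rw [show (m - l) 2 = m 2 - l 2 from rfl]
          gcongr
      _ = _ := by field_simp
  rw [← ofReal_norm, ← ofReal_norm, ← ofReal_norm]
  refine (ENNReal.ofReal_le_ofReal h1).trans (le_of_eq ?_)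
  rw [ENNReal.ofReal_mul (by positivity), ENNReal.ofReal_mul (triKernel_pos l m).le,
    ENNReal.ofReal_mul (norm_nonneg _)]
  rfl

theorem tsum_enorm_sq (x : Ell2) : ∑' k, ‖x k‖ₑ ^ 2 = ENNReal.ofReal (‖x‖ ^ 2) := by
  rw [← (hasSum_norm_sq x).tsum_eq, ENNReal.ofReal_tsum_of_nonneg (fun k => by positivity)
    (hasSum_norm_sq x).summable]
  exact tsum_congr fun k => by rw [ENNReal.ofReal_pow (norm_nonneg _), ofReal_norm]

/-- The bound for the convolution sums, with absolute values inside. -/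
theorem exists_tsum_convTerm_le (hq : ∀ k, 0 < q k) (h : ControlsConvection q) :
    ∃ C : NNReal, ∀ x y : Ell2,
      ∑' m, (∑' l, ‖convTerm q x y m l‖ₑ) ^ 2 ≤ ENNReal.ofReal ((C * ‖x‖ * ‖y‖) ^ 2) := by
  obtain ⟨C, hC⟩ := exists_norm_convTerm_le hq h
  obtain ⟨D, hD⟩ := exists_tsum_bilin_sq_le
  refine ⟨C * NNReal.sqrt D, fun x y => ?_⟩
  calc ∑' m, (∑' l, ‖convTerm q x y m l‖ₑ) ^ 2
      ≤ ∑' m, (∑' l, C * (ENNReal.ofReal (triKernel l m) * (‖x (m - l)‖ₑ * ‖y l‖ₑ))) ^ 2 := by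
        gcongr with m l
        exact hC x y m l
    _ ≤ C ^ 2 * (D * ((∑' k, ‖x k‖ₑ ^ 2) * ∑' k, ‖y k‖ₑ ^ 2)) := by
        simp only [ENNReal.tsum_mul_left, mul_pow]
        gcongr
        exact hD (fun k => ‖x k‖ₑ) (fun k => ‖y k‖ₑ)
    _ = _ := by
        rw [tsum_enorm_sq, tsum_enorm_sq, mul_pow, mul_pow, ENNReal.ofReal_mul (by positivity),
          ENNReal.ofReal_mul (by positivity), NNReal.coe_mul, mul_pow, ← NNReal.coe_pow, ← NNReal.coe_pow,
          NNReal.sq_sqrt, ← NNReal.coe_mul, ENNReal.ofReal_coe_nnreal]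
        push_cast
        ring

theorem summable_convTerm (hq : ∀ k, 0 < q k) (h : ControlsConvection q) (x y : Ell2) (m : Freq) :
    Summable (convTerm q x y m) := by
  obtain ⟨C, hC⟩ := exists_tsum_convTerm_le hq h
  refine Summable.of_enorm fun htop => ?_
  have := (ENNReal.le_tsum m).trans (hC x y)
  rw [htop] at this
  simp at this

/-- The convolution as a bounded bilinear operator on `ℓ²`. -/
theorem exists_transport (hq : ∀ k, 0 < q k) (h : ControlsConvection q) :
    ∃ N : Ell2 →L[ℝ] Ell2 →L[ℝ] Ell2, ∀ x y m, N x y m = ∑' l, convTerm q x y m l := by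
  obtain ⟨C, hC⟩ := exists_tsum_convTerm_le hq h
  have hs := fun (x y : Ell2) m => summable_convTerm hq h x y m
  have hle : ∀ x y : Ell2, ∑' m, ‖∑' l, convTerm q x y m l‖ₑ ^ 2 ≤
      ENNReal.ofReal ((C * ‖x‖ * ‖y‖) ^ 2) := by
    intro x y
    refine (ENNReal.tsum_le_tsum fun m => ?_).trans (hC x y)
    gcongr
    exact enorm_tsum_le_tsum_enorm
  have hmem : ∀ x y : Ell2, Memℓp (fun m => ∑' l, convTerm q x y m l) 2 := by
    intro x y
    rw [memlp_two_iff, ← summable_norm_iff]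
    refine Summable.of_enorm (ne_top_of_le_ne_top ENNReal.ofReal_ne_top (le_trans (le_of_eq ?_) (hle x y)))
    exact tsum_congr fun k => by rw [enorm_norm, enorm_pow, enorm_norm]
  refine ⟨LinearMap.mkContinuous₂ (LinearMap.mk₂ ℝ (fun x y => ⟨_, hmem x y⟩) ?_ ?_ ?_ ?_) C ?_,
    fun x y m => rfl⟩
  · intro x x' y
    ext m : 2
    exact (tsum_congr fun l => convTerm_add_left x x' y m l).trans ((hs x y m).tsum_add (hs x' y m))
  · intro r x y
    ext m : 2
    exact (tsum_congr fun l => convTerm_smul_left r x y m l).trans ((hs x y m).tsum_const_smul r)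
  · intro x y y'
    ext m : 2
    exact (tsum_congr fun l => convTerm_add_right x y y' m l).trans ((hs x y m).tsum_add (hs x y' m))
  · intro r x y
    ext m : 2
    exact (tsum_congr fun l => convTerm_smul_right r x y m l).trans ((hs x y m).tsum_const_smul r)
  · intro x y
    have h1 := hle x y
    have h2 := tsum_enorm_sq (⟨_, hmem x y⟩ : Ell2)
    rw [LinearMap.mk₂_apply]
    refine le_of_pow_le_pow_left₀ (n := 2) (by norm_num) (by positivity) ?_
    rw [← ENNReal.ofReal_le_ofReal_iff (by positivity), ← h2]
    exact h1

end Transport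

/-! ### Admissible sequences and the nonlinear operator -/

section Admissible

/-- The reflection `z ↦ -z` of frequencies. -/
def reflZ (k : Freq) : Freq := Function.update k 2 (-k 2)

/-- The constraints satisfied by the Fourier coefficients of real-valued fields, even in `z`, whose
vertical average is horizontally divergence free. -/
def Admissible (c : Freq → C2) : Prop :=
  (∀ k, k 2 = 0 → waveDot k (c k) = 0) ∧ (∀ k, c (reflZ k) = c k) ∧
    ∀ (k : Freq) (i : Fin 2), c (-k) i = (starRingEnd ℂ) (c k i)

theorem reflZ_apply (k : Freq) : reflZ k 0 = k 0 ∧ reflZ k 1 = k 1 ∧ reflZ k 2 = -k 2 := by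
  simp [reflZ]

theorem reflZ_involutive : Function.Involutive reflZ := by
  intro k; ext j; fin_cases j <;> simp [reflZ]

theorem reflZ_sub (k l : Freq) : reflZ (k - l) = reflZ k - reflZ l := by
  ext j; fin_cases j <;> simp [reflZ, sub_eq_add_neg, add_comm]

theorem wave_neg (k : Freq) (j : Fin 3) : wave (-k) j = -wave k j := by simp [wave]

theorem wave_sub (k l : Freq) (j : Fin 3) : wave (k - l) j = wave k j - wave l j := by
  simp [wave]; ring

theorem wave_reflZ (k : Freq) :
    wave (reflZ k) 0 = wave k 0 ∧ wave (reflZ k) 1 = wave k 1 ∧ wave (reflZ k) 2 = -wave k 2 := by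
  simp [wave, reflZ_apply]

theorem wave_two_eq_zero_iff (k : Freq) : wave k 2 = 0 ↔ k 2 = 0 := by
  have := Real.pi_pos.ne'
  simp [wave, period, this]

theorem waveDot_eq (k : Freq) (d : C2) : waveDot k d = wave k 0 * d 0 + wave k 1 * d 1 := by
  simp [waveDot, Fin.sum_univ_two]

theorem waveDot_sub_left (k l : Freq) (d : C2) : waveDot (k - l) d = waveDot k d - waveDot l d := by
  simp only [waveDot_eq, wave_sub]; push_cast; ring

theorem waveDot_eq_pi (k : Freq) (d : C2) :
    waveDot k d = 2 * Real.pi * ∑ j : Fin 2, (k j.castSucc : ℂ) * d j := by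
  simp [waveDot_eq, Fin.sum_univ_two, wave, period]; ring

theorem sum_mul_eq_zero_iff (k : Freq) (d : C2) :
    ∑ j : Fin 2, (k j.castSucc : ℂ) * d j = 0 ↔ waveDot k d = 0 := by
  have : (Real.pi : ℂ) ≠ 0 := by exact_mod_cast Real.pi_pos.ne'
  rw [waveDot_eq_pi]
  simp [this]

theorem freq_sq_ne_zero {k : Freq} (h : k 0 ≠ 0 ∨ k 1 ≠ 0) : (k 0 : ℂ) ^ 2 + (k 1 : ℂ) ^ 2 ≠ 0 := by
  have h1 : (k 0) ^ 2 + (k 1) ^ 2 ≠ 0 := by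
    rcases h with h | h <;> positivity
  exact_mod_cast h1

theorem hydroProj_of_waveDot {c : Freq → C2} {k : Freq} (h : k 2 = 0 → waveDot k (c k) = 0) :
    hydroProj c k = c k := by
  unfold hydroProj
  split_ifs with h2
  · rw [(sum_mul_eq_zero_iff k (c k)).2 (h h2)]
    ext i
    simp
  · rfl

theorem waveDot_hydroProj (c : Freq → C2) {k : Freq} (h : k 2 = 0) :
    waveDot k (hydroProj c k) = 0 := by
  by_cases hk : k 0 ≠ 0 ∨ k 1 ≠ 0
  · have h1 := freq_sq_ne_zero hk
    rw [← sum_mul_eq_zero_iff]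
    simp only [hydroProj, if_pos h, Fin.sum_univ_two, PiLp.sub_apply]
    simp only [Fin.castSucc_zero, Fin.isValue, Fin.castSucc_one]
    field_simp
    ring
  · push Not at hk
    rw [waveDot_eq_pi]
    simp [Fin.sum_univ_two, hk]

theorem hydroProj_eq_self_iff {c : Freq → C2} :
    hydroProj c = c ↔ ∀ k, k 2 = 0 → waveDot k (c k) = 0 := by
  constructor
  · intro h k hk
    rw [← h]
    exact waveDot_hydroProj c hk
  · intro h
    exact funext fun k => hydroProj_of_waveDot (h k)

theorem admissible_iff {c : Freq → C2} : Admissible c ↔ hydroProj c = c ∧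
    (∀ k : Freq, c (Function.update k 2 (-k 2)) = c k) ∧
    ∀ (k : Freq) (i : Fin 2), c (-k) i = (starRingEnd ℂ) (c k i) := by
  rw [hydroProj_eq_self_iff]; rfl

theorem real_inner_C2 (d e : C2) : inner ℝ d e = (∑ i, (starRingEnd ℂ) (d i) * e i).re := by
  rw [PiLp.inner_apply, Complex.re_sum]
  refine Finset.sum_congr rfl fun i _ => ?_
  rw [Complex.inner, mul_comm]

theorem real_inner_smul_C2 (z : ℂ) (d e : C2) :
    inner ℝ (z • d) e = inner ℝ d ((starRingEnd ℂ) z • e) := by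
  simp only [real_inner_C2]
  congr 1
  refine Finset.sum_congr rfl fun i _ => ?_
  simp
  ring

/-- The hydrostatic projection is orthogonal onto the sequences whose modes with `k₃ = 0` are
divergence free. -/
theorem inner_sub_hydroProj (c : Freq → C2) {k : Freq} {e : C2} (h : k 2 = 0 → waveDot k e = 0) :
    inner ℝ (c k - hydroProj c k) e = 0 := by
  by_cases h2 : k 2 = 0
  · have h3 := (sum_mul_eq_zero_iff k e).2 (h h2)
    rw [real_inner_C2]
    simp only [hydroProj, if_pos h2, sub_sub_cancel]
    have : ∑ i : Fin 2, (starRingEnd ℂ) ((k i.castSucc : ℂ) * (∑ j : Fin 2, (k j.castSucc : ℂ) * c k j) /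
        ((k 0 : ℂ) ^ 2 + (k 1 : ℂ) ^ 2)) * e i =
        (starRingEnd ℂ) ((∑ j : Fin 2, (k j.castSucc : ℂ) * c k j) / ((k 0 : ℂ) ^ 2 + (k 1 : ℂ) ^ 2)) *
          ∑ i : Fin 2, (k i.castSucc : ℂ) * e i := by
      rw [Finset.mul_sum]
      refine Finset.sum_congr rfl fun i _ => ?_
      rw [mul_div_assoc, map_mul]
      simp only [map_intCast]
      ring
    rw [this, h3, mul_zero, Complex.zero_re]
  · simp [hydroProj, h2]

theorem norm_hydroProj_le (c : Freq → C2) (k : Freq) : ‖hydroProj c k‖ ≤ ‖c k‖ := by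
  have h1 := inner_sub_hydroProj c (k := k) (e := hydroProj c k) fun h => waveDot_hydroProj c h
  have h2 := norm_add_sq_real (c k - hydroProj c k) (hydroProj c k)
  rw [sub_add_cancel, h1] at h2
  refine le_of_pow_le_pow_left₀ (n := 2) (by norm_num) (norm_nonneg _) ?_
  nlinarith [sq_nonneg ‖c k - hydroProj c k‖]

theorem memlp_hydroProj {c : Freq → C2} (h : Memℓp c 2) : Memℓp (hydroProj c) 2 := by
  rw [memlp_two_iff] at h ⊢
  refine Summable.of_nonneg_of_le (fun k => by positivity) (fun k => ?_) h
  gcongr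
  exact norm_hydroProj_le c k

theorem Admissible.hydroProj_of_symm {c : Freq → C2} (h : ∀ k, c (reflZ k) = c k)
    (h' : ∀ (k : Freq) (i : Fin 2), c (-k) i = (starRingEnd ℂ) (c k i)) : Admissible (hydroProj c) := by
  refine ⟨fun k hk => waveDot_hydroProj c hk, fun k => ?_, fun k i => ?_⟩
  · obtain ⟨r0, r1, r2⟩ := reflZ_apply k
    unfold hydroProj
    rw [r0, r1, r2, h k]
    by_cases h2 : k 2 = 0
    · have : reflZ k = k := by
        ext j; fin_cases j <;> simp [reflZ, h2]
      simp [h2, this]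
    · simp [h2]
  · unfold hydroProj
    by_cases h2 : k 2 = 0
    · simp [h2, h', Fin.sum_univ_two, neg_div]
      ring
    · simp [h2, h']

/-- The closed subspace of admissible sequences in `ℓ²`. -/
def admSubmodule : Submodule ℝ Ell2 where
  carrier := {x | Admissible x}
  zero_mem' := by
    refine ⟨fun k _ => ?_, fun k => rfl, fun k i => ?_⟩
    · simp [waveDot]
    · simp
  add_mem' := by
    rintro x y ⟨h1, h2, h3⟩ ⟨g1, g2, g3⟩
    refine ⟨fun k hk => ?_, fun k => ?_, fun k i => ?_⟩
    · rw [lp.coeFn_add, Pi.add_apply, waveDot_add, h1 k hk, g1 k hk, add_zero]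
    · rw [lp.coeFn_add, Pi.add_apply, Pi.add_apply, h2, g2]
    · rw [lp.coeFn_add, Pi.add_apply, Pi.add_apply, PiLp.add_apply, PiLp.add_apply, h3, g3, map_add]
  smul_mem' := by
    rintro r x ⟨h1, h2, h3⟩
    refine ⟨fun k hk => ?_, fun k => ?_, fun k i => ?_⟩
    · rw [lp.coeFn_smul, Pi.smul_apply, waveDot_smul, h1 k hk, mul_zero]
    · rw [lp.coeFn_smul, Pi.smul_apply, Pi.smul_apply, h2]
    · rw [lp.coeFn_smul, Pi.smul_apply, Pi.smul_apply, PiLp.smul_apply, PiLp.smul_apply, h3]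
      simp

theorem mem_admSubmodule {x : Ell2} : x ∈ admSubmodule ↔ Admissible x := Iff.rfl

theorem isClosed_admSubmodule : IsClosed (admSubmodule : Set Ell2) := by
  have hc : ∀ k : Freq, Continuous fun x : Ell2 => x k := continuous_seq_apply
  have hci : ∀ (k : Freq) (i : Fin 2), Continuous fun x : Ell2 => x k i := fun k i =>
    (EuclideanSpace.proj (𝕜 := ℂ) i).continuous.comp (hc k)
  have c1 : ∀ k : Freq, IsClosed {x : Ell2 | k 2 = 0 → waveDot k (x k) = 0} := by
    intro k
    by_cases hk : k 2 = 0
    · simp only [hk, true_imp_iff, waveDot_eq]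
      have h0 := hci k 0
      have h1 := hci k 1
      exact isClosed_eq ((continuous_const.mul h0).add (continuous_const.mul h1)) continuous_const
    · simp [hk]
  have c2 : ∀ k : Freq, IsClosed {x : Ell2 | x (reflZ k) = x k} := fun k =>
    isClosed_eq (hc (reflZ k)) (hc k)
  have c3 : ∀ (k : Freq) (i : Fin 2), IsClosed {x : Ell2 | x (-k) i = (starRingEnd ℂ) (x k i)} := by
    intro k i
    have h1 : Continuous fun x : Ell2 => (starRingEnd ℂ) (x k i) :=
      Complex.continuous_conj.comp (hci k i)
    exact isClosed_eq (hci (-k) i) h1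
  have h := (isClosed_iInter c1).inter ((isClosed_iInter c2).inter
    (isClosed_iInter fun k => isClosed_iInter (c3 k)))
  convert h using 1
  ext x
  simp only [mem_inter_iff, mem_iInter]
  rfl

instance : admSubmodule.HasOrthogonalProjection :=
  haveI : CompleteSpace admSubmodule := isClosed_admSubmodule.completeSpace_coe
  inferInstance

/-- The projection of a real and even sequence on the admissible ones. -/
theorem starProjection_eq_hydroProj {x : Ell2} (h : ∀ k, x (reflZ k) = x k)
    (h' : ∀ (k : Freq) (i : Fin 2), x (-k) i = (starRingEnd ℂ) (x k i)) (k : Freq) :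
    admSubmodule.starProjection x k = hydroProj x k := by
  have : (⟨_, memlp_hydroProj (lp.memℓp x)⟩ : Ell2) = admSubmodule.starProjection x := by
    refine (Submodule.eq_starProjection_of_mem_of_inner_eq_zero
      (Admissible.hydroProj_of_symm h h') fun w hw => ?_).symm
    rw [lp.inner_eq_tsum]
    refine (tsum_congr fun k => ?_).trans tsum_zero
    exact inner_sub_hydroProj x (hw.1 k)
  rw [← this]

end Admissible

section Cancellation

variable {q : Freq → ℝ}

theorem Admissible.smul {c : Freq → C2} (hc : Admissible c) (hr : ∀ k, q (reflZ k) = q k)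
    (hn : ∀ k, q (-k) = q k) : Admissible fun k => q k • c k := by
  refine ⟨fun k hk => ?_, fun k => ?_, fun k i => ?_⟩
  · rw [waveDot_smul, hc.1 k hk, mul_zero]
  · simp only [hr, hc.2.1]
  · simp [hn, hc.2.2]

theorem memlp_inv_smul (hq : ∀ k, 1 ≤ q k) (x : Ell2) : Memℓp (fun k => (q k)⁻¹ • x k) 2 := by
  rw [memlp_two_iff]
  refine Summable.of_nonneg_of_le (fun k => sq_nonneg _) (fun k => ?_) (hasSum_norm_sq x).summable
  rw [norm_smul, Real.norm_of_nonneg (inv_nonneg.2 (zero_le_one.trans (hq k)))]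
  have h0 : 0 ≤ (q k)⁻¹ := inv_nonneg.2 (zero_le_one.trans (hq k))
  refine pow_le_pow_left₀ (mul_nonneg h0 (norm_nonneg _)) ?_ 2
  exact mul_le_of_le_one_left (norm_nonneg (x k)) (inv_le_one_of_one_le₀ (hq k))

/-- The projection on the admissible sequences commutes with symmetric real multipliers. -/
theorem starProjection_multiplier (hq : ∀ k, 1 ≤ q k) (hr : ∀ k, q (reflZ k) = q k)
    (hn : ∀ k, q (-k) = q k) {X V : Ell2} (h : ∀ k, V k = q k • X k) (k : Freq) :
    admSubmodule.starProjection V k = q k • admSubmodule.starProjection X k := by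
  have hq0 : ∀ k, q k ≠ 0 := fun k => (zero_lt_one.trans_le (hq k)).ne'
  have hmem : ∀ {w : Ell2}, w ∈ admSubmodule → Admissible fun k => (q k)⁻¹ • w k := fun hw =>
    Admissible.smul (q := fun k => (q k)⁻¹) hw (fun k => by rw [hr]) (fun k => by rw [hn])
  have : (⟨_, memlp_inv_smul hq (admSubmodule.starProjection V)⟩ : Ell2) =
      admSubmodule.starProjection X := by
    refine (Submodule.eq_starProjection_of_mem_of_inner_eq_zero
      (hmem (Submodule.starProjection_apply_mem _ V)) fun w hw => ?_).symm
    have h1 := Submodule.starProjection_inner_eq_zero (K := admSubmodule) V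
      ⟨_, memlp_inv_smul hq w⟩ (hmem hw)
    rw [lp.inner_eq_tsum] at h1 ⊢
    rw [← h1]
    refine tsum_congr fun k => ?_
    rw [lp.coeFn_sub, lp.coeFn_sub, Pi.sub_apply, Pi.sub_apply, h]
    change inner ℝ (X k - (q k)⁻¹ • (admSubmodule.starProjection V) k) (w k) =
      inner ℝ (q k • X k - (admSubmodule.starProjection V) k) ((q k)⁻¹ • w k)
    rw [real_inner_smul_right, ← real_inner_smul_left, smul_sub, inv_smul_smul₀ (hq0 k)]
  rw [← this]
  exact (smul_inv_smul₀ (hq0 k) _).symm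

/-- The three-dimensional velocity is divergence free: its flux at frequency `k` through `ξ(k)`
vanishes. -/
theorem flux_self {k : Freq} {d : C2} (h : k 2 = 0 → waveDot k d = 0) : flux k k d = 0 := by
  unfold flux vertFreq
  by_cases h2 : k 2 = 0
  · rw [h h2]; simp
  · have : (wave k 2 : ℂ) ≠ 0 := by
      exact_mod_cast (wave_two_eq_zero_iff k).not.2 h2
    field_simp
    simp

theorem flux_sub (k l m : Freq) (d : C2) : flux k (m - l) d = flux k m d - flux k l d := by
  unfold flux
  rw [waveDot_sub_left, wave_sub]
  push_cast
  ring

theorem waveDot_conj {d d' : C2} (h : ∀ i, d' i = (starRingEnd ℂ) (d i)) (k : Freq) :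
    waveDot k d' = (starRingEnd ℂ) (waveDot k d) := by
  simp [waveDot_eq, h]

theorem waveDot_neg_left (k : Freq) (d : C2) : waveDot (-k) d = -waveDot k d := by
  simp only [waveDot_eq, wave_neg]; push_cast; ring

theorem flux_conj {d d' : C2} (h : ∀ i, d' i = (starRingEnd ℂ) (d i)) (k m : Freq) :
    flux (-k) m d' = -(starRingEnd ℂ) (flux k m d) := by
  unfold flux vertFreq
  rw [waveDot_neg_left, wave_neg, waveDot_conj h, waveDot_conj h]
  simp [neg_div, div_neg]

theorem flux_neg_right (k m : Freq) (d : C2) : flux k (-m) d = -flux k m d := by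
  unfold flux
  rw [waveDot_neg_left, wave_neg]
  push_cast
  ring

theorem flux_reflZ (k m : Freq) (d : C2) : flux (reflZ k) (reflZ m) d = flux k m d := by
  obtain ⟨h0, h1, h2⟩ := wave_reflZ k
  obtain ⟨g0, g1, g2⟩ := wave_reflZ m
  unfold flux vertFreq
  rw [waveDot_eq, waveDot_eq, waveDot_eq, waveDot_eq, h0, h1, h2, g0, g1, g2]
  push_cast
  rw [div_neg]
  ring

/-- The convection by the velocity with coefficients `c` of the field with coefficients `d`. -/
noncomputable def transport (c d : Freq → C2) (m : Freq) : C2 :=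
  ∑' l, flux (m - l) m (c (m - l)) • d l

theorem transport_reflZ {c d : Freq → C2} (hc : Admissible c) (hd : Admissible d) (m : Freq) :
    transport c d (reflZ m) = transport c d m := by
  unfold transport
  rw [← (Function.Involutive.toPerm reflZ reflZ_involutive).tsum_eq]
  refine tsum_congr fun l => ?_
  rw [Function.Involutive.coe_toPerm, ← reflZ_sub, flux_reflZ, hc.2.1, hd.2.1]

theorem transport_neg {c d : Freq → C2} (hc : Admissible c) (hd : Admissible d)
    {m : Freq} (hs : Summable fun l => flux (m - l) m (c (m - l)) • d l) (i : Fin 2) :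
    transport c d (-m) i = (starRingEnd ℂ) (transport c d m i) := by
  have h1 : ∀ l, flux (-m - -l) (-m) (c (-m - -l)) • d (-l) =
      WithLp.toLp 2 fun i => (starRingEnd ℂ) ((flux (m - l) m (c (m - l)) • d l) i) := by
    intro l
    have e : -m - -l = -(m - l) := by abel
    rw [e, flux_neg_right, flux_conj (hc.2.2 (m - l)), neg_neg]
    ext i
    simp [hd.2.2]
  have h2 := (ContinuousLinearMap.hasSum (EuclideanSpace.proj (𝕜 := ℂ) i) hs.hasSum).map
    (starRingEnd ℂ) Complex.continuous_conj
  have h3 : HasSum (fun l => flux (-m - l) (-m) (c (-m - l)) • d l)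
      (WithLp.toLp 2 fun i => (starRingEnd ℂ) (transport c d m i)) := by
    rw [← (Equiv.neg Freq).hasSum_iff]
    have e : (fun l => flux (-m - l) (-m) (c (-m - l)) • d l) ∘ (Equiv.neg Freq) =
      fun l => WithLp.toLp 2 fun i => (starRingEnd ℂ) ((flux (m - l) m (c (m - l)) • d l) i) :=
      funext h1
    rw [e]
    have h4 : Tendsto (fun s : Finset Freq => (WithLp.toLp 2 fun i : Fin 2 => ∑ l ∈ s,
        (starRingEnd ℂ) ((flux (m - l) m (c (m - l)) • d l) i) : C2)) atTop
        (𝓝 (WithLp.toLp 2 fun i => (starRingEnd ℂ) (transport c d m i))) := by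
      refine ((PiLp.continuous_toLp 2 _).tendsto _).comp (tendsto_pi_nhds.2 fun i => ?_)
      exact (ContinuousLinearMap.hasSum (EuclideanSpace.proj (𝕜 := ℂ) i) hs.hasSum).map
        (starRingEnd ℂ) Complex.continuous_conj
    refine h4.congr fun s => ?_
    ext i
    simp
  rw [transport, h3.tsum_eq]

theorem tsum_convTerm (x y : Freq → C2) (m : Freq) : ∑' l, convTerm q x y m l =
    (q m ^ 2)⁻¹ • transport (fun k => (q k)⁻¹ • x k) (fun k => (q k)⁻¹ • y k) m := by
  simp only [convTerm, transport]
  exact tsum_const_smul'' _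

open scoped ENNReal

/-- The convection does no work: by the divergence constraint, the exchange of the two
frequencies of the convected field turns the double sum into its negative. -/
theorem inner_transport_self (hq : ∀ k, 1 ≤ q k) (h : ControlsConvection q)
    (hr : ∀ k, q (reflZ k) = q k) (hn : ∀ k, q (-k) = q k)
    {N : Ell2 →L[ℝ] Ell2 →L[ℝ] Ell2} (hN : ∀ x y m, N x y m = ∑' l, convTerm q x y m l)
    {X V : Ell2} (hX : Admissible X) (hV : ∀ k, V k = q k • X k) : inner ℝ (N X X) V = 0 := by
  have hq0 : ∀ k, 0 < q k := fun k => zero_lt_one.trans_le (hq k)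
  set u : Freq → C2 := fun k => (q k)⁻¹ • X k with hu
  have hadm : Admissible u :=
    Admissible.smul (q := fun k => (q k)⁻¹) hX (fun k => by rw [hr]) (fun k => by rw [hn])
  set S : Freq × Freq → ℝ := fun p => inner ℝ (convTerm q X X p.1 p.2) (V p.1) with hS
  have hSu : ∀ m l, S (m, l) = inner ℝ (flux (m - l) m (u (m - l)) • u l) (u m) := by
    intro m l
    have e : V m = (q m ^ 2) • u m := by
      rw [hV, hu]
      simp only
      rw [smul_smul, sq, mul_assoc, mul_inv_cancel₀ (hq0 m).ne', mul_one]
    simp only [hS]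
    rw [e, real_inner_smul_right, ← real_inner_smul_left, convTerm,
      smul_inv_smul₀ (pow_ne_zero 2 (hq0 m).ne')]
  have hanti : ∀ p, S p.swap = -S p := by
    rintro ⟨m, l⟩
    rw [Prod.swap_prod_mk, hSu, hSu]
    have e1 : l - m = -(m - l) := by abel
    have e2 : flux (l - m) l (u (l - m)) = -(starRingEnd ℂ) (flux (m - l) m (u (m - l))) := by
      rw [← flux_conj (hadm.2.2 (m - l)), ← e1]
      have := flux_sub (l - m) m l (u (l - m))
      rw [flux_self (hadm.1 _)] at this
      exact sub_eq_zero.1 this.symm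
    rw [e2, neg_smul, inner_neg_left, real_inner_smul_C2, Complex.conj_conj, real_inner_comm]
  have hsum : Summable S := by
    obtain ⟨C, hC⟩ := exists_tsum_convTerm_le hq0 h
    refine Summable.of_enorm fun htop => ?_
    have h1 : (∑' p, ‖S p‖ₑ) ^ 2 ≤ ENNReal.ofReal ((C * ‖X‖ * ‖X‖) ^ 2) * ENNReal.ofReal (‖V‖ ^ 2) := by
      calc (∑' p, ‖S p‖ₑ) ^ 2 ≤ (∑' m, (∑' l, ‖convTerm q X X m l‖ₑ) * ‖V m‖ₑ) ^ 2 := by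
            rw [ENNReal.tsum_prod']
            gcongr with m
            rw [← ENNReal.tsum_mul_right]
            gcongr with l
            simp only [hS, ← ofReal_norm]
            rw [← ENNReal.ofReal_mul (norm_nonneg _)]
            exact ENNReal.ofReal_le_ofReal (norm_inner_le_norm _ _)
        _ ≤ _ := (ennreal_tsum_mul_sq_le _ _).trans (by
            rw [tsum_enorm_sq]
            gcongr
            exact hC X X)
    rw [htop, ← ENNReal.ofReal_mul (by positivity)] at h1
    simp at h1
  have h0 : ∑' p, S p = 0 := by
    have h1 : ∑' p, S p = -∑' p, S p := by
      rw [← tsum_neg]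
      exact ((Equiv.prodComm Freq Freq).tsum_eq S).symm.trans (tsum_congr hanti)
    linarith
  rw [lp.inner_eq_tsum, ← h0, hsum.tsum_prod]
  refine tsum_congr fun m => ?_
  rw [hN]
  exact ((innerSL ℝ).flip (V m)).map_tsum (summable_convTerm hq0 h X X m)

/-- The nonlinear operator `b^{-1/2} F(b^{-1/4} x, b^{-1/4} x)`, extended to all of `ℓ²` by means of
the projection on the admissible sequences. -/
theorem exists_nonlinear_operator (hq : ∀ k, 1 ≤ q k) (h : ControlsConvection q)
    (hr : ∀ k, q (reflZ k) = q k) (hn : ∀ k, q (-k) = q k) :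
    ∃ N : Ell2 →L[ℝ] Ell2 →L[ℝ] Ell2,
      (∀ X V : Ell2, (∀ k, V k = q k • X k) → inner ℝ (N X X) V = 0) ∧
      (∀ X Y, Admissible (N X Y)) ∧
      ∀ X : Ell2, Admissible X → ∀ m, N X X m = (q m ^ 2)⁻¹ •
        hydroProj (transport (fun k => (q k)⁻¹ • X k) (fun k => (q k)⁻¹ • X k)) m := by
  have hq0 : ∀ k, 0 < q k := fun k => zero_lt_one.trans_le (hq k)
  obtain ⟨N, hN⟩ := exists_transport hq0 h
  set R := admSubmodule.starProjection with hR
  refine ⟨(ContinuousLinearMap.compL ℝ _ _ _ R) ∘L (N.bilinearComp R R), ?_, ?_, ?_⟩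
  · intro X V hV
    have h1 : inner ℝ (R (N (R X) (R X))) V = inner ℝ (N (R X) (R X)) (R V) :=
      Submodule.inner_starProjection_left_eq_right _ _ _
    exact h1.trans (inner_transport_self hq h hr hn hN (Submodule.starProjection_apply_mem admSubmodule X)
      fun k => starProjection_multiplier hq hr hn hV k)
  · intro X Y
    exact Submodule.starProjection_apply_mem admSubmodule _
  · intro X hX m
    have hRX : R X = X := Submodule.starProjection_eq_self_iff.2 hX
    change R (N (R X) (R X)) m = _
    rw [hRX]
    set u : Freq → C2 := fun k => (q k)⁻¹ • X k with hu
    have hadm : Admissible u :=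
      Admissible.smul (q := fun k => (q k)⁻¹) hX (fun k => by rw [hr]) (fun k => by rw [hn])
    have hNm : ∀ m, N X X m = (q m ^ 2)⁻¹ • transport u u m := fun m => by
      rw [hN, tsum_convTerm]
    have hs : ∀ m, Summable fun l => flux (m - l) m (u (m - l)) • u l := by
      intro m
      have h1 := (summable_convTerm hq0 h X X m).const_smul (q m ^ 2)
      refine h1.congr fun l => ?_
      rw [convTerm, smul_inv_smul₀ (pow_ne_zero 2 (hq0 m).ne')]
    rw [starProjection_eq_hydroProj]
    · have hlin : ∀ (r : ℝ) (c d : Freq → C2), c m = r • d m → hydroProj c m = r • hydroProj d m := by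
        intro r c d hcd
        unfold hydroProj
        split_ifs
        · rw [hcd, smul_sub]
          congr 1
          ext i
          simp [Fin.sum_univ_two]
          ring
        · exact hcd
      exact hlin _ _ _ (hNm m)
    · intro k
      rw [hNm, hNm, hr, transport_reflZ hadm hadm]
    · intro k i
      rw [hNm, hNm, hn, PiLp.smul_apply, transport_neg hadm hadm (hs k)]
      simp

end Cancellation

/-! ### Fourier series on the periodic box -/

section Torus

/-- The normalised Haar measure of `ℝ / ℤ`, for which the Fourier monomials are orthonormal. -/
noncomputable local instance : MeasureSpace UnitAddCircle := ⟨AddCircle.haarAddCircle⟩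

local instance : Measure.IsAddHaarMeasure (volume : Measure UnitAddCircle) :=
  inferInstanceAs (Measure.IsAddHaarMeasure AddCircle.haarAddCircle)

local instance : IsProbabilityMeasure (volume : Measure UnitAddCircle) :=
  inferInstanceAs (IsProbabilityMeasure AddCircle.haarAddCircle)

theorem period_pos (j : Fin 3) : 0 < period j := by
  fin_cases j <;> simp [period]

/-- The left end points of the sides of the box, in units of the periods. -/
noncomputable def boxStart : Fin 3 → ℝ := ![0, 0, -1 / 2]

theorem Omega_eq_pi : Omega = Set.pi univ fun j =>
    Ioo (period j * boxStart j) (period j * (boxStart j + 1)) := by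
  ext p
  simp [Omega, Set.mem_pi, Fin.forall_fin_succ, period, boxStart]
  norm_num

theorem measurableSet_Omega : MeasurableSet Omega := by
  rw [Omega_eq_pi]
  exact MeasurableSet.univ_pi fun j => measurableSet_Ioo

/-- The quotient map from the periodic box to the torus. -/
noncomputable def toTorus (p : Pt) : UnitAddTorus (Fin 3) := fun j =>
  (((period j)⁻¹ * p j : ℝ) : UnitAddCircle)

/-- The fundamental domain as a section of the quotient map. -/
noncomputable def ofTorus (x : UnitAddTorus (Fin 3)) : Pt := fun j =>
  period j * (AddCircle.equivIoc 1 (boxStart j) (x j)).1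

theorem toTorus_ofTorus (x : UnitAddTorus (Fin 3)) : toTorus (ofTorus x) = x := by
  funext j
  unfold toTorus ofTorus
  rw [inv_mul_cancel_left₀ (period_pos j).ne']
  exact (AddCircle.equivIoc 1 (boxStart j)).symm_apply_apply (x j)

theorem ofTorus_toTorus {p : Pt} (hp : p ∈ Omega) : ofTorus (toTorus p) = p := by
  rw [Omega_eq_pi] at hp
  funext j
  have h1 := hp j (mem_univ j)
  have hP := period_pos j
  have h2 : (period j)⁻¹ * p j ∈ Ioc (boxStart j) (boxStart j + 1) := by
    constructor
    · rw [lt_inv_mul_iff₀ hP]; exact h1.1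
    · rw [inv_mul_le_iff₀ hP]; exact h1.2.le
  unfold ofTorus toTorus
  rw [AddCircle.equivIoc_coe_of_mem h2, mul_inv_cancel_left₀ hP.ne']

theorem measurable_toTorus : Measurable toTorus :=
  measurable_pi_lambda _ fun j =>
    AddCircle.measurable_mk'.comp ((measurable_pi_apply j).const_mul _)

theorem measurable_ofTorus : Measurable ofTorus :=
  measurable_pi_lambda _ fun j =>
    ((measurable_subtype_coe.comp (AddCircle.measurableEquivIoc 1 (boxStart j)).measurable).comp
      (measurable_pi_apply j)).const_mul _

theorem measurePreserving_coord (j : Fin 3) :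
    MeasurePreserving (fun x : ℝ => (((period j)⁻¹ * x : ℝ) : UnitAddCircle))
      (ENNReal.ofReal (period j)⁻¹ • volume.restrict
        (Ioo (period j * boxStart j) (period j * (boxStart j + 1)))) volume := by
  have hP := period_pos j
  have h1 : MeasurePreserving (fun x : ℝ => (period j)⁻¹ * x)
      (ENNReal.ofReal (period j)⁻¹ • volume) volume := by
    refine ⟨by fun_prop, ?_⟩
    rw [Measure.map_smul, Real.map_volume_mul_left (inv_ne_zero hP.ne'), inv_inv, abs_of_pos hP,
      smul_smul, ← ENNReal.ofReal_mul (by positivity), inv_mul_cancel₀ hP.ne', ENNReal.ofReal_one,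
      one_smul]
  have h2 := h1.restrict_preimage (s := Ioo (boxStart j) (boxStart j + 1)) measurableSet_Ioo
  have h3 : (fun x : ℝ => (period j)⁻¹ * x) ⁻¹' Ioo (boxStart j) (boxStart j + 1) =
      Ioo (period j * boxStart j) (period j * (boxStart j + 1)) := by
    ext x
    simp only [mem_preimage, mem_Ioo, lt_inv_mul_iff₀ hP, inv_mul_lt_iff₀ hP]
  rw [h3, Measure.restrict_smul, restrict_Ioo_eq_restrict_Ioc (a := boxStart j)] at h2
  have h4 := AddCircle.measurePreserving_mk 1 (boxStart j)
  have h5 : @volume _ (AddCircle.measureSpace 1) = AddCircle.haarAddCircle := by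
    simp [AddCircle.volume_eq_smul_haarAddCircle]
  rw [h5] at h4
  exact h4.comp h2

instance (j : Fin 3) : IsFiniteMeasure (ENNReal.ofReal (period j)⁻¹ • volume.restrict
    (Ioo (period j * boxStart j) (period j * (boxStart j + 1)))) :=
  Measure.smul_finite _ ENNReal.ofReal_ne_top

theorem half_smul_restrict_Omega : ENNReal.ofReal (1 / 2) • (volume : Measure Pt).restrict Omega =
    Measure.pi fun j => ENNReal.ofReal (period j)⁻¹ • volume.restrict
        (Ioo (period j * boxStart j) (period j * (boxStart j + 1))) := by
  symm
  refine Measure.pi_eq fun s hs => ?_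
  rw [Measure.smul_apply, Omega_eq_pi, volume_pi, Measure.restrict_pi_pi, Measure.pi_pi]
  simp only [Measure.smul_apply, smul_eq_mul]
  rw [Finset.prod_mul_distrib]
  congr 1
  simp [Fin.prod_univ_three, period]

theorem measurePreserving_toTorus : MeasurePreserving toTorus
    (ENNReal.ofReal (1 / 2) • (volume : Measure Pt).restrict Omega) volume := by
  rw [half_smul_restrict_Omega]
  exact measurePreserving_pi _ _ measurePreserving_coord

theorem measurePreserving_ofTorus : MeasurePreserving ofTorus volume
    (ENNReal.ofReal (1 / 2) • (volume : Measure Pt).restrict Omega) := by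
  refine ⟨measurable_ofTorus, ?_⟩
  rw [← measurePreserving_toTorus.map_eq, Measure.map_map measurable_ofTorus measurable_toTorus]
  refine (Measure.map_congr (g := id) ?_).trans Measure.map_id
  refine (Measure.smul_absolutelyContinuous (c := ENNReal.ofReal (1 / 2))).ae_le ?_
  filter_upwards [ae_restrict_mem measurableSet_Omega] with p hp
  exact ofTorus_toTorus hp

/-- The function `exp (i ξ(k)·p)`. -/
noncomputable def waveExp (k : Freq) (p : Pt) : ℂ :=
  Complex.exp (Complex.I * ((∑ j : Fin 3, wave k j * p j : ℝ) : ℂ))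

theorem mFourier_toTorus (k : Freq) (p : Pt) : UnitAddTorus.mFourier k (toTorus p) = waveExp k p := by
  simp only [UnitAddTorus.mFourier, ContinuousMap.coe_mk, toTorus, waveExp, fourier_coe_apply]
  rw [← Complex.exp_sum]
  congr 1
  push_cast
  rw [Finset.mul_sum]
  refine Finset.sum_congr rfl fun j _ => ?_
  rw [wave]
  push_cast
  rw [div_one]
  field_simp

/-- The Fourier coefficients of a complex-valued function on `Ω`. -/
noncomputable def scalarCoeff (F : Pt → ℂ) (k : Freq) : ℂ :=
  (1 / 2 : ℂ) * ∫ p in Omega,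
    Complex.exp (-Complex.I * ((∑ j : Fin 3, wave k j * p j : ℝ) : ℂ)) * F p

theorem fourierCoeff_apply (u : Pt → V2) (k : Freq) (i : Fin 2) :
    fourierCoeff u k i = scalarCoeff (fun p => ((u p i : ℝ) : ℂ)) k := rfl

theorem waveExp_neg (k : Freq) (p : Pt) : waveExp (-k) p =
    Complex.exp (-Complex.I * ((∑ j : Fin 3, wave k j * p j : ℝ) : ℂ)) := by
  rw [waveExp]
  congr 1
  simp only [wave_neg, neg_mul, Finset.sum_neg_distrib]
  push_cast
  ring

theorem scalarCoeff_eq (F : Pt → ℂ) (k : Freq) :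
    scalarCoeff F k = (1 / 2 : ℂ) * ∫ p in Omega, waveExp (-k) p * F p := by
  simp only [scalarCoeff, waveExp_neg]

theorem integral_half_Omega (F : Pt → ℂ) :
    ∫ p, F p ∂(ENNReal.ofReal (1 / 2) • (volume : Measure Pt).restrict Omega) =
      (1 / 2 : ℂ) * ∫ p in Omega, F p := by
  rw [integral_smul_measure, ENNReal.toReal_ofReal (by norm_num), ← Complex.coe_smul, smul_eq_mul]
  push_cast
  rfl

theorem mFourierCoeff_comp_ofTorus {F : Pt → ℂ}
    (hF : AEStronglyMeasurable F (volume.restrict Omega)) (k : Freq) :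
    UnitAddTorus.mFourierCoeff (F ∘ ofTorus) k = scalarCoeff F k := by
  have h1 : ∀ x, UnitAddTorus.mFourier (-k) x • (F ∘ ofTorus) x =
      (fun p => waveExp (-k) p * F p) (ofTorus x) := by
    intro x
    simp only [← mFourier_toTorus, toTorus_ofTorus, Function.comp_apply, smul_eq_mul]
  rw [UnitAddTorus.mFourierCoeff, scalarCoeff_eq, ← integral_half_Omega,
    ← measurePreserving_ofTorus.map_eq, integral_map measurable_ofTorus.aemeasurable]
  · exact integral_congr_ae (.of_forall h1)
  · rw [measurePreserving_ofTorus.map_eq]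
    refine AEStronglyMeasurable.smul_measure ?_ _
    refine AEStronglyMeasurable.mul ?_ hF
    unfold waveExp
    exact Continuous.aestronglyMeasurable (by fun_prop)

/-- Parseval's identity on `Ω`. -/
theorem hasSum_scalarCoeff {F G : Pt → ℂ} (hF : MemLp F 2 (volume.restrict Omega))
    (hG : MemLp G 2 (volume.restrict Omega)) :
    HasSum (fun k => (starRingEnd ℂ) (scalarCoeff F k) * scalarCoeff G k)
      ((1 / 2 : ℂ) * ∫ p in Omega, (starRingEnd ℂ) (F p) * G p) := by
  have hF' := (hF.smul_measure (c := ENNReal.ofReal (1 / 2)) ENNReal.ofReal_ne_top).comp_measurePreserving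
    measurePreserving_ofTorus
  have hG' := (hG.smul_measure (c := ENNReal.ofReal (1 / 2)) ENNReal.ofReal_ne_top).comp_measurePreserving
    measurePreserving_ofTorus
  have h := UnitAddTorus.hasSum_prod_mFourierCoeff hF'.toLp hG'.toLp
  have hc : ∀ {H : Pt → ℂ} (hH : MemLp H 2 (volume.restrict Omega))
      (hH' : MemLp (H ∘ ofTorus) 2 (volume : Measure (UnitAddTorus (Fin 3)))) (k : Freq),
      UnitAddTorus.mFourierCoeff hH'.toLp k = scalarCoeff H k := by
    intro H hH hH' k
    rw [← mFourierCoeff_comp_ofTorus hH.1]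
    refine integral_congr_ae ?_
    filter_upwards [hH'.coeFn_toLp] with x hx
    rw [hx]
  simp only [hc hF hF', hc hG hG'] at h
  have e : ∫ x, (starRingEnd ℂ) (hF'.toLp _ x) * hG'.toLp _ x =
      (1 / 2 : ℂ) * ∫ p in Omega, (starRingEnd ℂ) (F p) * G p := by
    rw [← integral_half_Omega, ← measurePreserving_ofTorus.map_eq,
      integral_map measurable_ofTorus.aemeasurable]
    · refine integral_congr_ae ?_
      filter_upwards [hF'.coeFn_toLp, hG'.coeFn_toLp] with x h1 h2
      rw [h1, h2]
      rfl
    · rw [measurePreserving_ofTorus.map_eq]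
      exact ((Complex.continuous_conj.comp_aestronglyMeasurable hF.1).mul hG.1).smul_measure _
  rwa [e] at h

/-- The Riesz–Fischer theorem on `Ω`. -/
theorem exists_scalarCoeff_eq {c : Freq → ℂ} (hc : Memℓp c 2) :
    ∃ F : Pt → ℂ, MemLp F 2 (volume.restrict Omega) ∧ ∀ k, scalarCoeff F k = c k := by
  set g := (UnitAddTorus.mFourierBasis (d := Fin 3)).repr.symm ⟨c, hc⟩ with hg
  have h1 : MemLp (g ∘ toTorus) 2 (ENNReal.ofReal (1 / 2) • (volume : Measure Pt).restrict Omega) :=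
    (Lp.memLp g).comp_measurePreserving measurePreserving_toTorus
  have h2 : MemLp (g ∘ toTorus) 2 ((volume : Measure Pt).restrict Omega) := by
    have := h1.smul_measure (c := ENNReal.ofReal 2) ENNReal.ofReal_ne_top
    rwa [smul_smul, ← ENNReal.ofReal_mul (by norm_num), show (2 : ℝ) * (1 / 2) = 1 by norm_num,
      ENNReal.ofReal_one, one_smul] at this
  refine ⟨g ∘ toTorus, h2, fun k => ?_⟩
  rw [← mFourierCoeff_comp_ofTorus h2.1]
  have h3 : (g ∘ toTorus) ∘ ofTorus = g := by
    funext x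
    simp [toTorus_ofTorus]
  rw [h3, ← UnitAddTorus.mFourierBasis_repr, hg, LinearIsometryEquiv.apply_symm_apply]

end Torus

/-! ### Products and square integrable fields -/

section ScalarCoeff

instance : IsFiniteMeasure ((volume : Measure Pt).restrict Omega) := by
  refine ⟨?_⟩
  rw [Measure.restrict_apply_univ, Omega_eq_pi, Real.volume_pi_Ioo]
  exact ENNReal.prod_lt_top fun i _ => ENNReal.ofReal_lt_top

theorem continuous_waveExp (k : Freq) : Continuous (waveExp k) := by
  unfold waveExp; fun_prop

theorem waveExp_add (k l : Freq) (p : Pt) : waveExp (k + l) p = waveExp k p * waveExp l p := by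
  have h : ∑ j, wave (k + l) j * p j = ∑ j, wave k j * p j + ∑ j, wave l j * p j := by
    simp [wave, Fin.sum_univ_three]; ring
  rw [waveExp, waveExp, waveExp, ← Complex.exp_add, ← mul_add, ← Complex.ofReal_add, h]

theorem conj_waveExp (k : Freq) (p : Pt) : (starRingEnd ℂ) (waveExp k p) = waveExp (-k) p := by
  rw [waveExp_neg, waveExp, ← Complex.exp_conj, map_mul, Complex.conj_I, Complex.conj_ofReal]

theorem norm_waveExp (k : Freq) (p : Pt) : ‖waveExp k p‖ = 1 := by
  rw [waveExp, mul_comm]; exact Complex.norm_exp_ofReal_mul_I _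

theorem integrable_waveExp_mul {F : Pt → ℂ} (hF : Integrable F (volume.restrict Omega)) (k : Freq) :
    Integrable (fun p => waveExp k p * F p) (volume.restrict Omega) :=
  hF.bdd_mul (c := 1) (continuous_waveExp k).aestronglyMeasurable
    (.of_forall fun p => (norm_waveExp k p).le)

theorem memLp_waveExp_mul {F : Pt → ℂ} (hF : MemLp F 2 (volume.restrict Omega)) (k : Freq) :
    MemLp (fun p => waveExp k p * F p) 2 (volume.restrict Omega) := by
  refine hF.of_le ((continuous_waveExp k).aestronglyMeasurable.mul hF.1) (.of_forall fun p => ?_)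
  rw [norm_mul, norm_waveExp, one_mul]

theorem scalarCoeff_add {F G : Pt → ℂ} (hF : Integrable F (volume.restrict Omega))
    (hG : Integrable G (volume.restrict Omega)) (k : Freq) :
    scalarCoeff (fun p => F p + G p) k = scalarCoeff F k + scalarCoeff G k := by
  simp only [scalarCoeff_eq, mul_add]
  rw [integral_add (integrable_waveExp_mul hF _) (integrable_waveExp_mul hG _), mul_add]

theorem scalarCoeff_const_mul (r : ℂ) (F : Pt → ℂ) (k : Freq) :
    scalarCoeff (fun p => r * F p) k = r * scalarCoeff F k := by
  have h : ∀ p, waveExp (-k) p * (r * F p) = r * (waveExp (-k) p * F p) := fun p => by ring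
  simp only [scalarCoeff_eq, h]
  rw [integral_const_mul]
  ring

theorem scalarCoeff_congr {F G : Pt → ℂ} (h : F =ᵐ[volume.restrict Omega] G) :
    scalarCoeff F = scalarCoeff G := by
  funext k
  rw [scalarCoeff, scalarCoeff]
  congr 1
  refine integral_congr_ae ?_
  filter_upwards [h] with p hp
  rw [hp]

theorem scalarCoeff_conj (F : Pt → ℂ) (k : Freq) :
    scalarCoeff (fun p => (starRingEnd ℂ) (F p)) k = (starRingEnd ℂ) (scalarCoeff F (-k)) := by
  simp only [scalarCoeff_eq, map_mul, ← integral_conj, conj_waveExp, neg_neg]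
  rw [map_div₀, map_one, Complex.conj_ofNat]

theorem hasSum_norm_scalarCoeff_sq {F : Pt → ℂ} (hF : MemLp F 2 (volume.restrict Omega)) :
    HasSum (fun k => ‖scalarCoeff F k‖ ^ 2) (1 / 2 * ∫ p in Omega, ‖F p‖ ^ 2) := by
  have h := Complex.hasSum_re (hasSum_scalarCoeff hF hF)
  have e : ∀ z : ℂ, (starRingEnd ℂ) z * z = ((‖z‖ ^ 2 : ℝ) : ℂ) := fun z => by
    rw [Complex.conj_mul']; push_cast; rfl
  simp only [e, Complex.ofReal_re] at h
  rw [integral_complex_ofReal] at h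
  convert h using 1
  rw [show (1 / 2 : ℂ) = ((1 / 2 : ℝ) : ℂ) by push_cast; rfl, ← Complex.ofReal_mul, Complex.ofReal_re]

theorem ae_eq_zero_of_scalarCoeff {F : Pt → ℂ} (hF : MemLp F 2 (volume.restrict Omega))
    (h : ∀ k, scalarCoeff F k = 0) : F =ᵐ[volume.restrict Omega] 0 := by
  have h1 := hasSum_norm_scalarCoeff_sq hF
  simp only [h, norm_zero, ne_eq, OfNat.ofNat_ne_zero, not_false_eq_true, zero_pow] at h1
  have h2 : ∫ p in Omega, ‖F p‖ ^ 2 = 0 := by linarith [h1.unique hasSum_zero]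
  have h3 := (integral_eq_zero_iff_of_nonneg (fun p => by positivity)
    (hF.integrable_norm_pow (by norm_num))).1 h2
  filter_upwards [h3] with p hp
  simpa using hp

/-- The Fourier coefficients of a product are the convolution of the Fourier coefficients. -/
theorem hasSum_scalarCoeff_mul {F G : Pt → ℂ} (hF : MemLp F 2 (volume.restrict Omega))
    (hG : MemLp G 2 (volume.restrict Omega)) (m : Freq) :
    HasSum (fun l => scalarCoeff F (m - l) * scalarCoeff G l) (scalarCoeff (fun p => F p * G p) m) := by
  have hF' : MemLp (fun p => waveExp m p * (starRingEnd ℂ) (F p)) 2 (volume.restrict Omega) :=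
    memLp_waveExp_mul (hF.star) m
  have h := hasSum_scalarCoeff hF' hG
  have e1 : ∀ l, (starRingEnd ℂ) (scalarCoeff (fun p => waveExp m p * (starRingEnd ℂ) (F p)) l) =
      scalarCoeff F (m - l) := by
    intro l
    rw [← neg_neg l, ← scalarCoeff_conj, scalarCoeff_eq, scalarCoeff_eq, neg_neg]
    congr 2
    funext p
    rw [map_mul, Complex.conj_conj, conj_waveExp, ← mul_assoc, ← waveExp_add]
    congr 2
    abel
  have e2 : (1 / 2 : ℂ) * ∫ p in Omega, (starRingEnd ℂ) (waveExp m p * (starRingEnd ℂ) (F p)) * G p =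
      scalarCoeff (fun p => F p * G p) m := by
    rw [scalarCoeff_eq]
    congr 2
    funext p
    rw [map_mul, Complex.conj_conj, conj_waveExp, mul_assoc]
  simp only [e1] at h
  rwa [e2] at h

end ScalarCoeff

section Coeff

theorem memLp_component (u : L2) (i : Fin 2) :
    MemLp (fun p => (((u : Pt → V2) p i : ℝ) : ℂ)) 2 (volume.restrict Omega) := by
  have h := Lp.memLp u
  refine h.of_le ?_ (.of_forall fun p => ?_)
  · exact Complex.continuous_ofReal.comp_aestronglyMeasurable
      ((EuclideanSpace.proj (𝕜 := ℝ) i).continuous.comp_aestronglyMeasurable h.1)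
  · rw [Complex.norm_real]
    exact PiLp.norm_apply_le _ i

theorem coeff_apply (u : L2) (k : Freq) (i : Fin 2) :
    coeff u k i = scalarCoeff (fun p => (((u : Pt → V2) p i : ℝ) : ℂ)) k := rfl

theorem coeff_neg_freq (u : L2) (k : Freq) (i : Fin 2) :
    coeff u (-k) i = (starRingEnd ℂ) (coeff u k i) := by
  have h := scalarCoeff_conj (fun p => (((u : Pt → V2) p i : ℝ) : ℂ)) (-k)
  simp only [Complex.conj_ofReal, neg_neg] at h
  exact h

theorem coeff_sub (u v : L2) : coeff (u - v) = coeff u - coeff v := by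
  funext k
  ext i
  have h1 : (fun p => (((u - v : L2) p i : ℝ) : ℂ)) =ᵐ[volume.restrict Omega]
      fun p => ((u p i : ℝ) : ℂ) + (-1) * ((v p i : ℝ) : ℂ) := by
    filter_upwards [Lp.coeFn_sub u v] with p hp
    rw [hp]
    simp [sub_eq_add_neg]
  rw [coeff_apply, scalarCoeff_congr h1, scalarCoeff_add ((memLp_component u i).integrable (by norm_num))
    (((memLp_component v i).integrable (by norm_num)).const_mul (-1)), scalarCoeff_const_mul,
    Pi.sub_apply, PiLp.sub_apply, coeff_apply, coeff_apply]
  ring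

/-- Parseval's identity for vector fields. -/
theorem hasSum_norm_coeff_sq (u : L2) : HasSum (fun k => ‖coeff u k‖ ^ 2) (1 / 2 * ‖u‖ ^ 2) := by
  have h := hasSum_sum (f := fun (i : Fin 2) (k : Freq) => ‖coeff u k i‖ ^ 2)
    (s := Finset.univ) fun i _ => hasSum_norm_scalarCoeff_sq (memLp_component u i)
  have e : ∑ i : Fin 2, 1 / 2 * ∫ p in Omega, ‖(((u : Pt → V2) p i : ℝ) : ℂ)‖ ^ 2 =
      1 / 2 * ‖u‖ ^ 2 := by
    rw [← Finset.mul_sum, ← integral_finsetSum _ fun i _ =>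
      (memLp_component u i).integrable_norm_pow (by norm_num)]
    congr 1
    have h2 := MemLp.norm_pow_eq_integral (n := 2) (by norm_num) (Lp.memLp u)
    rw [Lp.norm_def]
    refine Eq.trans ?_ h2.symm
    refine integral_congr_ae (.of_forall fun p => ?_)
    simp [EuclideanSpace.norm_sq_eq]
  rw [e] at h
  refine h.congr_fun fun k => ?_
  exact EuclideanSpace.norm_sq_eq _

theorem memlp_coeff (u : L2) : Memℓp (coeff u) 2 := memlp_two_iff.2 (hasSum_norm_coeff_sq u).summable

theorem coeff_injective {u v : L2} (h : coeff u = coeff v) : u = v := by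
  have h1 := hasSum_norm_coeff_sq (u - v)
  rw [coeff_sub, h, sub_self] at h1
  simp only [Pi.zero_apply, norm_zero, ne_eq, OfNat.ofNat_ne_zero, not_false_eq_true, zero_pow] at h1
  have h2 : ‖u - v‖ ^ 2 = 0 := by linarith [h1.unique hasSum_zero]
  exact sub_eq_zero.1 (norm_eq_zero.1 (pow_eq_zero_iff (by norm_num) |>.1 h2))

/-- The Riesz–Fischer theorem for real vector fields. -/
theorem exists_coeff_eq {c : Freq → C2} (hc : Memℓp c 2)
    (hr : ∀ (k : Freq) (i : Fin 2), c (-k) i = (starRingEnd ℂ) (c k i)) : ∃ u : L2, coeff u = c := by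
  have hci : ∀ i, Memℓp (fun k => c k i) 2 := by
    intro i
    rw [memlp_two_iff] at hc ⊢
    refine hc.of_nonneg_of_le (fun k => by positivity) fun k => ?_
    gcongr
    exact PiLp.norm_apply_le _ i
  choose F hF hFc using fun i => exists_scalarCoeff_eq (hci i)
  have hre : ∀ i, MemLp (fun p => (F i p).re) 2 (volume.restrict Omega) := fun i => (hF i).re
  have hu : MemLp (fun p => (WithLp.toLp 2 fun i => (F i p).re : V2)) 2 (volume.restrict Omega) := by
    have h1 : AEStronglyMeasurable (fun p => (WithLp.toLp 2 fun i => (F i p).re : V2))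
        (volume.restrict Omega) := by
      refine AEMeasurable.aestronglyMeasurable ?_
      exact (WithLp.measurable_toLp 2 _).comp_aemeasurable
        (aemeasurable_pi_lambda _ fun i => (hre i).1.aemeasurable)
    rw [memLp_two_iff_integrable_sq_norm h1]
    simp only [EuclideanSpace.norm_sq_eq]
    exact integrable_finsetSum _ fun i _ => (hre i).integrable_norm_pow (by norm_num)
  refine ⟨hu.toLp, ?_⟩
  funext k
  ext i
  have h1 : (fun p => (((hu.toLp _ : L2) p i : ℝ) : ℂ)) =ᵐ[volume.restrict Omega]
      fun p => (1 / 2 : ℂ) * (F i p + (starRingEnd ℂ) (F i p)) := by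
    filter_upwards [hu.coeFn_toLp] with p hp
    rw [hp, Complex.add_conj]
    push_cast
    ring
  have hi := (hF i).integrable (by norm_num)
  have hi' : Integrable (fun p => (starRingEnd ℂ) (F i p)) (volume.restrict Omega) :=
    (hF i).star.integrable (by norm_num)
  rw [coeff_apply, scalarCoeff_congr h1, scalarCoeff_const_mul, scalarCoeff_add hi hi',
    scalarCoeff_conj, hFc, hFc, hr, Complex.conj_conj]
  ring

end Coeff

/-! ### Weak derivatives -/

section Derivatives

/-- Up to null sets, `Ω` is a compact box. -/
theorem restrict_Omega_eq : (volume : Measure Pt).restrict Omega = volume.restrict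
    (Icc (fun j => period j * boxStart j) fun j => period j * (boxStart j + 1)) := by
  rw [Omega_eq_pi]
  exact Measure.restrict_congr_set Measure.univ_pi_Ioo_ae_eq_Icc

theorem integrable_of_continuous {E : Type*} [NormedAddCommGroup E] {ψ : Pt → E}
    (h : Continuous ψ) : Integrable ψ (volume.restrict Omega) := by
  rw [restrict_Omega_eq]
  exact h.continuousOn.integrableOn_compact isCompact_Icc

theorem memLp_of_continuous {E : Type*} [NormedAddCommGroup E] {ψ : Pt → E}
    (h : Continuous ψ) : MemLp ψ 2 (volume.restrict Omega) := by
  have h1 : AEStronglyMeasurable ψ (volume.restrict Omega) := (integrable_of_continuous h).1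
  rw [memLp_two_iff_integrable_sq_norm h1]
  exact integrable_of_continuous (h.norm.pow 2)

theorem continuous_partialDeriv {E : Type*} [NormedAddCommGroup E] [NormedSpace ℝ E] {ψ : Pt → E}
    (h : ContDiff ℝ ∞ ψ) (j : Fin 3) : Continuous (partialDeriv j ψ) :=
  (h.continuous_fderiv (by simp)).clm_apply continuous_const

/-- A derivative of a periodic function has mean value zero. -/
theorem integral_partialDeriv_eq_zero {E : Type*} [NormedAddCommGroup E] [NormedSpace ℝ E]
    [CompleteSpace E] {ψ : Pt → E} (h : SmoothPeriodic ψ) (j : Fin 3) :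
    ∫ p in Omega, partialDeriv j ψ p = 0 := by
  have hd : Differentiable ℝ ψ := h.1.differentiable (by simp)
  have hsum : ∀ x, ∑ i : Fin 3, (if i = j then fderiv ℝ ψ x else 0) (Pi.single i 1) =
      partialDeriv j ψ x := by
    intro x
    rw [Finset.sum_eq_single j (fun i _ hi => by simp [hi]) (by simp)]
    simp [partialDeriv]
  have hc := (integrable_of_continuous (continuous_partialDeriv h.1 j))
  rw [restrict_Omega_eq] at hc ⊢
  have key := integral_divergence_of_hasFDerivAt_off_countable' (E := E) (n := 2)
    (fun j => period j * boxStart j) (fun j => period j * (boxStart j + 1))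
    (fun i => by have := period_pos i; nlinarith)
    (fun i => if i = j then ψ else 0) (fun i x => if i = j then fderiv ℝ ψ x else 0) ∅ countable_empty
    (fun i => by
      split_ifs
      · exact h.1.continuous.continuousOn
      · exact continuousOn_const)
    (fun x _ i => by
      by_cases hij : i = j
      · simp only [hij, if_true]; exact (hd x).hasFDerivAt
      · simp only [hij, if_false]; exact hasFDerivAt_const 0 x)
    (by simp only [hsum]; exact hc)
  simp only [hsum] at key
  rw [key]
  refine Finset.sum_eq_zero fun i _ => ?_
  by_cases hij : i = j
  · subst hij
    simp only [if_true]
    rw [sub_eq_zero]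
    refine integral_congr_ae (.of_forall fun x => ?_)
    simp only
    rw [← h.2 i (i.insertNth (period i * boxStart i) x)]
    congr 1
    funext l
    rcases eq_or_ne l i with rfl | hl
    · simp; ring
    · obtain ⟨l, rfl⟩ := Fin.exists_succAbove_eq hl
      simp
  · simp [hij]

theorem waveExp_add_single (k : Freq) (p : Pt) (j : Fin 3) (t : ℝ) :
    waveExp k (p + Pi.single j t) = waveExp k p * Complex.exp (Complex.I * ((wave k j * t : ℝ) : ℂ)) := by
  have h : ∑ i, wave k i * (p + Pi.single j t : Pt) i = ∑ i, wave k i * p i + wave k j * t := by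
    simp only [Pi.add_apply, mul_add, Finset.sum_add_distrib]
    congr 1
    rw [Finset.sum_eq_single j (fun i _ hi => by simp [hi]) (by simp)]
    simp
  rw [waveExp, waveExp, h, ← Complex.exp_add, ← mul_add, ← Complex.ofReal_add]

theorem contDiff_waveExp (k : Freq) : ContDiff ℝ ∞ (waveExp k) := by
  have h : ContDiff ℝ ∞ fun p : Pt => ∑ j : Fin 3, wave k j * p j :=
    ContDiff.sum fun j _ => contDiff_const.mul (contDiff_apply ℝ ℝ j)
  exact ContDiff.cexp (contDiff_const.mul (Complex.ofRealCLM.contDiff.comp h))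

theorem smoothPeriodic_waveExp (k : Freq) : SmoothPeriodic (waveExp k) := by
  refine ⟨contDiff_waveExp k, fun j p => ?_⟩
  rw [waveExp_add_single, wave]
  have : Complex.exp (Complex.I * ((2 * Real.pi / period j * (k j : ℝ) * period j : ℝ) : ℂ)) = 1 := by
    rw [show 2 * Real.pi / period j * (k j : ℝ) * period j = 2 * Real.pi * k j by
      have := (period_pos j).ne'; field_simp]
    rw [Complex.exp_eq_one_iff]
    exact ⟨k j, by push_cast; ring⟩
  rw [this, mul_one]

theorem partialDeriv_eq_deriv {E : Type*} [NormedAddCommGroup E] [NormedSpace ℝ E] {ψ : Pt → E} {p : Pt}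
    (h : DifferentiableAt ℝ ψ p) (j : Fin 3) :
    partialDeriv j ψ p = deriv (fun t : ℝ => ψ (p + t • Pi.single j 1)) 0 :=
  h.lineDeriv_eq_fderiv.symm

theorem partialDeriv_waveExp (k : Freq) (j : Fin 3) (p : Pt) :
    partialDeriv j (waveExp k) p = Complex.I * wave k j * waveExp k p := by
  rw [partialDeriv_eq_deriv ((contDiff_waveExp k).differentiable (by simp) p)]
  have h : (fun t : ℝ => waveExp k (p + t • Pi.single j 1)) =
      fun t : ℝ => waveExp k p * Complex.exp (Complex.I * wave k j * (t : ℂ)) := by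
    funext t
    rw [← Pi.single_smul, smul_eq_mul, mul_one, waveExp_add_single]
    push_cast
    ring_nf
  rw [h]
  have h1 : HasDerivAt (fun t : ℝ => waveExp k p * Complex.exp (Complex.I * wave k j * (t : ℂ)))
      (waveExp k p * (Complex.exp (Complex.I * wave k j * ((0 : ℝ) : ℂ)) *
        (Complex.I * wave k j * 1))) 0 :=
    (((Complex.ofRealCLM.hasDerivAt (x := (0 : ℝ))).const_mul (Complex.I * wave k j)).cexp).const_mul _
  rw [h1.deriv]
  simp
  ring

theorem SmoothPeriodic.ofReal {φ : Pt → ℝ} (h : SmoothPeriodic φ) :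
    SmoothPeriodic fun p => (φ p : ℂ) :=
  ⟨Complex.ofRealCLM.contDiff.comp h.1, fun j p => by simp only [h.2]⟩

theorem partialDeriv_ofReal {φ : Pt → ℝ} (h : SmoothPeriodic φ) (j : Fin 3) (p : Pt) :
    partialDeriv j (fun p => (φ p : ℂ)) p = ((partialDeriv j φ p : ℝ) : ℂ) := by
  have h1 := (Complex.ofRealCLM.hasFDerivAt (x := φ p)).comp p
    ((h.1.differentiable (by simp) p).hasFDerivAt)
  unfold partialDeriv
  have h2 : fderiv ℝ (fun p => (φ p : ℂ)) p = _ := h1.fderiv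
  rw [h2]
  rfl

/-- Differentiation is multiplication by `i ξ_j` on the Fourier side. -/
theorem scalarCoeff_partialDeriv {φ : Pt → ℝ} (h : SmoothPeriodic φ) (j : Fin 3) (k : Freq) :
    scalarCoeff (fun p => ((partialDeriv j φ p : ℝ) : ℂ)) k =
      Complex.I * wave k j * scalarCoeff (fun p => (φ p : ℂ)) k := by
  have hs : SmoothPeriodic fun p => waveExp (-k) p * (φ p : ℂ) :=
    ⟨(contDiff_waveExp _).mul h.ofReal.1, fun j p => by simp only [(smoothPeriodic_waveExp (-k)).2, h.2]⟩
  have h1 : ∀ p, partialDeriv j (fun p => waveExp (-k) p * (φ p : ℂ)) p =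
      waveExp (-k) p * ((partialDeriv j φ p : ℝ) : ℂ) -
        Complex.I * wave k j * (waveExp (-k) p * (φ p : ℂ)) := by
    intro p
    have d1 := ((contDiff_waveExp (-k)).differentiable (by simp) p)
    have d2 := (h.ofReal.1.differentiable (by simp) p)
    rw [partialDeriv, fderiv_fun_mul d1 d2]
    have e1 := partialDeriv_waveExp (-k) j p
    have e2 := partialDeriv_ofReal h j p
    simp only [partialDeriv] at e1 e2 ⊢
    simp only [add_apply, smul_apply, smul_eq_mul, e1, e2, wave_neg]
    push_cast
    ring
  have h2 := integral_partialDeriv_eq_zero hs j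
  simp only [h1] at h2
  have c1 : Continuous fun p => waveExp (-k) p * ((partialDeriv j φ p : ℝ) : ℂ) :=
    (continuous_waveExp _).mul (Complex.continuous_ofReal.comp (continuous_partialDeriv h.1 j))
  have c2 : Continuous fun p => waveExp (-k) p * (φ p : ℂ) := hs.1.continuous
  rw [integral_sub (integrable_of_continuous c1) ((integrable_of_continuous c2).const_mul _),
    integral_const_mul, sub_eq_zero] at h2
  rw [scalarCoeff_eq, scalarCoeff_eq, h2]
  ring

theorem integral_component {F : Pt → V2} (hF : Integrable F (volume.restrict Omega)) (i : Fin 2) :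
    (∫ p in Omega, F p) i = ∫ p in Omega, F p i :=
  ((EuclideanSpace.proj (𝕜 := ℝ) i).integral_comp_comm hF).symm

theorem integrable_smul_field {φ : Pt → ℝ} (h : Continuous φ) (u : L2) :
    Integrable (fun p => φ p • (u : Pt → V2) p) (volume.restrict Omega) :=
  memLp_one_iff_integrable.1 ((Lp.memLp u).smul (r := 1) (memLp_of_continuous h))

theorem isWeakDeriv_iff_component (j : Fin 3) (u g : L2) : IsWeakDeriv j u g ↔
    ∀ φ : Pt → ℝ, SmoothPeriodic φ → ∀ i : Fin 2,
      ∫ p in Omega, ((partialDeriv j φ p : ℝ) : ℂ) * (((u : Pt → V2) p i : ℝ) : ℂ) =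
        -∫ p in Omega, ((φ p : ℝ) : ℂ) * (((g : Pt → V2) p i : ℝ) : ℂ) := by
  refine forall₂_congr fun φ hφ => ?_
  have i1 := integrable_smul_field (continuous_partialDeriv hφ.1 j) u
  have i2 := integrable_smul_field hφ.1.continuous g
  have e : ∀ (φ : Pt → ℝ) (w : L2) (i : Fin 2),
      ∫ p in Omega, ((φ p : ℝ) : ℂ) * (((w : Pt → V2) p i : ℝ) : ℂ) =
      ((∫ p in Omega, (φ p • (w : Pt → V2) p) i : ℝ) : ℂ) := by
    intro φ w i
    rw [← integral_complex_ofReal]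
    refine integral_congr_ae (.of_forall fun p => ?_)
    simp
  simp only [e]
  constructor
  · intro h i
    rw [← integral_component i1, ← integral_component i2, h]
    simp
  · intro h
    ext i
    rw [PiLp.neg_apply, integral_component i1, integral_component i2]
    exact_mod_cast h i

/-- A field has the weak derivative `g` if the Fourier coefficients say so. -/
theorem isWeakDeriv_of_coeff {j : Fin 3} {u g : L2}
    (h : ∀ k, coeff g k = (Complex.I * wave k j : ℂ) • coeff u k) : IsWeakDeriv j u g := by
  rw [isWeakDeriv_iff_component]
  intro φ hφ i
  have c1 : Continuous fun p => ((partialDeriv j φ p : ℝ) : ℂ) :=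
    Complex.continuous_ofReal.comp (continuous_partialDeriv hφ.1 j)
  have c2 : Continuous fun p => ((φ p : ℝ) : ℂ) := Complex.continuous_ofReal.comp hφ.1.continuous
  have s1 := hasSum_scalarCoeff (memLp_of_continuous c1) (memLp_component u i)
  have s2 := (hasSum_scalarCoeff (memLp_of_continuous c2) (memLp_component g i)).neg
  have e : (fun k => (starRingEnd ℂ) (scalarCoeff (fun p => ((partialDeriv j φ p : ℝ) : ℂ)) k) *
      scalarCoeff (fun p => (((u : Pt → V2) p i : ℝ) : ℂ)) k) = fun k =>
      -((starRingEnd ℂ) (scalarCoeff (fun p => ((φ p : ℝ) : ℂ)) k) *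
      scalarCoeff (fun p => (((g : Pt → V2) p i : ℝ) : ℂ)) k) := by
    funext k
    have h1 : scalarCoeff (fun p => (((g : Pt → V2) p i : ℝ) : ℂ)) k =
        Complex.I * wave k j * scalarCoeff (fun p => (((u : Pt → V2) p i : ℝ) : ℂ)) k := by
      have : coeff g k i = Complex.I * wave k j * coeff u k i := by
        rw [h k, PiLp.smul_apply, smul_eq_mul]
      exact this
    rw [scalarCoeff_partialDeriv hφ, h1]
    simp
    ring
  rw [e] at s1
  have := s1.unique s2
  simp only [Complex.conj_ofReal] at this
  linear_combination 2 * this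

/-- The Fourier coefficients of a weak derivative. -/
theorem IsWeakDeriv.coeff_eq {j : Fin 3} {u g : L2} (h : IsWeakDeriv j u g) (k : Freq) :
    coeff g k = (Complex.I * wave k j : ℂ) • coeff u k := by
  rw [isWeakDeriv_iff_component] at h
  ext i
  set U : Pt → ℂ := fun p => (((u : Pt → V2) p i : ℝ) : ℂ) with hU
  set G : Pt → ℂ := fun p => (((g : Pt → V2) p i : ℝ) : ℂ) with hG
  have hUi : Integrable U (volume.restrict Omega) := (memLp_component u i).integrable (by norm_num)
  have hGi : Integrable G (volume.restrict Omega) := (memLp_component g i).integrable (by norm_num)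
  have hper := smoothPeriodic_waveExp (-k)
  have hre : SmoothPeriodic fun p => (waveExp (-k) p).re :=
    ⟨Complex.reCLM.contDiff.comp hper.1, fun j p => by simp only [hper.2]⟩
  have him : SmoothPeriodic fun p => (waveExp (-k) p).im :=
    ⟨Complex.imCLM.contDiff.comp hper.1, fun j p => by simp only [hper.2]⟩
  have d := fun p => ((contDiff_waveExp (-k)).differentiable (by simp) p).hasFDerivAt
  have dre : ∀ p, partialDeriv j (fun p => (waveExp (-k) p).re) p =
      (partialDeriv j (waveExp (-k)) p).re := by
    intro p
    have h2 : fderiv ℝ (fun p => (waveExp (-k) p).re) p = _ :=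
      ((Complex.reCLM.hasFDerivAt (x := waveExp (-k) p)).comp p (d p)).fderiv
    simp only [partialDeriv]
    rw [h2]
    rfl
  have dim : ∀ p, partialDeriv j (fun p => (waveExp (-k) p).im) p =
      (partialDeriv j (waveExp (-k)) p).im := by
    intro p
    have h2 : fderiv ℝ (fun p => (waveExp (-k) p).im) p = _ :=
      ((Complex.imCLM.hasFDerivAt (x := waveExp (-k) p)).comp p (d p)).fderiv
    simp only [partialDeriv]
    rw [h2]
    rfl
  -- the real and the imaginary parts of `exp (-i ξ(k)·p)` are admissible test functions
  have h1 := h _ hre i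
  have h2 := h _ him i
  have split : ∀ (z : Pt → ℂ) (F : Pt → ℂ), Continuous z → MemLp F 2 (volume.restrict Omega) →
      ∫ p in Omega, z p * F p = (∫ p in Omega, (((z p).re : ℝ) : ℂ) * F p) +
        Complex.I * ∫ p in Omega, (((z p).im : ℝ) : ℂ) * F p := by
    intro z F hz hF
    have j1 : Integrable (fun p => (((z p).re : ℝ) : ℂ) * F p) (volume.restrict Omega) :=
      (memLp_of_continuous (Complex.continuous_ofReal.comp (Complex.continuous_re.comp hz))).integrable_mul hF
    have j2 : Integrable (fun p => (((z p).im : ℝ) : ℂ) * F p) (volume.restrict Omega) :=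
      (memLp_of_continuous (Complex.continuous_ofReal.comp (Complex.continuous_im.comp hz))).integrable_mul hF
    rw [← integral_const_mul, ← integral_add j1 (j2.const_mul _)]
    refine integral_congr_ae (.of_forall fun p => ?_)
    simp only
    conv_lhs => rw [← Complex.re_add_im (z p)]
    ring
  have s1 := split (partialDeriv j (waveExp (-k))) U (continuous_partialDeriv hper.1 j) (memLp_component u i)
  have s2 := split (waveExp (-k)) G hper.1.continuous (memLp_component g i)
  simp only [← dre, ← dim] at s1
  rw [h1, h2] at s1
  simp only [partialDeriv_waveExp, mul_assoc] at s1
  rw [integral_const_mul, integral_const_mul] at s1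
  rw [PiLp.smul_apply, smul_eq_mul, coeff_apply, coeff_apply, scalarCoeff_eq, scalarCoeff_eq, s2]
  rw [wave_neg] at s1
  push_cast at s1
  simp only [hU, hG] at s1 ⊢
  linear_combination (1 / 2 : ℂ) * s1

theorem coeff_weakDeriv {j : Fin 3} {u : L2}
    (h : Memℓp (fun k => (Complex.I * wave k j : ℂ) • coeff u k) 2) (k : Freq) :
    coeff (weakDeriv j u) k = (Complex.I * wave k j : ℂ) • coeff u k := by
  have hex : ∃ g : L2, IsWeakDeriv j u g := by
    obtain ⟨g, hg⟩ := exists_coeff_eq h fun k i => by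
      simp [coeff_neg_freq, wave_neg]
    exact ⟨g, isWeakDeriv_of_coeff fun k => congrFun hg k⟩
  rw [weakDeriv, dif_pos hex]
  exact hex.choose_spec.coeff_eq k

end Derivatives

/-! ### Vertical integration -/

section Vertical

/-- The exchange of the vertical coordinate with a parameter `ζ`. It preserves the measure of
`Ω × (-1,1)`, which makes integrals along vertical lines meaningful for classes of functions. -/
def vertSwap (x : Pt × ℝ) : Pt × ℝ := (Function.update x.1 2 x.2, x.1 2)

theorem continuous_update_two : Continuous fun x : Pt × ℝ => Function.update x.1 2 x.2 :=
  continuous_fst.update 2 continuous_snd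

theorem update_mem_Omega_iff {p : Pt} {ζ : ℝ} :
    (Function.update p 2 ζ ∈ Omega ∧ p 2 ∈ Ioo (-1 : ℝ) 1) ↔ (p ∈ Omega ∧ ζ ∈ Ioo (-1 : ℝ) 1) := by
  simp [Omega]; tauto

theorem measurePreserving_vertSwap : MeasurePreserving vertSwap
    (((volume : Measure Pt).restrict Omega).prod (volume.restrict (Ioo (-1 : ℝ) 1)))
    (((volume : Measure Pt).restrict Omega).prod (volume.restrict (Ioo (-1 : ℝ) 1))) := by
  have he := volume_preserving_piFinSuccAbove (fun _ : Fin 3 => ℝ) 2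
  set e := MeasurableEquiv.piFinSuccAbove (fun _ : Fin 3 => ℝ) 2 with hedef
  have h1 : MeasurePreserving (fun x : (ℝ × (Fin 2 → ℝ)) × ℝ => ((x.2, x.1.2), x.1.1))
      (volume.prod volume) (volume.prod volume) := by
    have a1 := measurePreserving_prodAssoc (volume : Measure ℝ) (volume : Measure (Fin 2 → ℝ))
      (volume : Measure ℝ)
    have a2 := Measure.measurePreserving_swap (μ := (volume : Measure ℝ))
      (ν := (volume : Measure (Fin 2 → ℝ)).prod (volume : Measure ℝ))
    have a3 := (Measure.measurePreserving_swap (μ := (volume : Measure (Fin 2 → ℝ)))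
      (ν := (volume : Measure ℝ))).prod (MeasurePreserving.id (volume : Measure ℝ))
    exact a3.comp (a2.comp a1)
  have h2 := ((he.symm e).prod (MeasurePreserving.id (volume : Measure ℝ))).comp
    (h1.comp (he.prod (MeasurePreserving.id (volume : Measure ℝ))))
  have h3 : (Prod.map e.symm id ∘ (fun x : (ℝ × (Fin 2 → ℝ)) × ℝ => ((x.2, x.1.2), x.1.1)) ∘
      Prod.map e id : Pt × ℝ → Pt × ℝ) = vertSwap := by
    funext x
    refine Prod.ext ?_ rfl
    change Fin.insertNth 2 x.2 (Fin.removeNth 2 x.1) = _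
    rw [Fin.insertNth_removeNth]
    rfl
  rw [h3] at h2
  have h4 := h2.restrict_preimage (s := Omega ×ˢ Ioo (-1 : ℝ) 1)
    (measurableSet_Omega.prod measurableSet_Ioo)
  have h5 : vertSwap ⁻¹' (Omega ×ˢ Ioo (-1 : ℝ) 1) = Omega ×ˢ Ioo (-1 : ℝ) 1 := by
    ext x
    exact update_mem_Omega_iff
  rw [h5] at h4
  rwa [Measure.prod_restrict]

/-- Fubini's theorem after the exchange of the vertical coordinate. -/
theorem integral_vertSwap {G : Pt × ℝ → ℂ} (hG : Integrable G
    (((volume : Measure Pt).restrict Omega).prod (volume.restrict (Ioo (-1 : ℝ) 1)))) :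
    ∫ p in Omega, ∫ ζ in Ioo (-1 : ℝ) 1, G (Function.update p 2 ζ, p 2) =
      ∫ p in Omega, ∫ ζ in Ioo (-1 : ℝ) 1, G (p, ζ) := by
  have h1 : Integrable (fun x => G (vertSwap x)) (((volume : Measure Pt).restrict Omega).prod
      (volume.restrict (Ioo (-1 : ℝ) 1))) := measurePreserving_vertSwap.integrable_comp_of_integrable hG
  rw [← integral_prod _ hG, ← integral_prod (fun x : Pt × ℝ => G (Function.update x.1 2 x.2, x.1 2)) h1]
  conv_rhs => rw [← measurePreserving_vertSwap.map_eq]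
  rw [integral_map measurePreserving_vertSwap.measurable.aemeasurable]
  · rfl
  · rw [measurePreserving_vertSwap.map_eq]; exact hG.1

theorem waveExp_update (k : Freq) (p : Pt) (ζ : ℝ) : waveExp k (Function.update p 2 ζ) =
    waveExp k p * Complex.exp (Complex.I * ((wave k 2 * (ζ - p 2) : ℝ) : ℂ)) := by
  rw [← waveExp_add_single]
  congr 1
  ext j
  by_cases h : j = 2
  · subst h; simp
  · simp [h]

/-- The reflection `z ↦ -z` of the box. -/
def reflPt (p : Pt) : Pt := Function.update p 2 (-p 2)

theorem measurePreserving_reflPt : MeasurePreserving reflPt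
    ((volume : Measure Pt).restrict Omega) (volume.restrict Omega) := by
  have h1 := volume_preserving_pi (ι := Fin 3) (α' := fun _ => ℝ) (β' := fun _ => ℝ)
    (f := fun (j : Fin 3) (x : ℝ) => if j = 2 then -x else x) fun j => by
      by_cases h : j = 2
      · simp only [h, if_true]; exact Measure.measurePreserving_neg volume
      · simp only [h, if_false]; exact MeasurePreserving.id volume
  have h2 : (fun (a : Fin 3 → ℝ) (i : Fin 3) => if i = 2 then -(a i) else a i) = reflPt := by
    funext a i
    by_cases h : i = 2
    · subst h; simp [reflPt]
    · simp [reflPt, h]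
  rw [h2] at h1
  have h3 := h1.restrict_preimage (s := Omega) measurableSet_Omega
  have h4 : reflPt ⁻¹' Omega = Omega := by
    ext p
    simp only [reflPt, Omega, mem_preimage, mem_ofPred_eq, mem_Ioo]
    simp
    intros
    constructor <;> rintro ⟨a, b⟩ <;> constructor <;> linarith
  rwa [h4] at h3

theorem integral_reflPt {F : Pt → ℂ} (hF : AEStronglyMeasurable F (volume.restrict Omega)) :
    ∫ p in Omega, F (reflPt p) = ∫ p in Omega, F p := by
  conv_rhs => rw [← measurePreserving_reflPt.map_eq]
  rw [integral_map measurePreserving_reflPt.measurable.aemeasurable]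
  rwa [measurePreserving_reflPt.map_eq]

theorem waveExp_reflPt (k : Freq) (p : Pt) : waveExp k (reflPt p) = waveExp (reflZ k) p := by
  obtain ⟨h0, h1, h2⟩ := wave_reflZ k
  simp only [waveExp, Fin.sum_univ_three, h0, h1, h2]
  simp [reflPt]

theorem reflZ_neg (k : Freq) : reflZ (-k) = -reflZ k := by
  ext j; fin_cases j <;> simp [reflZ]

theorem scalarCoeff_reflPt {F : Pt → ℂ} (hF : AEStronglyMeasurable F (volume.restrict Omega))
    (k : Freq) : scalarCoeff (fun p => F (reflPt p)) k = scalarCoeff F (reflZ k) := by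
  have h := integral_reflPt (F := fun p => waveExp (-reflZ k) p * F p)
    ((continuous_waveExp (-reflZ k)).aestronglyMeasurable.mul hF)
  rw [scalarCoeff_eq, scalarCoeff_eq, ← h]
  congr 2
  funext p
  rw [waveExp_reflPt, ← reflZ_neg, reflZ_involutive]

theorem sq_integral_le_two_mul {f : ℝ → ℝ} (hf : Integrable f (volume.restrict (Ioo (-1 : ℝ) 1)))
    (hf2 : Integrable (fun t => f t ^ 2) (volume.restrict (Ioo (-1 : ℝ) 1))) :
    (∫ t in Ioo (-1 : ℝ) 1, f t) ^ 2 ≤ 2 * ∫ t in Ioo (-1 : ℝ) 1, f t ^ 2 := by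
  set c := ∫ t in Ioo (-1 : ℝ) 1, f t with hc
  have h1 : 0 ≤ ∫ t in Ioo (-1 : ℝ) 1, (f t ^ 2 - c * f t + c ^ 2 / 4) :=
    integral_nonneg fun t => by
      simp only [Pi.zero_apply]
      nlinarith [sq_nonneg (f t - c / 2)]
  have i1 : Integrable (fun t => f t ^ 2 - c * f t) (volume.restrict (Ioo (-1 : ℝ) 1)) :=
    hf2.sub (hf.const_mul c)
  rw [integral_add i1 (integrable_const _), integral_sub hf2 (hf.const_mul c), integral_const_mul,
    ← hc, integral_const] at h1
  simp at h1
  norm_num at h1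
  linarith

/-- Minus the vertical primitive of `D`, from the bottom. -/
noncomputable def vertPrimitive (D : Pt → ℝ) (p : Pt) : ℝ :=
  -∫ ζ in (-1 : ℝ)..(p 2), D (Function.update p 2 ζ)

variable {D : Pt → ℝ}

/-- The values of `D` at the points above height `ζ`. -/
noncomputable def lowerCut (D : Pt → ℝ) (x : Pt × ℝ) : ℝ := if x.1 2 < x.2 then D x.1 else 0

theorem vertPrimitive_eq {p : Pt} (hp : p ∈ Omega) :
    vertPrimitive D p = -∫ ζ in Ioo (-1 : ℝ) 1, lowerCut D (vertSwap (p, ζ)) := by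
  have hp2 : p 2 ∈ Ioo (-1 : ℝ) 1 := hp.2.2
  rw [vertPrimitive, intervalIntegral.integral_of_le hp2.1.le, integral_Ioc_eq_integral_Ioo]
  congr 1
  have : (fun ζ => lowerCut D (vertSwap (p, ζ))) =
      (Iio (p 2)).indicator fun ζ => D (Function.update p 2 ζ) := by
    funext ζ
    simp [lowerCut, vertSwap, indicator_apply]
  rw [this, integral_indicator measurableSet_Iio, Measure.restrict_restrict measurableSet_Iio]
  congr 2
  ext ζ
  simp only [mem_Ioo, mem_inter_iff, mem_Iio]
  constructor
  · rintro ⟨a, b⟩; exact ⟨b, a, b.trans hp2.2⟩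
  · rintro ⟨a, b, c⟩; exact ⟨b, a⟩

theorem memLp_lowerCut (hD : MemLp D 2 (volume.restrict Omega)) :
    MemLp (lowerCut D) 2
      (((volume : Measure Pt).restrict Omega).prod (volume.restrict (Ioo (-1 : ℝ) 1))) := by
  have h1 := hD.comp_fst (volume.restrict (Ioo (-1 : ℝ) 1))
  have hs : MeasurableSet {x : Pt × ℝ | x.1 2 < x.2} :=
    measurableSet_lt ((measurable_pi_apply 2).comp measurable_fst) measurable_snd
  exact h1.indicator hs

theorem memLp_vertPrimitive (hD : MemLp D 2 (volume.restrict Omega)) :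
    MemLp (vertPrimitive D) 2 (volume.restrict Omega) := by
  have hK : MemLp (fun x => lowerCut D (vertSwap x)) 2
      (((volume : Measure Pt).restrict Omega).prod (volume.restrict (Ioo (-1 : ℝ) 1))) :=
    (memLp_lowerCut hD).comp_measurePreserving measurePreserving_vertSwap
  have hKi := hK.integrable (by norm_num)
  have hK2 := hK.integrable_sq
  have hae : vertPrimitive D =ᵐ[volume.restrict Omega]
      fun p => -∫ ζ in Ioo (-1 : ℝ) 1, lowerCut D (vertSwap (p, ζ)) := by
    filter_upwards [ae_restrict_mem measurableSet_Omega] with p hp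
    exact vertPrimitive_eq hp
  have hm : AEStronglyMeasurable (fun p => -∫ ζ in Ioo (-1 : ℝ) 1, lowerCut D (vertSwap (p, ζ)))
      (volume.restrict Omega) := hKi.integral_prod_left.1.neg
  refine MemLp.ae_eq hae.symm ?_
  rw [memLp_two_iff_integrable_sq hm]
  refine (hK2.integral_prod_left.const_mul 2).mono' (hm.pow 2) ?_
  filter_upwards [hKi.prod_right_ae, hK2.prod_right_ae] with p h1 h2
  rw [Real.norm_of_nonneg (sq_nonneg _), neg_sq]
  exact sq_integral_le_two_mul h1 h2

theorem integral_exp_Ioo {z : ℝ} (hz : z ∈ Ioo (-1 : ℝ) 1) {r : ℝ} (hr : r ≠ 0) :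
    ∫ ζ in Ioo (-1 : ℝ) 1, (if z < ζ then Complex.exp (Complex.I * ((r * (ζ - z) : ℝ) : ℂ)) else 0) =
      (Complex.exp (Complex.I * ((r * (1 - z) : ℝ) : ℂ)) - 1) / (Complex.I * r) := by
  have h0 : (fun ζ : ℝ => if z < ζ then Complex.exp (Complex.I * ((r * (ζ - z) : ℝ) : ℂ)) else 0) =
      (Ioi z).indicator fun ζ : ℝ => Complex.exp (Complex.I * ((r * (ζ - z) : ℝ) : ℂ)) := by
    funext ζ
    simp [indicator_apply]
  have h1 : Ioi z ∩ Ioo (-1 : ℝ) 1 = Ioo z 1 := by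
    ext ζ
    simp only [mem_Ioo, mem_inter_iff, mem_Ioi]
    constructor
    · rintro ⟨a, b, c⟩; exact ⟨a, c⟩
    · rintro ⟨a, b⟩; exact ⟨a, hz.1.trans a, b⟩
  rw [h0, integral_indicator measurableSet_Ioi, Measure.restrict_restrict measurableSet_Ioi, h1,
    ← integral_Ioc_eq_integral_Ioo, ← intervalIntegral.integral_of_le hz.2.le]
  have hc : (Complex.I * r : ℂ) ≠ 0 := mul_ne_zero Complex.I_ne_zero (by exact_mod_cast hr)
  have h2 : ∀ ζ ∈ uIcc z 1, HasDerivAt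
      (fun ζ : ℝ => Complex.exp (Complex.I * ((r * (ζ - z) : ℝ) : ℂ)) / (Complex.I * r))
      (Complex.exp (Complex.I * ((r * (ζ - z) : ℝ) : ℂ))) ζ := by
    intro ζ _
    have h3 : HasDerivAt (fun ζ : ℝ => ((r * (ζ - z) : ℝ) : ℂ)) ((r : ℝ) : ℂ) ζ := by
      have := (((hasDerivAt_id ζ).sub_const z).const_mul r).ofReal_comp
      simpa using this
    have h4 := ((h3.const_mul Complex.I).cexp).div_const (Complex.I * r)
    rwa [mul_div_assoc, div_self hc, mul_one] at h4
  rw [intervalIntegral.integral_eq_sub_of_hasDerivAt h2 (Continuous.intervalIntegrable (by fun_prop) _ _),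
    sub_self, mul_zero, Complex.ofReal_zero, mul_zero, Complex.exp_zero, sub_div]

/-- The Fourier coefficients of a vertical primitive, first as an integral over the box. -/
theorem scalarCoeff_vertPrimitive_aux (hD : MemLp D 2 (volume.restrict Omega)) (k : Freq) :
    scalarCoeff (fun p => (vertPrimitive D p : ℂ)) k = -(1 / 2 : ℂ) * ∫ p in Omega,
      waveExp (-k) p * (D p : ℂ) * ∫ ζ in Ioo (-1 : ℝ) 1,
        (if p 2 < ζ then Complex.exp (Complex.I * ((wave (-k) 2 * (ζ - p 2) : ℝ) : ℂ)) else 0) := by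
  have hint : Integrable (fun x : Pt × ℝ => waveExp (-k) (Function.update x.1 2 x.2) *
      (lowerCut D x : ℂ)) (((volume : Measure Pt).restrict Omega).prod
        (volume.restrict (Ioo (-1 : ℝ) 1))) := by
    refine (((memLp_lowerCut hD).integrable (by norm_num)).ofReal).bdd_mul (c := 1)
      ((continuous_waveExp _).comp continuous_update_two).aestronglyMeasurable
      (.of_forall fun x => (norm_waveExp _ _).le)
  have h1 := integral_vertSwap hint
  have h2 : ∫ p in Omega, waveExp (-k) p * (vertPrimitive D p : ℂ) =
      -∫ p in Omega, ∫ ζ in Ioo (-1 : ℝ) 1,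
        waveExp (-k) (Function.update (Function.update p 2 ζ) 2 (p 2)) *
          (lowerCut D (Function.update p 2 ζ, p 2) : ℂ) := by
    rw [← integral_neg]
    refine integral_congr_ae ?_
    filter_upwards [ae_restrict_mem measurableSet_Omega] with p hp
    rw [vertPrimitive_eq hp]
    simp only [Function.update_idem, Function.update_eq_self]
    rw [integral_const_mul, integral_complex_ofReal]
    push_cast
    rw [mul_neg]
    rfl
  have h3 : ∀ p : Pt, ∫ ζ in Ioo (-1 : ℝ) 1, waveExp (-k) (Function.update p 2 ζ) *
      (lowerCut D (p, ζ) : ℂ) = waveExp (-k) p * (D p : ℂ) * ∫ ζ in Ioo (-1 : ℝ) 1,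
        (if p 2 < ζ then Complex.exp (Complex.I * ((wave (-k) 2 * (ζ - p 2) : ℝ) : ℂ)) else 0) := by
    intro p
    rw [← integral_const_mul]
    congr 1
    funext ζ
    rw [waveExp_update]
    by_cases h : p 2 < ζ
    · simp only [lowerCut, h, if_true]; ring
    · simp [lowerCut, h]
  rw [scalarCoeff_eq, h2, h1]
  simp only [h3]
  ring

/-- Vertical integration divides the Fourier coefficients by `i ξ₃`, if `D` is even in `z` and
has vertical mean zero. For `k₃ = 0` both sides are `0`: the primitive is odd in `z`, and the
division by zero gives `0`. -/
theorem scalarCoeff_vertPrimitive (hD : MemLp D 2 (volume.restrict Omega))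
    (h0 : ∀ k : Freq, k 2 = 0 → scalarCoeff (fun p => (D p : ℂ)) k = 0)
    (he : ∀ k, scalarCoeff (fun p => (D p : ℂ)) (reflZ k) = scalarCoeff (fun p => (D p : ℂ)) k)
    (k : Freq) : scalarCoeff (fun p => (vertPrimitive D p : ℂ)) k =
      -scalarCoeff (fun p => (D p : ℂ)) k / (Complex.I * wave k 2) := by
  have hDc : MemLp (fun p => (D p : ℂ)) 2 (volume.restrict Omega) := hD.ofReal
  have hDi : Integrable (fun p => (D p : ℂ)) (volume.restrict Omega) := hDc.integrable (by norm_num)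
  rw [scalarCoeff_vertPrimitive_aux hD]
  by_cases hk : k 2 = 0
  · -- the integrand is odd in `z`, up to a term which is the mean of `D`
    have hw : wave k 2 = 0 := (wave_two_eq_zero_iff k).2 hk
    rw [hw, Complex.ofReal_zero, mul_zero, div_zero]
    have hrefl : reflZ k = k := by ext j; fin_cases j <;> simp [reflZ, hk]
    have hDr : MemLp (fun p => (D (reflPt p) : ℂ)) 2 (volume.restrict Omega) :=
      hDc.comp_measurePreserving measurePreserving_reflPt
    have heven : (fun p => (D (reflPt p) : ℂ)) =ᵐ[volume.restrict Omega] fun p => (D p : ℂ) := by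
      have h1 : MemLp (fun p => (D (reflPt p) : ℂ) + (-1) * (D p : ℂ)) 2 (volume.restrict Omega) :=
        hDr.add (hDc.const_mul (-1))
      have h2 := ae_eq_zero_of_scalarCoeff h1 fun k => by
        rw [scalarCoeff_add (hDr.integrable (by norm_num)) (hDi.const_mul (-1)), scalarCoeff_const_mul,
          scalarCoeff_reflPt (F := fun p => (D p : ℂ)) hDc.1, he]
        ring
      filter_upwards [h2] with p hp
      simp only [Pi.zero_apply] at hp
      linear_combination hp
    have hz : Continuous fun p : Pt => ((p 2 : ℝ) : ℂ) :=
      Complex.continuous_ofReal.comp (continuous_apply 2)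
    have hzD : Integrable (fun p => ((p 2 : ℝ) : ℂ) * (waveExp (-k) p * (D p : ℂ)))
        (volume.restrict Omega) :=
      (memLp_of_continuous hz).integrable_mul (memLp_waveExp_mul hDc (-k))
    have hodd : ∫ p in Omega, ((p 2 : ℝ) : ℂ) * (waveExp (-k) p * (D p : ℂ)) = 0 := by
      have h1 := integral_reflPt hzD.1
      have h2 : ∫ p in Omega, ((reflPt p 2 : ℝ) : ℂ) * (waveExp (-k) (reflPt p) * (D (reflPt p) : ℂ)) =
          -∫ p in Omega, ((p 2 : ℝ) : ℂ) * (waveExp (-k) p * (D p : ℂ)) := by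
        rw [← integral_neg]
        refine integral_congr_ae ?_
        filter_upwards [heven] with p hp
        rw [hp, waveExp_reflPt, reflZ_neg, hrefl]
        simp [reflPt]
      rw [h2] at h1
      exact self_eq_neg.1 h1.symm
    have hmean := h0 k hk
    rw [scalarCoeff_eq] at hmean
    have hfin : ∫ p in Omega, waveExp (-k) p * (D p : ℂ) * ∫ ζ in Ioo (-1 : ℝ) 1,
        (if p 2 < ζ then Complex.exp (Complex.I * ((wave (-k) 2 * (ζ - p 2) : ℝ) : ℂ)) else 0) =
        ∫ p in Omega, (waveExp (-k) p * (D p : ℂ) -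
          ((p 2 : ℝ) : ℂ) * (waveExp (-k) p * (D p : ℂ))) := by
      refine integral_congr_ae ?_
      filter_upwards [ae_restrict_mem measurableSet_Omega] with p hp
      have hp2 : p 2 ∈ Ioo (-1 : ℝ) 1 := hp.2.2
      have h1 : ∫ ζ in Ioo (-1 : ℝ) 1, (if p 2 < ζ then
          Complex.exp (Complex.I * ((wave (-k) 2 * (ζ - p 2) : ℝ) : ℂ)) else 0) = 1 - ((p 2 : ℝ) : ℂ) := by
        have h2 : (fun ζ : ℝ => if p 2 < ζ then
            Complex.exp (Complex.I * ((wave (-k) 2 * (ζ - p 2) : ℝ) : ℂ)) else 0) =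
            (Ioi (p 2)).indicator fun _ => (1 : ℂ) := by
          funext ζ
          simp [indicator_apply, wave_neg, hw]
        have h3 : Ioi (p 2) ∩ Ioo (-1 : ℝ) 1 = Ioo (p 2) 1 := by
          ext ζ
          simp only [mem_Ioo, mem_inter_iff, mem_Ioi]
          constructor
          · rintro ⟨a, b, c⟩; exact ⟨a, c⟩
          · rintro ⟨a, b⟩; exact ⟨a, hp2.1.trans a, b⟩
        rw [h2, integral_indicator measurableSet_Ioi, Measure.restrict_restrict measurableSet_Ioi, h3,
          setIntegral_const, measureReal_def, Real.volume_Ioo, ENNReal.toReal_ofReal (by linarith [hp2.2])]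
        simp
      rw [h1]
      ring
    rw [hfin, integral_sub (integrable_waveExp_mul hDi _) hzD, hodd, sub_zero]
    linear_combination -hmean
  · have hw : wave k 2 ≠ 0 := (wave_two_eq_zero_iff k).not.2 hk
    have hw' : wave (-k) 2 ≠ 0 := by rw [wave_neg]; exact neg_ne_zero.2 hw
    have hwc : (wave k 2 : ℂ) ≠ 0 := by exact_mod_cast hw
    set k₀ : Freq := Function.update k 2 0 with hk₀
    have hexp : ∀ p : Pt, waveExp (-k) p *
        Complex.exp (Complex.I * ((wave (-k) 2 * (1 - p 2) : ℝ) : ℂ)) =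
        Complex.exp (Complex.I * ((wave (-k) 2 : ℝ) : ℂ)) * waveExp (-k₀) p := by
      intro p
      rw [waveExp, waveExp, ← Complex.exp_add, ← Complex.exp_add]
      congr 1
      simp only [Fin.sum_univ_three, wave_neg]
      have e0 : wave k₀ 0 = wave k 0 := by simp [wave, hk₀]
      have e1 : wave k₀ 1 = wave k 1 := by simp [wave, hk₀]
      have e2 : wave k₀ 2 = 0 := by simp [wave, hk₀]
      rw [e0, e1, e2]
      push_cast
      ring
    have hmean := h0 k₀ (by simp [hk₀])
    rw [scalarCoeff_eq] at hmean ⊢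
    have hfin : ∫ p in Omega, waveExp (-k) p * (D p : ℂ) * ∫ ζ in Ioo (-1 : ℝ) 1,
        (if p 2 < ζ then Complex.exp (Complex.I * ((wave (-k) 2 * (ζ - p 2) : ℝ) : ℂ)) else 0) =
        ∫ p in Omega, (Complex.exp (Complex.I * ((wave (-k) 2 : ℝ) : ℂ)) / (Complex.I * wave (-k) 2) *
          (waveExp (-k₀) p * (D p : ℂ)) -
          1 / (Complex.I * wave (-k) 2) * (waveExp (-k) p * (D p : ℂ))) := by
      refine integral_congr_ae ?_
      filter_upwards [ae_restrict_mem measurableSet_Omega] with p hp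
      rw [integral_exp_Ioo hp.2.2 hw']
      linear_combination (D p : ℂ) / (Complex.I * wave (-k) 2) * hexp p
    rw [hfin, integral_sub ((integrable_waveExp_mul hDi _).const_mul _)
      ((integrable_waveExp_mul hDi _).const_mul _), integral_const_mul, integral_const_mul]
    have hmean' : ∫ p in Omega, waveExp (-k₀) p * (D p : ℂ) = 0 := by
      linear_combination 2 * hmean
    rw [hmean', wave_neg]
    push_cast
    have := Complex.I_ne_zero
    field_simp
    ring

end Vertical

/-! ### The convection term in Fourier variables -/

theorem memLp_component_real (u : L2) (i : Fin 2) :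
    MemLp (fun p => (u : Pt → V2) p i) 2 (volume.restrict Omega) := by
  have h := Lp.memLp u
  exact h.of_le ((EuclideanSpace.proj (𝕜 := ℝ) i).continuous.comp_aestronglyMeasurable h.1)
    (.of_forall fun p => PiLp.norm_apply_le _ i)

theorem hasSum_C2 {ι : Type*} {f : ι → C2} {d : C2} (h : ∀ i, HasSum (fun l => f l i) (d i)) :
    HasSum f d := by
  have h1 : HasSum (fun l i => f l i) (fun i => d i) := Pi.hasSum.2 h
  exact h1.mapL ((EuclideanSpace.equiv (Fin 2) ℂ).symm : (Fin 2 → ℂ) →L[ℂ] C2)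

/-- The horizontal divergence of a field in terms of its weak derivatives. -/
noncomputable def divH (v : L2) (p : Pt) : ℝ :=
  ∑ i : Fin 2, ((weakDeriv i.castSucc v : L2) : Pt → V2) p i

theorem vertVel_eq (v : L2) : vertVel v = vertPrimitive (divH v) := rfl

theorem memLp_divH (v : L2) : MemLp (divH v) 2 (volume.restrict Omega) :=
  memLp_finsetSum _ fun i _ => memLp_component_real _ i

theorem scalarCoeff_divH {v : L2}
    (hd : ∀ j, Memℓp (fun k => (Complex.I * wave k j : ℂ) • coeff v k) 2) (k : Freq) :
    scalarCoeff (fun p => (divH v p : ℂ)) k = Complex.I * waveDot k (coeff v k) := by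
  have h1 : (fun p => (divH v p : ℂ)) = fun p =>
      ((((weakDeriv (Fin.castSucc 0) v : L2) : Pt → V2) p 0 : ℝ) : ℂ) +
        ((((weakDeriv (Fin.castSucc 1) v : L2) : Pt → V2) p 1 : ℝ) : ℂ) := by
    funext p
    simp [divH, Fin.sum_univ_two]
  rw [h1, scalarCoeff_add ((memLp_component _ _).integrable (by norm_num))
    ((memLp_component _ _).integrable (by norm_num)), ← coeff_apply, ← coeff_apply,
    coeff_weakDeriv (hd _), coeff_weakDeriv (hd _), waveDot_eq]
  simp
  ring

theorem scalarCoeff_vertVel {v : L2} (hv : Admissible (coeff v))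
    (hd : ∀ j, Memℓp (fun k => (Complex.I * wave k j : ℂ) • coeff v k) 2) (k : Freq) :
    scalarCoeff (fun p => (vertVel v p : ℂ)) k = vertFreq k (coeff v k) := by
  rw [vertVel_eq, scalarCoeff_vertPrimitive (memLp_divH v), scalarCoeff_divH hd, vertFreq, ← mul_neg,
    mul_div_mul_left _ _ Complex.I_ne_zero]
  · intro k hk
    rw [scalarCoeff_divH hd, hv.1 k hk, mul_zero]
  · intro k
    obtain ⟨h0, h1, -⟩ := wave_reflZ k
    rw [scalarCoeff_divH hd, scalarCoeff_divH hd, hv.2.1, waveDot_eq, waveDot_eq, h0, h1]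

/-- The convection term is the convolution `transport`. -/
theorem hasSum_convection {v : L2} (hv : Admissible (coeff v))
    (hd : ∀ j, Memℓp (fun k => (Complex.I * wave k j : ℂ) • coeff v k) 2) (m : Freq) :
    HasSum (fun l => flux (m - l) m (coeff v (m - l)) • coeff v l)
      (fourierCoeff (convection v v) m) := by
  refine hasSum_C2 fun i => ?_
  have hW : MemLp (fun p => (vertVel v p : ℂ)) 2 (volume.restrict Omega) := by
    rw [vertVel_eq]; exact (memLp_vertPrimitive (memLp_divH v)).ofReal
  have hc := fun u : L2 => memLp_component u
  have hm : ∀ {F G : Pt → ℂ}, MemLp F 2 (volume.restrict Omega) → MemLp G 2 (volume.restrict Omega) →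
      Integrable (fun p => F p * G p) (volume.restrict Omega) := fun hF hG => hF.integrable_mul hG
  have h0 := hm (hc v 0) (hc (weakDeriv (Fin.castSucc 0) v) i)
  have h1 := hm (hc v 1) (hc (weakDeriv (Fin.castSucc 1) v) i)
  have h2 := hm hW (hc (weakDeriv 2 v) i)
  have ha : ∀ {F G : Pt → ℂ}, Integrable F (volume.restrict Omega) → Integrable G (volume.restrict Omega) →
      Integrable (fun p => F p + G p) (volume.restrict Omega) := fun hF hG => hF.add hG
  have h01 := ha h0 h1
  have e : (fun p => ((convection v v p i : ℝ) : ℂ)) = fun p =>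
      (vertVel v p : ℂ) * ((((weakDeriv 2 v : L2) : Pt → V2) p i : ℝ) : ℂ) +
      ((((v : Pt → V2) p 0 : ℝ) : ℂ) * ((((weakDeriv (Fin.castSucc 0) v : L2) : Pt → V2) p i : ℝ) : ℂ) +
      (((v : Pt → V2) p 1 : ℝ) : ℂ) * ((((weakDeriv (Fin.castSucc 1) v : L2) : Pt → V2) p i : ℝ) : ℂ)) := by
    funext p
    simp [convection, Fin.sum_univ_two]
  rw [fourierCoeff_apply, e, scalarCoeff_add h2 h01, scalarCoeff_add h0 h1]
  refine ((hasSum_scalarCoeff_mul hW (hc (weakDeriv 2 v) i) m).add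
    ((hasSum_scalarCoeff_mul (hc v 0) (hc (weakDeriv (Fin.castSucc 0) v) i) m).add
      (hasSum_scalarCoeff_mul (hc v 1) (hc (weakDeriv (Fin.castSucc 1) v) i) m))).congr_fun
    fun l => ?_
  -- the flux of an admissible mode through itself vanishes
  have hf : flux (m - l) m (coeff v (m - l)) = flux (m - l) l (coeff v (m - l)) := by
    have := flux_sub (m - l) l m (coeff v (m - l))
    rw [flux_self (hv.1 (m - l))] at this
    exact (sub_eq_zero.1 this.symm)
  rw [scalarCoeff_vertVel hv hd, ← coeff_apply, ← coeff_apply, ← coeff_apply, ← coeff_apply,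
    ← coeff_apply, coeff_weakDeriv (hd _), coeff_weakDeriv (hd _), coeff_weakDeriv (hd _), hf, flux,
    waveDot_eq]
  simp
  ring

theorem nonlin_eq {v : L2} (hv : Admissible (coeff v))
    (hd : ∀ j, Memℓp (fun k => (Complex.I * wave k j : ℂ) • coeff v k) 2) : nonlin v v = hydroProj (transport (coeff v) (coeff v)) := by
  have : fourierCoeff (convection v v) = transport (coeff v) (coeff v) :=
    funext fun m => (hasSum_convection hv hd m).tsum_eq.symm
  rw [nonlin, this]

/-! ### Solenoidal test fields are admissible -/

/-- The linear part of `p ↦ Function.update p 2 ζ`. -/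
noncomputable def dropZ : Pt →L[ℝ] Pt :=
  ContinuousLinearMap.id ℝ Pt -
    (ContinuousLinearMap.single ℝ (fun _ : Fin 3 => ℝ) 2).comp (ContinuousLinearMap.proj 2)

theorem update_two_eq (p : Pt) (ζ : ℝ) : Function.update p 2 ζ = dropZ p + Pi.single 2 ζ := by
  ext j
  by_cases h : j = 2
  · subst h; simp [dropZ]
  · simp [dropZ, h]

/-- Horizontal differentiation under the integral along vertical lines. -/
theorem partialDeriv_integral_update {E : Type*} [NormedAddCommGroup E] [NormedSpace ℝ E]
    [CompleteSpace E] {v : Pt → E} (hv : ContDiff ℝ ∞ v) {j : Fin 3} (hj : j ≠ 2) (p : Pt) :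
    partialDeriv j (fun p => ∫ ζ in (-1 : ℝ)..1, v (Function.update p 2 ζ)) p =
      ∫ ζ in (-1 : ℝ)..1, partialDeriv j v (Function.update p 2 ζ) := by
  have hc : Continuous fun x : Pt × ℝ => (fderiv ℝ v (Function.update x.1 2 x.2)).comp dropZ :=
    ((hv.continuous_fderiv (by simp)).comp continuous_update_two).clm_comp continuous_const
  have hcz : ∀ p : Pt, Continuous fun ζ : ℝ => Function.update p 2 ζ := fun p =>
    continuous_update_two.comp (Continuous.prodMk_right p)
  obtain ⟨C, hC⟩ := ((isCompact_closedBall p 1).prod (isCompact_Icc (a := (-1 : ℝ)) (b := 1))).exists_bound_of_continuousOn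
    hc.continuousOn
  have hcf : ∀ p : Pt, Continuous fun ζ : ℝ => (fderiv ℝ v (Function.update p 2 ζ)).comp dropZ :=
    fun p => hc.comp (Continuous.prodMk_right p)
  have h := intervalIntegral.hasFDerivAt_integral_of_dominated_of_fderiv_le (μ := volume)
    (a := (-1 : ℝ)) (b := 1) (F := fun p ζ => v (Function.update p 2 ζ)) (bound := fun _ => C)
    (F' := fun p ζ => (fderiv ℝ v (Function.update p 2 ζ)).comp dropZ)
    (Metric.closedBall_mem_nhds p one_pos)
    (.of_forall fun p => ((hv.continuous.comp (hcz p)).aestronglyMeasurable))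
    ((hv.continuous.comp (hcz p)).intervalIntegrable _ _)
    (hcf p).aestronglyMeasurable
    (.of_forall fun ζ hζ x hx => hC (x, ζ) ⟨hx, by
      rw [uIoc_of_le (by norm_num)] at hζ; exact Ioc_subset_Icc_self hζ⟩)
    intervalIntegrable_const
    (.of_forall fun ζ _ x _ => by
      have h1 : HasFDerivAt (fun p => Function.update p 2 ζ) dropZ x := by
        simp only [update_two_eq]
        exact dropZ.hasFDerivAt.add_const _
      exact ((hv.differentiable (by simp)) _).hasFDerivAt.comp x h1)
  unfold partialDeriv
  rw [h.fderiv, ContinuousLinearMap.intervalIntegral_apply ((hcf p).intervalIntegrable _ _)]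
  congr 1
  funext ζ
  rw [ContinuousLinearMap.comp_apply]
  congr 1
  ext i
  have hj' : (2 : Fin 3) ≠ j := fun h => hj h.symm
  simp [dropZ, hj']

theorem SmoothPeriodic.component {v : Pt → V2} (hv : SmoothPeriodic v) (i : Fin 2) :
    SmoothPeriodic fun p => v p i :=
  ⟨(EuclideanSpace.proj (𝕜 := ℝ) i).contDiff.comp hv.1, fun j p => by simp only [hv.2]⟩

theorem partialDeriv_component {v : Pt → V2} {p : Pt} (hv : DifferentiableAt ℝ v p) (i : Fin 2)
    (j : Fin 3) : partialDeriv j (fun p => v p i) p = partialDeriv j v p i := by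
  have h := ((EuclideanSpace.proj (𝕜 := ℝ) i).hasFDerivAt (x := v p)).comp p hv.hasFDerivAt
  unfold partialDeriv
  have h2 : fderiv ℝ (fun p => v p i) p = _ := h.fderiv
  rw [h2]
  rfl

theorem IsSolenoidalTestField.admissible {v : Pt → V2} (hv : IsSolenoidalTestField v) :
    Admissible (fourierCoeff v) := by
  obtain ⟨hs, he, hdiv⟩ := hv
  have hdiff := hs.1.differentiable (by simp : (∞ : WithTop ℕ∞) ≠ 0)
  have hci : ∀ i, Continuous fun p => ((v p i : ℝ) : ℂ) := fun i =>
    Complex.continuous_ofReal.comp (hs.component i).1.continuous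
  refine ⟨fun k hk => ?_, fun k => ?_, fun k i => ?_⟩
  · set d : Pt → ℝ := fun p => ∑ i : Fin 2, partialDeriv i.castSucc v p i with hd
    have hdc : Continuous d := continuous_finsetSum _ fun i _ =>
      (EuclideanSpace.proj (𝕜 := ℝ) i).continuous.comp (continuous_partialDeriv hs.1 _)
    have hcz : ∀ p : Pt, Continuous fun ζ : ℝ => Function.update p 2 ζ := fun p =>
      continuous_update_two.comp (Continuous.prodMk_right p)
    have hd0 : ∀ p, ∫ ζ in Ioo (-1 : ℝ) 1, d (Function.update p 2 ζ) = 0 := by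
      intro p
      have h1 := hdiv p
      have h2 : ∀ j : Fin 3, j ≠ 2 → partialDeriv j (verticalMean v) p =
          (1 / 2 : ℝ) • ∫ ζ in (-1 : ℝ)..1, partialDeriv j v (Function.update p 2 ζ) := by
        intro j hj
        rw [← partialDeriv_integral_update hs.1 hj]
        change fderiv ℝ ((1 / 2 : ℝ) • fun p => ∫ ζ in (-1 : ℝ)..1, v (Function.update p 2 ζ)) p _ = _
        rw [fderiv_const_smul_field]
        rfl
      have h3 : ∀ i : Fin 2, (∫ ζ in (-1 : ℝ)..1, partialDeriv i.castSucc v (Function.update p 2 ζ)) i =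
          ∫ ζ in (-1 : ℝ)..1, partialDeriv i.castSucc v (Function.update p 2 ζ) i := fun i =>
        ((EuclideanSpace.proj (𝕜 := ℝ) i).intervalIntegral_comp_comm
          (((continuous_partialDeriv hs.1 _).comp (hcz p)).intervalIntegrable _ _)).symm
      rw [← integral_Ioc_eq_integral_Ioo, ← intervalIntegral.integral_of_le (by norm_num), hd]
      have h5 : ∀ i : Fin 2, IntervalIntegrable
          (fun ζ => partialDeriv i.castSucc v (Function.update p 2 ζ) i) volume (-1) 1 := fun i =>
        Continuous.intervalIntegrable ((EuclideanSpace.proj (𝕜 := ℝ) i).continuous.comp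
            ((continuous_partialDeriv hs.1 _).comp (hcz p))) _ _
      beta_reduce
      rw [intervalIntegral.integral_finsetSum fun i _ => h5 i]
      have h4 : ∀ i : Fin 2, partialDeriv i.castSucc (verticalMean v) p i =
          1 / 2 * ∫ ζ in (-1 : ℝ)..1, partialDeriv i.castSucc v (Function.update p 2 ζ) i := by
        intro i
        rw [h2 _ (by fin_cases i <;> decide), PiLp.smul_apply, h3, smul_eq_mul]
      rw [Finset.sum_congr rfl fun i _ => h4 i, ← Finset.mul_sum] at h1
      linarith
    have hcoef : scalarCoeff (fun p => (d p : ℂ)) k = Complex.I * waveDot k (fourierCoeff v k) := by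
      have e : (fun p => (d p : ℂ)) = fun p =>
          ((partialDeriv (Fin.castSucc 0) (fun p => v p 0) p : ℝ) : ℂ) +
            ((partialDeriv (Fin.castSucc 1) (fun p => v p 1) p : ℝ) : ℂ) := by
        funext p
        simp only [hd, Fin.sum_univ_two, partialDeriv_component (hdiff p)]
        push_cast
        rfl
      have hi : ∀ i j, Integrable (fun p => ((partialDeriv j (fun p => v p i) p : ℝ) : ℂ))
          (volume.restrict Omega) := fun i j =>
        (integrable_of_continuous (continuous_partialDeriv (hs.component i).1 j)).ofReal
      rw [e, scalarCoeff_add (hi _ _) (hi _ _), scalarCoeff_partialDeriv (hs.component 0),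
        scalarCoeff_partialDeriv (hs.component 1), waveDot_eq, fourierCoeff_apply, fourierCoeff_apply]
      simp
      ring
    have hint : Integrable (fun x : Pt × ℝ => waveExp (-k) x.1 * (d x.1 : ℂ))
        (((volume : Measure Pt).restrict Omega).prod (volume.restrict (Ioo (-1 : ℝ) 1))) :=
      Integrable.comp_fst (f := fun p => waveExp (-k) p * (d p : ℂ)) (integrable_of_continuous
        ((continuous_waveExp _).mul (Complex.continuous_ofReal.comp hdc))) _
    have hsw := integral_vertSwap hint
    have hw2 : wave (-k) 2 = 0 := by rw [wave_neg, (wave_two_eq_zero_iff k).2 hk, neg_zero]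
    have hl : ∀ p : Pt, ∫ ζ in Ioo (-1 : ℝ) 1, waveExp (-k) (Function.update p 2 ζ) *
        (d (Function.update p 2 ζ) : ℂ) = 0 := by
      intro p
      have : ∀ ζ, waveExp (-k) (Function.update p 2 ζ) = waveExp (-k) p := fun ζ => by
        rw [waveExp_update, hw2]; simp
      simp only [this]
      rw [integral_const_mul, integral_complex_ofReal, hd0]
      simp
    simp only [hl, integral_const] at hsw
    rw [integral_smul, smul_zero] at hsw
    have hvol : (volume.restrict (Ioo (-1 : ℝ) 1)).real univ = 2 := by
      simp [measureReal_def]; norm_num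
    rw [hvol] at hsw
    have h0 : scalarCoeff (fun p => (d p : ℂ)) k = 0 := by
      rw [scalarCoeff_eq]
      have := (smul_eq_zero.1 hsw.symm).resolve_left (two_ne_zero (α := ℝ))
      rw [this, mul_zero]
    rw [h0] at hcoef
    exact (mul_eq_zero.1 hcoef.symm).resolve_left Complex.I_ne_zero
  · ext i
    have h := scalarCoeff_reflPt (integrable_of_continuous (hci i)).1 k
    rw [fourierCoeff_apply, fourierCoeff_apply, ← h]
    simp only [reflPt, he]
  · have h := scalarCoeff_conj (fun p => ((v p i : ℝ) : ℂ)) (-k)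
    simp only [Complex.conj_ofReal, neg_neg] at h
    exact h

/-- The Fourier coefficients of an `L²` field as a square summable sequence. -/
noncomputable def coeffSeq (u : L2) : Ell2 := ⟨coeff u, memlp_coeff u⟩

theorem norm_coeffSeq_sub_sq (u v : L2) : ‖coeffSeq u - coeffSeq v‖ ^ 2 = 1 / 2 * ‖u - v‖ ^ 2 := by
  have h1 := hasSum_norm_sq (coeffSeq u - coeffSeq v)
  have h2 := hasSum_norm_coeff_sq (u - v)
  rw [coeff_sub] at h2
  exact h1.unique h2

theorem continuous_coeffSeq : Continuous coeffSeq := by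
  refine (LipschitzWith.of_dist_le_mul (K := 1) fun u v => ?_).continuous
  rw [dist_eq_norm, dist_eq_norm, NNReal.coe_one, one_mul]
  refine le_of_pow_le_pow_left₀ (n := 2) (by norm_num) (norm_nonneg _) ?_
  rw [norm_coeffSeq_sub_sq]
  nlinarith [sq_nonneg ‖u - v‖]

theorem admissible_of_mem_L2sol {u : L2} (hu : u ∈ L2sol) : Admissible (coeff u) := by
  have hcl : IsClosed (coeffSeq ⁻¹' (admSubmodule : Set Ell2)) :=
    isClosed_admSubmodule.preimage continuous_coeffSeq
  refine closure_minimal ?_ hcl hu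
  rintro w ⟨φ, hφ, hw⟩
  have : coeff w = fourierCoeff φ := by
    funext k
    ext i
    rw [coeff_apply, fourierCoeff_apply]
    exact congrFun (scalarCoeff_congr (hw.mono fun p hp => by simp only [hp])) k
  change Admissible (coeff w)
  rw [this]
  exact hφ.admissible

/-! ### Multipliers and the scale of the operator -/

/-- The bounded diagonal operator with entries `r k ∈ [-1,1]`. -/
noncomputable def multiplier (r : Freq → ℝ) (hr : ∀ k, |r k| ≤ 1) : Ell2 →L[ℝ] Ell2 :=
  have hle : ∀ (x : Ell2) k, ‖r k • x k‖ ^ 2 ≤ ‖x k‖ ^ 2 := fun x k =>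
    pow_le_pow_left₀ (norm_nonneg _) (by
      rw [norm_smul, Real.norm_eq_abs]
      exact mul_le_of_le_one_left (norm_nonneg _) (hr k)) 2
  have hm : ∀ x : Ell2, Memℓp (fun k => r k • x k) 2 := fun x =>
    memlp_two_iff.2 ((hasSum_norm_sq x).summable.of_nonneg_of_le (fun k => sq_nonneg _) (hle x))
  LinearMap.mkContinuous
    { toFun := fun x => ⟨fun k => r k • x k, hm x⟩
      map_add' := fun x y => by ext1; funext k; exact smul_add _ _ _
      map_smul' := fun c x => by ext1; funext k; exact smul_comm (r k) c (x k) } 1 fun x => by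
    rw [one_mul]
    refine le_of_pow_le_pow_left₀ (n := 2) (by norm_num) (norm_nonneg _) ?_
    exact hasSum_le (hle x) (hasSum_norm_sq (⟨fun k => r k • x k, hm x⟩ : Ell2)) (hasSum_norm_sq x)

/-- What the proof requires of the symbol of the operator `A`: it is nonnegative and symmetric, so
that the constraints are preserved, it dominates the convection, and its form domain consists of
weakly differentiable fields. -/
structure IsHyperviscous (a : Freq → ℝ) : Prop where
  nonneg : ∀ k, 0 ≤ a k
  reflZ : ∀ k, a (reflZ k) = a k
  neg : ∀ k, a (-k) = a k
  controls : ControlsConvection (quarterWeight a)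
  wave_sq_le : ∃ C, ∀ k j, wave k j ^ 2 ≤ C * (1 + a k)

theorem isHyperviscous_symbolFull {ν ε : ℝ} (hν : 0 ≤ ν) (hε : 0 < ε) :
    IsHyperviscous (symbolFull ν ε) where
  nonneg k := by unfold symbolFull; positivity
  reflZ k := by
    obtain ⟨h0, h1, h2⟩ := wave_reflZ k
    simp only [symbolFull, h0, h1, h2, neg_sq]
  neg k := by simp only [symbolFull, wave_neg, neg_sq]
  controls := controlsConvection_symbolFull hν hε
  wave_sq_le := by
    refine ⟨1 + 1 / ε, fun k j => ?_⟩
    set x := wave k 0 ^ 2 + wave k 1 ^ 2 + wave k 2 ^ 2 with hx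
    have hx0 : 0 ≤ x := by positivity
    have h1 : wave k j ^ 2 ≤ x := by
      have h0 := sq_nonneg (wave k 0)
      have h1 := sq_nonneg (wave k 1)
      have h2 := sq_nonneg (wave k 2)
      fin_cases j <;> simp only [hx, Fin.zero_eta, Fin.mk_one, Fin.reduceFinMk] <;> linarith
    have h2 : x ≤ 1 + x ^ (8 / 5 : ℝ) := by
      rcases le_total x 1 with h | h
      · have : 0 ≤ x ^ (8 / 5 : ℝ) := by positivity
        linarith
      · have := Real.rpow_le_rpow_of_exponent_le h (show (1 : ℝ) ≤ 8 / 5 by norm_num)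
        rw [Real.rpow_one] at this
        linarith
    have h3 : symbolFull ν ε k = ν * x + ε * x ^ (8 / 5 : ℝ) := rfl
    have h4 : 0 ≤ ν * x := by positivity
    have h5 : x ^ (8 / 5 : ℝ) ≤ 1 / ε * symbolFull ν ε k := by
      rw [h3, mul_add, ← mul_assoc (1 / ε) ε, one_div_mul_cancel hε.ne', one_mul]
      have : 0 ≤ 1 / ε * (ν * x) := by positivity
      linarith
    have h6 : 0 ≤ symbolFull ν ε k := by rw [h3]; positivity
    have h7 : 0 < 1 / ε := by positivity
    nlinarith

theorem isHyperviscous_symbolHoriz {ν ε : ℝ} (hν : 0 < ν) (hε : 0 < ε) :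
    IsHyperviscous (symbolHoriz ν ε) where
  nonneg k := by unfold symbolHoriz; positivity
  reflZ k := by
    obtain ⟨h0, h1, h2⟩ := wave_reflZ k
    simp only [symbolHoriz, h0, h1, h2, neg_sq]
  neg k := by simp only [symbolHoriz, wave_neg, neg_sq]
  controls := controlsConvection_symbolHoriz hν hε
  wave_sq_le := by
    refine ⟨1 / ν, fun k j => ?_⟩
    set x := wave k 0 ^ 2 + wave k 1 ^ 2 + wave k 2 ^ 2 with hx
    have h1 : wave k j ^ 2 ≤ x := by
      have h0 := sq_nonneg (wave k 0)
      have h1 := sq_nonneg (wave k 1)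
      have h2 := sq_nonneg (wave k 2)
      fin_cases j <;> simp only [hx, Fin.zero_eta, Fin.mk_one, Fin.reduceFinMk] <;> linarith
    have h3 : ν * x ≤ 1 + symbolHoriz ν ε k := by
      have : symbolHoriz ν ε k = ν * x + ε * (wave k 0 ^ 2 + wave k 1 ^ 2) ^ 2 := rfl
      have h4 : 0 ≤ ε * (wave k 0 ^ 2 + wave k 1 ^ 2) ^ 2 := by positivity
      linarith
    rw [one_div, ← div_eq_inv_mul, le_div_iff₀ hν]
    nlinarith

namespace IsHyperviscous

variable {a : Freq → ℝ} (ha : IsHyperviscous a)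
include ha

theorem one_le_quarterWeight (k : Freq) : 1 ≤ quarterWeight a k :=
  Real.one_le_rpow (by linarith [ha.nonneg k]) (by norm_num)

theorem quarterWeight_pow_four (k : Freq) : quarterWeight a k ^ 4 = 1 + a k := by
  have h0 : 0 ≤ 1 + a k := by linarith [ha.nonneg k]
  rw [quarterWeight, rpow_pow h0 4 (r := 1) (by norm_num), Real.rpow_one]

theorem rpow_half (k : Freq) : (1 + a k) ^ (1 / 2 : ℝ) = quarterWeight a k ^ 2 := by
  have h0 : 0 ≤ 1 + a k := by linarith [ha.nonneg k]
  rw [quarterWeight, rpow_pow h0 2 (r := 1 / 2) (by norm_num)]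

theorem rpow_neg_half (k : Freq) : (1 + a k) ^ (-1 / 2 : ℝ) = (quarterWeight a k ^ 2)⁻¹ := by
  have h0 : 0 ≤ 1 + a k := by linarith [ha.nonneg k]
  rw [neg_div, Real.rpow_neg h0, ha.rpow_half]

theorem quarterWeight_reflZ (k : Freq) : quarterWeight a (HPE.reflZ k) = quarterWeight a k := by
  rw [quarterWeight, quarterWeight, ha.reflZ]

theorem quarterWeight_neg (k : Freq) : quarterWeight a (-k) = quarterWeight a k := by
  rw [quarterWeight, quarterWeight, ha.neg]

theorem abs_inv_sq_le (k : Freq) : |(quarterWeight a k ^ 2)⁻¹| ≤ 1 := by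
  have h := ha.one_le_quarterWeight k
  rw [abs_of_nonneg (by positivity)]
  exact inv_le_one_of_one_le₀ (one_le_pow₀ h)

theorem sq_ne_zero (k : Freq) : quarterWeight a k ^ 2 ≠ 0 :=
  pow_ne_zero 2 (zero_lt_one.trans_le (ha.one_le_quarterWeight k)).ne'

theorem opPow_half : opPow (fun k => 1 + a k) (1 / 2) =
    fun c k => quarterWeight a k ^ 2 • c k := by
  funext c k; rw [opPow, ha.rpow_half]

theorem opPow_neg_half : opPow (fun k => 1 + a k) (-1 / 2) =
    fun c k => (quarterWeight a k ^ 2)⁻¹ • c k := by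
  funext c k; rw [opPow, ha.rpow_neg_half]

theorem mem_DA_half_iff {c : Freq → C2} : c ∈ DA a (1 / 2) ↔
    Memℓp (fun k => quarterWeight a k ^ 2 • c k) 2 ∧ Admissible c := by
  rw [DA, Set.mem_ofPred_eq, ha.opPow_half, admissible_iff]

theorem mem_DA_neg_half_iff {c : Freq → C2} : c ∈ DA a (-1 / 2) ↔
    Memℓp (fun k => (quarterWeight a k ^ 2)⁻¹ • c k) 2 ∧ Admissible c := by
  rw [DA, Set.mem_ofPred_eq, ha.opPow_neg_half, admissible_iff]

theorem toEll2_half (c : Freq → C2) : toEll2 a (1 / 2) c =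
    mkSeq fun k => quarterWeight a k ^ 2 • c k := by
  change mkSeq (opPow (fun k => 1 + a k) (1 / 2) c) = _
  rw [ha.opPow_half]

theorem toEll2_neg_half (c : Freq → C2) : toEll2 a (-1 / 2) c =
    mkSeq fun k => (quarterWeight a k ^ 2)⁻¹ • c k := by
  change mkSeq (opPow (fun k => 1 + a k) (-1 / 2) c) = _
  rw [ha.opPow_neg_half]

/-- The operator `(1 + A)^{-1/2}` on `ℓ²`. -/
noncomputable def invHalf : Ell2 →L[ℝ] Ell2 :=
  multiplier (fun k => (quarterWeight a k ^ 2)⁻¹) ha.abs_inv_sq_le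

theorem invHalf_apply (x : Ell2) (k : Freq) :
    ha.invHalf x k = (quarterWeight a k ^ 2)⁻¹ • x k := rfl

theorem toEll2_neg_half_of_eq {c : Freq → C2} {x : Ell2} (h : ∀ k, x k = c k) :
    toEll2 a (-1 / 2) c = ha.invHalf x := by
  have : (fun k => (quarterWeight a k ^ 2)⁻¹ • c k) = fun k => ha.invHalf x k := by
    funext k; rw [← h, ha.invHalf_apply]
  rw [ha.toEll2_neg_half, this, mkSeq_coe]

theorem memlp_wave_smul {c : Freq → C2} (h : Memℓp (fun k => quarterWeight a k ^ 2 • c k) 2)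
    (j : Fin 3) : Memℓp (fun k => (Complex.I * wave k j : ℂ) • c k) 2 := by
  obtain ⟨C, hC⟩ := ha.wave_sq_le
  rw [memlp_two_iff] at h ⊢
  refine (h.mul_left C).of_nonneg_of_le (fun k => by positivity) fun k => ?_
  rw [norm_smul, norm_smul, mul_pow, mul_pow, norm_mul, Complex.norm_I, one_mul, Complex.norm_real,
    Real.norm_eq_abs, sq_abs, norm_pow, ← pow_mul, Real.norm_eq_abs,
    abs_of_pos (zero_lt_one.trans_le (ha.one_le_quarterWeight k)), ha.quarterWeight_pow_four, ← mul_assoc]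
  gcongr
  exact hC k j

theorem admissible_smul {c : Freq → C2} (hc : Admissible c) :
    Admissible fun k => quarterWeight a k ^ 2 • c k :=
  hc.smul (fun k => by rw [ha.quarterWeight_reflZ]) fun k => by rw [ha.quarterWeight_neg]

theorem admissible_inv_smul {c : Freq → C2} (hc : Admissible c) :
    Admissible fun k => (quarterWeight a k ^ 2)⁻¹ • c k :=
  hc.smul (q := fun k => (quarterWeight a k ^ 2)⁻¹)
    (fun k => by rw [ha.quarterWeight_reflZ]) fun k => by rw [ha.quarterWeight_neg]

end IsHyperviscous

/-! ### The linear evolution preserves the constraints -/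

theorem modeSol_congr_ae {E : Type*} [NormedAddCommGroup E] [NormedSpace ℝ E] {α T : ℝ} {e₀ : E}
    {h h' : ℝ → E} (hh : ∀ᵐ s ∂volume.restrict (Ioo 0 T), h s = h' s) {t : ℝ} (ht : t ∈ Icc 0 T) :
    modeSol α e₀ h t = modeSol α e₀ h' t := by
  unfold modeSol
  rw [intervalIntegral.integral_of_le ht.1, intervalIntegral.integral_of_le ht.1,
    integral_Ioc_eq_integral_Ioo, integral_Ioc_eq_integral_Ioo]
  congr 2
  refine integral_congr_ae ?_
  filter_upwards [ae_restrict_of_ae_restrict_of_subset (Ioo_subset_Ioo_right ht.2) hh] with s hs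
  rw [hs]

theorem map_modeSol {E F : Type*} [NormedAddCommGroup E] [NormedSpace ℝ E] [CompleteSpace E]
    [NormedAddCommGroup F] [NormedSpace ℝ F] [CompleteSpace F] (L : E →L[ℝ] F) {α T : ℝ} {e₀ : E}
    {h : ℝ → E} (hh : IntegrableOn h (Ioc 0 T)) {t : ℝ} (ht : t ∈ Icc 0 T) :
    L (modeSol α e₀ h t) = modeSol α (L e₀) (fun s => L (h s)) t := by
  have hi : IntervalIntegrable (fun s => Real.exp (α * s) • h s) volume 0 t := by
    have h1 : IntervalIntegrable h volume 0 t :=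
      (intervalIntegrable_iff_integrableOn_Ioc_of_le ht.1).2 (hh.mono_set (Ioc_subset_Ioc_right ht.2))
    exact h1.continuousOn_smul (f := fun s => Real.exp (α * s)) (by fun_prop)
  unfold modeSol
  rw [map_smul, map_add, ← L.intervalIntegral_comp_comm hi]
  simp only [map_smul]

theorem modeSol_zero {E : Type*} [NormedAddCommGroup E] [NormedSpace ℝ E] (α t : ℝ) :
    modeSol α (0 : E) (fun _ => 0) t = 0 := by
  simp [modeSol]

theorem admissible_evolMode {q : Freq → ℝ} (hr : ∀ k, q (reflZ k) = q k) (hn : ∀ k, q (-k) = q k)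
    {T : ℝ} {u₀ : Ell2} (hu : Admissible u₀) {g : ℝ → Ell2}
    (hg : MemLp g 2 (volume.restrict (Ioo 0 T)))
    (hga : ∀ᵐ s ∂volume.restrict (Ioo 0 T), Admissible (g s)) {t : ℝ} (ht : t ∈ Icc 0 T) :
    Admissible (evolMode q u₀ g t) := by
  have hi : ∀ k, IntegrableOn (fun s => q k ^ 2 • g s k) (Ioc 0 T) := fun k =>
    (integrableOn_coord hg k).smul (q k ^ 2)
  refine ⟨fun k hk => ?_, fun k => ?_, fun k i => ?_⟩
  · let L : C2 →L[ℝ] ℂ := LinearMap.toContinuousLinearMap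
      { toFun := waveDot k
        map_add' := waveDot_add k
        map_smul' := fun r d => by rw [waveDot_smul]; rfl }
    change L (modeSol _ _ _ t) = 0
    rw [map_modeSol L (hi k) ht, show L (u₀ k) = 0 from hu.1 k hk,
      modeSol_congr_ae (h' := fun _ => 0) (hga.mono fun s hs => ?_) ht, modeSol_zero]
    change waveDot k (q k ^ 2 • g s k) = 0
    rw [waveDot_smul, hs.1 k hk, mul_zero]
  · unfold evolMode
    rw [hr, hu.2.1]
    exact modeSol_congr_ae (hga.mono fun s hs => by rw [hs.2.1]) ht
  · let L : C2 →L[ℝ] ℂ := (EuclideanSpace.proj (𝕜 := ℂ) i).restrictScalars ℝ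
    change L (modeSol _ _ _ t) = Complex.conjCLE (L (modeSol _ _ _ t))
    rw [map_modeSol L (hi (-k)) ht, ← ContinuousLinearEquiv.coe_coe, ← ContinuousLinearMap.comp_apply,
      map_modeSol _ (hi k) ht, hn]
    change modeSol _ (u₀ (-k) i) _ t = modeSol _ ((starRingEnd ℂ) (u₀ k i)) _ t
    rw [hu.2.2]
    refine modeSol_congr_ae (hga.mono fun s hs => ?_) ht
    change (q k ^ 2 • g s (-k)) i = (starRingEnd ℂ) ((q k ^ 2 • g s k) i)
    simp [hs.2.2]

/-- Integration by parts in time against a test function. -/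
theorem integral_deriv_smul_of_primitive {E : Type*} [NormedAddCommGroup E] [NormedSpace ℝ E]
    [CompleteSpace E] {T : ℝ} (hT : 0 ≤ T) {u ψ : ℝ → E} {u₀ : E} (hψ : IntegrableOn ψ (Ioc 0 T))
    (hu : ∀ t ∈ Icc 0 T, u t = u₀ + ∫ s in (0 : ℝ)..t, ψ s) {φ : ℝ → ℝ} (hφ : ContDiff ℝ ∞ φ)
    (hs : tsupport φ ⊆ Ioo 0 T) :
    ∫ t in Ioo 0 T, deriv φ t • u t = -∫ t in Ioo 0 T, φ t • ψ t := by
  have hout : ∀ t, t ∉ Ioo 0 T → φ t = 0 := fun t ht => image_eq_zero_of_notMem_tsupport fun h => ht (hs h)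
  have hd : Continuous (deriv φ) := hφ.continuous_deriv (by simp)
  have hprim : ∀ t ∈ Icc 0 T, φ t = 0 + ∫ s in (0 : ℝ)..t, deriv φ s := by
    intro t _
    rw [intervalIntegral.integral_deriv_eq_sub (fun x _ => hφ.differentiable (by simp) x)
      (hd.intervalIntegrable _ _), hout 0 (by simp)]
    ring
  have hc : ContinuousOn u (Icc 0 T) := continuousOn_add_primitive hψ hu
  have hI : IntegrableOn (deriv φ) (Ioc 0 T) := (hd.integrableOn_Icc).mono_set Ioc_subset_Icc_self
  have h := (bilin_add_primitive (ContinuousLinearMap.lsmul ℝ ℝ : ℝ →L[ℝ] E →L[ℝ] E) hI hψ hprim hu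
    T (right_mem_Icc.2 hT)).2
  simp only [ContinuousLinearMap.lsmul_apply, hout T (by simp), zero_smul, zero_add] at h
  have i1 : IntervalIntegrable (fun t => deriv φ t • u t) volume 0 T :=
    ContinuousOn.intervalIntegrable (by rw [uIcc_of_le hT]; exact hd.continuousOn.smul hc)
  have i2 : IntervalIntegrable (fun t => φ t • ψ t) volume 0 T :=
    ((intervalIntegrable_iff_integrableOn_Ioc_of_le hT).2 hψ).continuousOn_smul hφ.continuous.continuousOn
  rw [intervalIntegral.integral_add i1 i2, intervalIntegral.integral_of_le hT,
    intervalIntegral.integral_of_le hT, integral_Ioc_eq_integral_Ioo, integral_Ioc_eq_integral_Ioo] at h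
  exact eq_neg_of_add_eq_zero_left h.symm

/-! ### Strong solutions and the evolution of the modes -/

namespace IsHyperviscous

variable {a : Freq → ℝ} (ha : IsHyperviscous a) {T : ℝ}
include ha

theorem forcing_ae {f : ℝ → Freq → C2} (hf : MemL2 a (-1 / 2) T f) :
    ∀ᵐ t ∂volume.restrict (Ioo 0 T), Admissible (toEll2 a (-1 / 2) (f t)) ∧
      ∀ k, toEll2 a (-1 / 2) (f t) k = (quarterWeight a k ^ 2)⁻¹ • f t k := by
  filter_upwards [hf.1] with t ht
  rw [ha.mem_DA_neg_half_iff] at ht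
  have h : ∀ k, toEll2 a (-1 / 2) (f t) k = (quarterWeight a k ^ 2)⁻¹ • f t k := fun k => by
    rw [ha.toEll2_neg_half, mkSeq_apply ht.1]
  refine ⟨?_, h⟩
  rw [funext h]
  exact ha.admissible_inv_smul ht.2

theorem evol_eq_invHalf {u₀ : Ell2} {g : ℝ → Ell2} (hT : 0 ≤ T)
    (hg : MemLp g 2 (volume.restrict (Ioo 0 T))) :
    ∀ᵐ t ∂volume.restrict (Ioo 0 T), evol (quarterWeight a) u₀ g t =
      ha.invHalf (evolHalf (quarterWeight a) u₀ g t) := by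
  filter_upwards [evolHalf_ae (q := quarterWeight a) (u₀ := u₀) hT hg,
    ae_restrict_mem measurableSet_Ioo] with t h1 ht
  ext1
  funext k
  rw [evol_apply hg (Ioo_subset_Icc_self ht), ha.invHalf_apply, h1, inv_smul_smul₀ (ha.sq_ne_zero k)]

theorem memLp_evol {u₀ : Ell2} {g : ℝ → Ell2} (hT : 0 ≤ T)
    (hg : MemLp g 2 (volume.restrict (Ioo 0 T))) :
    MemLp (evol (quarterWeight a) u₀ g) 2 (volume.restrict (Ioo 0 T)) :=
  (memLp_congr_ae (ha.evol_eq_invHalf hT hg)).2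
    (ha.invHalf.comp_memLp' (memLp_evolHalf (q := quarterWeight a) (u₀ := u₀) hT hg).2.1)

/-- A field whose Fourier modes solve the linear equations with the forcing `f - n`, where `n` is
its own nonlinear term, is a strong solution. -/
theorem isStrongSolution_of_modes (hT : 0 < T) {v₀ : L2} (hv₀ : Admissible (coeff v₀))
    {f : ℝ → Freq → C2} (hf : MemL2 a (-1 / 2) T f) {n : ℝ → Ell2}
    (hn : MemLp n 2 (volume.restrict (Ioo 0 T)))
    (hna : ∀ᵐ t ∂volume.restrict (Ioo 0 T), Admissible (n t)) {v : ℝ → L2}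
    (hv : ∀ t ∈ Icc 0 T, coeff (v t) = evolMode (quarterWeight a) (coeffSeq v₀)
      (fun s => toEll2 a (-1 / 2) (f s) + (-1 : ℝ) • n s) t)
    (hnv : ∀ᵐ t ∂volume.restrict (Ioo 0 T), ∀ k,
      n t k = (quarterWeight a k ^ 2)⁻¹ • nonlin (v t) (v t) k) :
    IsStrongSolution a T v₀ f v := by
  set q := quarterWeight a with hq
  set u₀ := coeffSeq v₀ with hu₀
  set G : ℝ → Ell2 := fun s => toEll2 a (-1 / 2) (f s) + (-1 : ℝ) • n s with hGdef
  have hG : MemLp G 2 (volume.restrict (Ioo 0 T)) := hf.2.add (hn.const_smul (-1 : ℝ))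
  have hGa : ∀ᵐ s ∂volume.restrict (Ioo 0 T), Admissible (G s) := by
    filter_upwards [ha.forcing_ae hf, hna] with s h1 h2
    exact admSubmodule.add_mem (mem_admSubmodule.2 h1.1) (admSubmodule.smul_mem _ (mem_admSubmodule.2 h2))
  have hadm : ∀ t ∈ Icc 0 T, Admissible (coeff (v t)) := fun t ht => by
    rw [hv t ht]
    exact admissible_evolMode ha.quarterWeight_reflZ ha.quarterWeight_neg hv₀ hG hGa ht
  have hV := memLp_evolHalf (q := q) (u₀ := u₀) hT.le hG
  have hVae := evolHalf_ae (q := q) (u₀ := u₀) hT.le hG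
  have hE := ha.memLp_evol (u₀ := u₀) hT.le hG
  have hmem : ∀ᵐ t ∂volume.restrict (Ioo 0 T), t ∈ Icc 0 T :=
    (ae_restrict_mem measurableSet_Ioo).mono fun t ht => Ioo_subset_Icc_self ht
  have hW : ∀ t ∈ Icc 0 T, toEll2 a (-1 / 2) (coeff (v t)) = ha.invHalf (evol q u₀ G t) := fun t ht =>
    ha.toEll2_neg_half_of_eq fun k => by rw [hv t ht, evol_apply hG ht]
  set g : ℝ → Freq → C2 := fun t => f t - opPow a 1 (coeff (v t)) - nonlin (v t) (v t) with hg
  set H : ℝ → Ell2 := fun t => G t - evolHalf q u₀ G t + ha.invHalf (evol q u₀ G t) with hH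
  have hHmem : MemLp H 2 (volume.restrict (Ioo 0 T)) :=
    (hG.sub hV.2.1).add (ha.invHalf.comp_memLp' hE)
  -- the coordinates of `(1 + A)^{-1/2} ∂_t v`
  have hHk : ∀ᵐ t ∂volume.restrict (Ioo 0 T), ∀ k, H t k = (q k ^ 2)⁻¹ •
      (q k ^ 2 • G t k - (q k ^ 4 - 1) • evolMode q u₀ G t k) := by
    filter_upwards [hVae, hmem] with t h1 ht k
    change G t k - evolHalf q u₀ G t k + ha.invHalf (evol q u₀ G t) k = _
    rw [h1, ha.invHalf_apply, evol_apply hG ht, smul_sub, inv_smul_smul₀ (ha.sq_ne_zero k), smul_smul,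
      sub_add, ← sub_smul]
    congr 2
    have := ha.sq_ne_zero k
    rw [← hq] at this ⊢
    field_simp
  have hgk : ∀ᵐ t ∂volume.restrict (Ioo 0 T), ∀ k, g t k = q k ^ 2 • H t k := by
    filter_upwards [hHk, ha.forcing_ae hf, hnv, hmem] with t h1 h2 h3 ht k
    have e1 : G t k = (q k ^ 2)⁻¹ • f t k - (q k ^ 2)⁻¹ • nonlin (v t) (v t) k := by
      change toEll2 a (-1 / 2) (f t) k + (-1 : ℝ) • n t k = _
      rw [h2.2, h3, neg_smul, one_smul, sub_eq_add_neg]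
    have e2 : g t k = f t k - a k • coeff (v t) k - nonlin (v t) (v t) k := by
      simp only [hg, Pi.sub_apply, opPow, Real.rpow_one]
    rw [h1, smul_inv_smul₀ (ha.sq_ne_zero k), e1, ← smul_sub, smul_inv_smul₀ (ha.sq_ne_zero k), e2,
      hv t ht, ha.quarterWeight_pow_four, add_sub_cancel_left]
    abel
  have hgH : ∀ᵐ t ∂volume.restrict (Ioo 0 T), toEll2 a (-1 / 2) (g t) = H t := by
    filter_upwards [hgk] with t h1
    rw [ha.toEll2_neg_half, ← mkSeq_coe (H t)]
    congr 1
    funext k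
    rw [h1, inv_smul_smul₀ (ha.sq_ne_zero k)]
  refine ⟨⟨?_, ?_⟩, ⟨?_, ?_⟩, ⟨g, ⟨?_, ?_⟩, ?_, .of_forall fun t => by simp only [hg]; abel⟩, ?_⟩
  · filter_upwards [hV.1, hmem] with t h1 ht
    rw [ha.mem_DA_half_iff]
    exact ⟨by rw [hv t ht]; exact h1, hadm t ht⟩
  · refine (memLp_congr_ae ?_).2 hV.2.1
    filter_upwards [hmem] with t ht
    rw [ha.toEll2_half, hv t ht]
    rfl
  · filter_upwards [hmem] with t ht
    rw [ha.mem_DA_neg_half_iff]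
    exact ⟨lp.memℓp (ha.invHalf (coeffSeq (v t))), hadm t ht⟩
  · refine (memLp_congr_ae ?_).2 (ha.invHalf.comp_memLp' hE)
    filter_upwards [hmem] with t ht
    exact hW t ht
  · filter_upwards [hgk, hGa, hVae, hmem] with t h1 h2 h3 ht
    have hHa : H t ∈ admSubmodule := by
      refine admSubmodule.add_mem (admSubmodule.sub_mem (mem_admSubmodule.2 h2) ?_) ?_
      · rw [mem_admSubmodule, funext h3, ← hv t ht]
        exact ha.admissible_smul (hadm t ht)
      · rw [mem_admSubmodule, ← hW t ht, ha.toEll2_neg_half_of_eq (c := coeff (v t)) (x := coeffSeq (v t)) fun k => rfl]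
        exact ha.admissible_inv_smul (hadm t ht)
    rw [ha.mem_DA_neg_half_iff, funext h1]
    refine ⟨?_, ha.admissible_smul hHa⟩
    have : (fun k => (quarterWeight a k ^ 2)⁻¹ • q k ^ 2 • H t k) = fun k => H t k :=
      funext fun k => inv_smul_smul₀ (ha.sq_ne_zero k) _
    rw [this]
    exact lp.memℓp (H t)
  · exact (memLp_congr_ae hgH).2 hHmem
  · intro φ hφ hφc hφs
    have m1 : MemLp (deriv φ) 2 (volume.restrict (Ioo 0 T)) :=
      ((hφ.continuous_deriv (by simp)).memLp_of_hasCompactSupport hφc.deriv)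
    have m2 : MemLp φ 2 (volume.restrict (Ioo 0 T)) := hφ.continuous.memLp_of_hasCompactSupport hφc
    have i1 : Integrable (fun t => deriv φ t • ha.invHalf (evol q u₀ G t)) (volume.restrict (Ioo 0 T)) :=
      memLp_one_iff_integrable.1 ((ha.invHalf.comp_memLp' hE).smul (r := 1) m1)
    have i2 : Integrable (fun t => φ t • H t) (volume.restrict (Ioo 0 T)) :=
      memLp_one_iff_integrable.1 (hHmem.smul (r := 1) m2)
    have e1 : ∫ t in Ioo 0 T, deriv φ t • toEll2 a (-1 / 2) (coeff (v t)) =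
        ∫ t in Ioo 0 T, deriv φ t • ha.invHalf (evol q u₀ G t) :=
      integral_congr_ae (hmem.mono fun t ht => by simp only [hW t ht])
    have e2 : ∫ t in Ioo 0 T, φ t • toEll2 a (-1 / 2) (g t) = ∫ t in Ioo 0 T, φ t • H t :=
      integral_congr_ae (hgH.mono fun t ht => by simp only [ht])
    rw [e1, e2]
    ext1
    funext k
    have hGk := integrableOn_coord hG k
    have hci := fun k => integrableOn_coord hG k
    have hψ : IntegrableOn (fun s => q k ^ 2 • G s k - (q k ^ 4 - 1) • evolMode q u₀ G s k) (Ioc 0 T) :=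
      (hGk.smul (q k ^ 2)).sub
        (((continuousOn_evolMode hci k).integrableOn_Icc.mono_set Ioc_subset_Icc_self).smul (q k ^ 4 - 1))
    have h := integral_deriv_smul_of_primitive hT.le hψ (evolMode_eq hci k) hφ hφs
    set E : Ell2 →L[ℝ] C2 := lp.evalCLM ℝ (fun _ : Freq => C2) 2 k
    change E _ = -E _
    rw [← E.integral_comp_comm i1, ← E.integral_comp_comm i2]
    have e3 : ∫ t in Ioo 0 T, E (deriv φ t • ha.invHalf (evol q u₀ G t)) =
        (q k ^ 2)⁻¹ • ∫ t in Ioo 0 T, deriv φ t • evolMode q u₀ G t k := by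
      rw [← integral_smul]
      refine integral_congr_ae (hmem.mono fun t ht => ?_)
      change deriv φ t • ((q k ^ 2)⁻¹ • evol q u₀ G t k) = _
      rw [evol_apply hG ht, smul_comm]
    have e4 : ∫ t in Ioo 0 T, E (φ t • H t) = (q k ^ 2)⁻¹ • ∫ t in Ioo 0 T,
        φ t • (q k ^ 2 • G t k - (q k ^ 4 - 1) • evolMode q u₀ G t k) := by
      rw [← integral_smul]
      refine integral_congr_ae (hHk.mono fun t ht => ?_)
      change φ t • H t k = _
      rw [ht, smul_comm]
    rw [e3, e4, h, smul_neg]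
  · refine ⟨fun t => ha.invHalf (evol q u₀ G t),
      ha.invHalf.continuous.comp_continuousOn (continuousOn_evol hG), ?_, ?_⟩
    · filter_upwards [hmem] with t ht
      exact (hW t ht).symm
    · simp only [evol_zero hT.le hG]
      exact (ha.toEll2_neg_half_of_eq fun k => rfl).symm

end IsHyperviscous

/-! ### Uniqueness of strong solutions -/

namespace IsHyperviscous

variable {a : Freq → ℝ} (ha : IsHyperviscous a) {T : ℝ}
include ha

/-- The Fourier modes of a strong solution solve the linear equations with the forcing `f - n`,
where `n` is its own nonlinear term. -/
theorem modes_of_isStrongSolution (hT : 0 < T) {v₀ : L2} {f : ℝ → Freq → C2}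
    (hf : MemL2 a (-1 / 2) T f) {v : ℝ → L2} (hv : IsStrongSolution a T v₀ f v) :
    ∃ n : ℝ → Ell2, MemLp n 2 (volume.restrict (Ioo 0 T)) ∧
      (∀ᵐ t ∂volume.restrict (Ioo 0 T), ∀ k,
        n t k = (quarterWeight a k ^ 2)⁻¹ • nonlin (v t) (v t) k) ∧
      ∀ᵐ t ∂volume.restrict (Ioo 0 T), ∀ k, coeff (v t) k = evolMode (quarterWeight a) (coeffSeq v₀)
        (fun s => toEll2 a (-1 / 2) (f s) + (-1 : ℝ) • n s) t k := by
  obtain ⟨hhalf, hneg, ⟨g, hg, hgd, heq⟩, ⟨r, hr, hrae, hr0⟩⟩ := hv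
  set q := quarterWeight a with hq
  set F : ℝ → Ell2 := fun t => toEll2 a (-1 / 2) (f t) with hF
  set V : ℝ → Ell2 := fun t => toEll2 a (1 / 2) (coeff (v t)) with hV
  set W : ℝ → Ell2 := fun t => toEll2 a (-1 / 2) (coeff (v t)) with hW
  set H : ℝ → Ell2 := fun t => toEll2 a (-1 / 2) (g t) with hH
  have hFm : MemLp F 2 (volume.restrict (Ioo 0 T)) := hf.2
  have hVm : MemLp V 2 (volume.restrict (Ioo 0 T)) := hhalf.2
  have hWm : MemLp W 2 (volume.restrict (Ioo 0 T)) := hneg.2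
  have hHm : MemLp H 2 (volume.restrict (Ioo 0 T)) := hg.2
  have hVk : ∀ᵐ t ∂volume.restrict (Ioo 0 T), ∀ k, V t k = q k ^ 2 • coeff (v t) k := by
    filter_upwards [hhalf.1] with t ht k
    rw [ha.mem_DA_half_iff] at ht
    simp only [hV]
    rw [ha.toEll2_half, mkSeq_apply ht.1]
  have hWk : ∀ t k, W t k = (q k ^ 2)⁻¹ • coeff (v t) k := fun t k => by
    simp only [hW]
    rw [ha.toEll2_neg_half_of_eq (c := coeff (v t)) (x := coeffSeq (v t)) fun k => rfl]
    rfl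
  have hFk := ha.forcing_ae hf
  have hHk := ha.forcing_ae hg
  set n : ℝ → Ell2 := fun t => F t - V t + W t - H t with hn
  have hnm : MemLp n 2 (volume.restrict (Ioo 0 T)) := ((hFm.sub hVm).add hWm).sub hHm
  have hnk : ∀ᵐ t ∂volume.restrict (Ioo 0 T), ∀ k,
      n t k = (q k ^ 2)⁻¹ • nonlin (v t) (v t) k := by
    filter_upwards [hVk, hFk, hHk, heq] with t h1 h2 h3 h4 k
    have e1 : f t k = g t k + a k • coeff (v t) k + nonlin (v t) (v t) k := by
      rw [← h4]
      simp only [Pi.add_apply, opPow, Real.rpow_one]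
    have e2 : a k = q k ^ 2 * q k ^ 2 - 1 := by
      have := ha.quarterWeight_pow_four k
      rw [← hq] at this
      linear_combination -this
    have e3 : q k ^ 2 • coeff (v t) k =
        (q k ^ 2)⁻¹ • (q k ^ 2 * q k ^ 2) • coeff (v t) k := by
      rw [mul_smul, inv_smul_smul₀ (ha.sq_ne_zero k)]
    change F t k - V t k + W t k - H t k = _
    rw [h1, hWk, e3]
    simp only [hF, hH]
    rw [h2.2, h3.2, e1, e2, ← hq, ← smul_sub, ← smul_add, ← smul_sub, sub_smul, one_smul]
    congr 1
    abel
  refine ⟨n, hnm, hnk, ?_⟩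
  -- the continuous representative of the solution
  obtain ⟨e, he⟩ := exists_ae_eq_add_primitive hT (hWm.integrable (by norm_num))
    (hHm.integrable (by norm_num)) hgd
  have hHi : IntegrableOn H (Ioc 0 T) := by
    rw [integrableOn_Ioc_iff_integrableOn_Ioo]
    exact hHm.integrable (by norm_num)
  set y : ℝ → Ell2 := fun t => e + ∫ s in (0 : ℝ)..t, H s with hy
  have hyc : ContinuousOn y (Icc 0 T) := continuousOn_add_primitive hHi fun t _ => rfl
  have hre : EqOn r y (Icc 0 T) := by
    refine Measure.eqOn_Icc_of_ae_eq volume hT.ne ?_ hr hyc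
    rw [← Measure.restrict_congr_set Ioo_ae_eq_Icc]
    filter_upwards [hrae, he] with t h1 h2
    rw [h1]
    exact h2
  have he0 : e = ha.invHalf (coeffSeq v₀) := by
    have h1 := hre (left_mem_Icc.2 hT.le)
    simp only [hy, intervalIntegral.integral_same, add_zero] at h1
    rw [← h1, hr0]
    exact ha.toEll2_neg_half_of_eq fun k => rfl
  have hG : MemLp (fun s => F s + (-1 : ℝ) • n s) 2 (volume.restrict (Ioo 0 T)) :=
    hFm.add (hnm.const_smul (-1 : ℝ))
  have hGk := fun k => integrableOn_coord hG k
  have hmode : ∀ k, EqOn (fun t => q k ^ 2 • y t k)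
      (fun t => evolMode q (coeffSeq v₀) (fun s => F s + (-1 : ℝ) • n s) t k) (Icc 0 T) := by
    intro k
    set E : Ell2 →L[ℝ] C2 := lp.evalCLM ℝ (fun _ : Freq => C2) 2 k with hE
    have hα : 0 ≤ q k ^ 4 - 1 := by
      rw [hq, ha.quarterWeight_pow_four]
      linarith [ha.nonneg k]
    refine mode_unique hα ((hGk k).smul (q k ^ 2))
      (((E.continuous.comp_continuousOn hyc)).const_smul (q k ^ 2))
      (continuousOn_evolMode hGk k) (fun t ht => ?_) (evolMode_eq hGk k)
    have hHt : IntervalIntegrable H volume 0 t :=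
      (intervalIntegrable_iff_integrableOn_Ioc_of_le ht.1).2 (hHi.mono_set (Ioc_subset_Ioc_right ht.2))
    have h1 : y t k = (q k ^ 2)⁻¹ • coeffSeq v₀ k + ∫ s in (0 : ℝ)..t, H s k := by
      change E (e + ∫ s in (0 : ℝ)..t, H s) = _
      rw [map_add, ← E.intervalIntegral_comp_comm hHt, he0]
      rfl
    rw [h1, smul_add, smul_inv_smul₀ (ha.sq_ne_zero k), ← intervalIntegral.integral_smul,
      intervalIntegral.integral_of_le ht.1, intervalIntegral.integral_of_le ht.1,
      integral_Ioc_eq_integral_Ioo, integral_Ioc_eq_integral_Ioo]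
    congr 1
    refine integral_congr_ae ?_
    refine ae_restrict_of_ae_restrict_of_subset (Ioo_subset_Ioo_right ht.2) ?_
    filter_upwards [hVk, he] with s h2 h3
    have e1 : y s k = (q k ^ 2)⁻¹ • coeff (v s) k := by rw [← hWk, h3]
    have e2 : (F s + (-1 : ℝ) • n s) k = H s k + V s k - W s k := by
      change F s k + (-1 : ℝ) • (F s k - V s k + W s k - H s k) = _
      rw [neg_smul, one_smul]
      abel
    change q k ^ 2 • H s k = q k ^ 2 • (F s + (-1 : ℝ) • n s) k - (q k ^ 4 - 1) • q k ^ 2 • y s k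
    rw [e1, e2, h2, hWk, smul_inv_smul₀ (ha.sq_ne_zero k), smul_sub, smul_add,
      smul_inv_smul₀ (ha.sq_ne_zero k), smul_smul, sub_smul, one_smul, ← pow_add]
    abel
  filter_upwards [he, ae_restrict_mem measurableSet_Ioo] with t h1 ht k
  have h2 := hmode k (Ioo_subset_Icc_self ht)
  refine Eq.trans ?_ h2
  change coeff (v t) k = q k ^ 2 • (e + ∫ s in (0 : ℝ)..t, H s) k
  rw [← h1, hWk, smul_inv_smul₀ (ha.sq_ne_zero k)]

/-- The nonlinear operator in the variable `X = (1 + A)^{1/4} v` is the convection term. -/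
theorem operator_eq_nonlin {N : Ell2 →L[ℝ] Ell2 →L[ℝ] Ell2}
    (hN : ∀ X : Ell2, Admissible X → ∀ m, N X X m = (quarterWeight a m ^ 2)⁻¹ •
      hydroProj (transport (fun k => (quarterWeight a k)⁻¹ • X k)
        (fun k => (quarterWeight a k)⁻¹ • X k)) m)
    {v : L2} (hv : coeff v ∈ DA a (1 / 2)) {X : Ell2} (hX : ∀ k, X k = quarterWeight a k • coeff v k)
    (m : Freq) : N X X m = (quarterWeight a m ^ 2)⁻¹ • nonlin v v m := by
  obtain ⟨h1, h2⟩ := ha.mem_DA_half_iff.1 hv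
  have hXa : Admissible X := by
    rw [funext hX]
    exact h2.smul ha.quarterWeight_reflZ ha.quarterWeight_neg
  have h3 : (fun k => (quarterWeight a k)⁻¹ • X k) = coeff v := by
    funext k
    rw [hX, inv_smul_smul₀ (zero_lt_one.trans_le (ha.one_le_quarterWeight k)).ne']
  rw [hN X hXa, h3, nonlin_eq h2 (ha.memlp_wave_smul h1)]

/-! ### The energy equality -/

theorem normSq_opPow_half {c : Freq → C2} {u V : Ell2} (hu : ∀ k, u k = c k)
    (hV : ∀ k, V k = quarterWeight a k ^ 2 • c k) :
    normSq (opPow a (1 / 2) c) = 2 * (‖V‖ ^ 2 - ‖u‖ ^ 2) := by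
  have h := (hasSum_norm_sq V).sub (hasSum_norm_sq u)
  rw [normSq, ← h.tsum_eq]
  congr 1
  refine tsum_congr fun k => ?_
  have h1 : (a k ^ (1 / 2 : ℝ)) ^ 2 = a k := by
    rw [rpow_pow (ha.nonneg k) 2 (r := 1) (by norm_num), Real.rpow_one]
  have h2 : (quarterWeight a k ^ 2) ^ 2 = 1 + a k := by
    rw [← pow_mul, ha.quarterWeight_pow_four]
  rw [opPow, hV, hu, norm_smul, norm_smul, mul_pow, mul_pow, Real.norm_eq_abs, sq_abs, h1,
    Real.norm_eq_abs, sq_abs, h2]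
  ring

theorem pairing_eq {c d : Freq → C2} {F V : Ell2} (hF : ∀ k, F k = (quarterWeight a k ^ 2)⁻¹ • d k)
    (hV : ∀ k, V k = quarterWeight a k ^ 2 • c k) : pairing d c = 2 * inner ℝ F V := by
  rw [pairing, lp.inner_eq_tsum]
  congr 1
  refine tsum_congr fun k => ?_
  rw [hF, hV, real_inner_smul_left, real_inner_smul_right, inv_mul_cancel_left₀ (ha.sq_ne_zero k),
    real_inner_C2, EuclideanSpace.inner_eq_star_dotProduct]
  simp only [dotProduct, Complex.re_sum]
  refine Finset.sum_congr rfl fun i _ => ?_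
  simp

/-- Twice the energy equality in `ℓ²`, since `|Ω| = 2`. -/
theorem energy_equality (hT : 0 < T) {f : ℝ → Freq → C2} (hf : MemL2 a (-1 / 2) T f)
    {v : ℝ → L2} {u₀ : Ell2} {n : ℝ → Ell2}
    (hn : MemLp n 2 (volume.restrict (Ioo 0 T)))
    (hv : ∀ t ∈ Icc 0 T, coeff (v t) = evolMode (quarterWeight a) u₀
      (fun s => toEll2 a (-1 / 2) (f s) + (-1 : ℝ) • n s) t)
    (hwork : ∀ᵐ t ∂volume.restrict (Ioo 0 T), inner ℝ (n t) (evolHalf (quarterWeight a) u₀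
      (fun s => toEll2 a (-1 / 2) (f s) + (-1 : ℝ) • n s) t) = 0) {t : ℝ} (ht : t ∈ Ioc 0 T) :
    ‖v t‖ ^ 2 + 2 * ∫ s in (0 : ℝ)..t, normSq (opPow a (1 / 2) (coeff (v s))) =
      ‖v 0‖ ^ 2 + 2 * ∫ s in (0 : ℝ)..t, pairing (f s) (coeff (v s)) := by
  set q := quarterWeight a with hq
  set G : ℝ → Ell2 := fun s => toEll2 a (-1 / 2) (f s) + (-1 : ℝ) • n s with hGdef
  have hG : MemLp G 2 (volume.restrict (Ioo 0 T)) := hf.2.add (hn.const_smul (-1 : ℝ))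
  have htc : t ∈ Icc 0 T := Ioc_subset_Icc_self ht
  have hsub : Ioo 0 t ⊆ Ioo 0 T := Ioo_subset_Ioo_right ht.2
  have hVm := (memLp_evolHalf (q := q) (u₀ := u₀) hT.le hG).2.1
  have hEm := ha.memLp_evol (u₀ := u₀) hT.le hG
  have hev : ∀ s ∈ Icc 0 T, ∀ k, evol q u₀ G s k = coeff (v s) k := fun s hs k => by
    rw [evol_apply hG hs, hv s hs]
  have hVk : ∀ᵐ s ∂volume.restrict (Ioo 0 T), ∀ k, evolHalf q u₀ G s k = q k ^ 2 • coeff (v s) k := by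
    filter_upwards [evolHalf_ae (q := q) (u₀ := u₀) hT.le hG, ae_restrict_mem measurableSet_Ioo]
      with s h1 hs k
    rw [h1, hv s (Ioo_subset_Icc_self hs)]
  have hnorm : ∀ s ∈ Icc 0 T, ‖v s‖ ^ 2 = 2 * ‖evol q u₀ G s‖ ^ 2 := fun s hs => by
    have h1 := hasSum_norm_sq (evol q u₀ G s)
    simp only [hev s hs] at h1
    linarith [h1.unique (hasSum_norm_coeff_sq (v s))]
  have hV2 : IntegrableOn (fun s => ‖evolHalf q u₀ G s‖ ^ 2) (Ioo 0 t) :=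
    (hVm.integrable_norm_pow (by norm_num)).mono_measure (Measure.restrict_mono_set _ hsub)
  have hE2 : IntegrableOn (fun s => ‖evol q u₀ G s‖ ^ 2) (Ioo 0 t) :=
    (hEm.integrable_norm_pow (by norm_num)).mono_measure (Measure.restrict_mono_set _ hsub)
  have e1 : ∫ s in (0 : ℝ)..t, normSq (opPow a (1 / 2) (coeff (v s))) =
      2 * ((∫ s in Ioo 0 t, ‖evolHalf q u₀ G s‖ ^ 2) - ∫ s in Ioo 0 t, ‖evol q u₀ G s‖ ^ 2) := by
    rw [intervalIntegral.integral_of_le ht.1.le, integral_Ioc_eq_integral_Ioo,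
      ← integral_sub hV2 hE2, ← integral_const_mul]
    refine integral_congr_ae (ae_restrict_of_ae_restrict_of_subset hsub ?_)
    filter_upwards [hVk, ae_restrict_mem measurableSet_Ioo] with s h1 hs
    exact ha.normSq_opPow_half (hev s (Ioo_subset_Icc_self hs)) h1
  have e2 : ∫ s in (0 : ℝ)..t, pairing (f s) (coeff (v s)) =
      2 * ∫ s in Ioo 0 t, inner ℝ (G s) (evolHalf q u₀ G s) := by
    rw [intervalIntegral.integral_of_le ht.1.le, integral_Ioc_eq_integral_Ioo, ← integral_const_mul]
    refine integral_congr_ae (ae_restrict_of_ae_restrict_of_subset hsub ?_)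
    filter_upwards [hVk, ha.forcing_ae hf, hwork] with s h1 h2 h3
    rw [ha.pairing_eq h2.2 h1]
    simp only [hGdef]
    rw [inner_add_left, real_inner_smul_left, h3, mul_zero, add_zero]
  have h := evol_energy (q := q) (u₀ := u₀) hG htc
  have h0 := hnorm 0 (left_mem_Icc.2 hT.le)
  rw [evol_zero hT.le hG] at h0
  rw [e1, e2, hnorm t htc, h0]
  linarith

end IsHyperviscous

/-! ### Well-posedness -/

theorem continuousOn_of_coeff {s : Set ℝ} {v : ℝ → L2} {u : ℝ → Ell2} (hu : ContinuousOn u s)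
    (h : ∀ t ∈ s, coeffSeq (v t) = u t) : ContinuousOn v s := by
  intro t ht
  have h1 := tendsto_iff_norm_sub_tendsto_zero.1 (hu t ht)
  refine tendsto_iff_norm_sub_tendsto_zero.2 ?_
  have h2 := h1.const_mul (√2)
  rw [mul_zero] at h2
  refine h2.congr' ?_
  filter_upwards [self_mem_nhdsWithin] with r hr
  have h3 := norm_coeffSeq_sub_sq (v r) (v t)
  rw [h r hr, h t ht] at h3
  have h4 : ‖v r - v t‖ ^ 2 = (√2 * ‖u r - u t‖) ^ 2 := by
    rw [mul_pow, Real.sq_sqrt (by norm_num), h3]; ring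
  exact ((pow_left_inj₀ (norm_nonneg _) (by positivity) two_ne_zero).1 h4).symm

theorem IsHyperviscous.exists_unique_isStrongSolution {a : Freq → ℝ} (ha : IsHyperviscous a) {T : ℝ}
    (hT : 0 < T) {v₀ : L2} (hv₀ : v₀ ∈ L2sol) {f : ℝ → Freq → C2} (hf : MemL2 a (-1 / 2) T f) :
    ∃ v : ℝ → L2, IsStrongSolution a T v₀ f v ∧
      (∀ v' : ℝ → L2, IsStrongSolution a T v₀ f v' →
        ∀ᵐ t ∂volume.restrict (Ioo 0 T), v' t = v t) ∧
      ContinuousOn v (Icc 0 T) ∧ v 0 = v₀ ∧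
      ∀ t ∈ Ioc 0 T,
        ‖v t‖ ^ 2 + 2 * ∫ s in (0 : ℝ)..t, normSq (opPow a (1 / 2) (coeff (v s))) =
          ‖v 0‖ ^ 2 + 2 * ∫ s in (0 : ℝ)..t, pairing (f s) (coeff (v s)) := by
  have hadm₀ := admissible_of_mem_L2sol hv₀
  obtain ⟨N, hN0, hNa, hN⟩ := exists_nonlinear_operator ha.one_le_quarterWeight ha.controls
    ha.quarterWeight_reflZ ha.quarterWeight_neg
  obtain ⟨n, hn, hneq, huniq⟩ := exists_unique_nonlinear_term (q := quarterWeight a) N hT.le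
    (coeffSeq v₀) hf.2 hN0
  have hG : MemLp (fun s => toEll2 a (-1 / 2) (f s) + (-1 : ℝ) • n s) 2 (volume.restrict (Ioo 0 T)) :=
    hf.2.add (hn.const_smul (-1 : ℝ))
  have hna : ∀ᵐ t ∂volume.restrict (Ioo 0 T), Admissible (n t) :=
    hneq.mono fun t ht => by rw [ht]; exact hNa _ _
  have hGa : ∀ᵐ s ∂volume.restrict (Ioo 0 T),
      Admissible (toEll2 a (-1 / 2) (f s) + (-1 : ℝ) • n s : Ell2) := by
    filter_upwards [ha.forcing_ae hf, hna] with s h1 h2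
    exact admSubmodule.add_mem (mem_admSubmodule.2 h1.1) (admSubmodule.smul_mem _ (mem_admSubmodule.2 h2))
  have hadm : ∀ t ∈ Icc 0 T, Admissible (evolMode (quarterWeight a) (coeffSeq v₀)
      (fun s => toEll2 a (-1 / 2) (f s) + (-1 : ℝ) • n s) t) := fun t ht =>
    admissible_evolMode ha.quarterWeight_reflZ ha.quarterWeight_neg hadm₀ hG hGa ht
  have hex : ∀ t, ∃ w : L2, t ∈ Icc 0 T → coeff w = evolMode (quarterWeight a) (coeffSeq v₀)
      (fun s => toEll2 a (-1 / 2) (f s) + (-1 : ℝ) • n s) t := by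
    intro t
    by_cases ht : t ∈ Icc 0 T
    · obtain ⟨w, hw⟩ := exists_coeff_eq (memlp_evolMode (q := quarterWeight a) (u₀ := coeffSeq v₀) hG ht)
        (hadm t ht).2.2
      exact ⟨w, fun _ => hw⟩
    · exact ⟨0, fun h => absurd h ht⟩
  choose v hv using hex
  have hmem : ∀ᵐ t ∂volume.restrict (Ioo 0 T), t ∈ Icc 0 T :=
    (ae_restrict_mem measurableSet_Ioo).mono fun t ht => Ioo_subset_Icc_self ht
  have hQ := evolQuarter_ae (q := quarterWeight a) (u₀ := coeffSeq v₀) hT.le hG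
  have hV := memLp_evolHalf (q := quarterWeight a) (u₀ := coeffSeq v₀) hT.le hG
  have hVk := evolHalf_ae (q := quarterWeight a) (u₀ := coeffSeq v₀) hT.le hG
  have hnv : ∀ᵐ t ∂volume.restrict (Ioo 0 T), ∀ k,
      n t k = (quarterWeight a k ^ 2)⁻¹ • nonlin (v t) (v t) k := by
    filter_upwards [hneq, hQ, hV.1, hmem] with t h1 h2 h3 ht k
    rw [h1]
    refine ha.operator_eq_nonlin hN (ha.mem_DA_half_iff.2 ⟨?_, ?_⟩) (fun k => ?_) k
    · rw [hv t ht]; exact h3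
    · rw [hv t ht]; exact hadm t ht
    · rw [hv t ht]; exact h2.1 k
  have hwork : ∀ᵐ t ∂volume.restrict (Ioo 0 T), inner ℝ (n t) (evolHalf (quarterWeight a) (coeffSeq v₀)
      (fun s => toEll2 a (-1 / 2) (f s) + (-1 : ℝ) • n s) t) = 0 := by
    filter_upwards [hneq, hQ, hVk] with t h1 h2 h3
    rw [h1]
    exact hN0 _ _ fun k => by rw [h3, h2.1, smul_smul, sq]
  refine ⟨v, ha.isStrongSolution_of_modes hT hadm₀ hf hn hna hv hnv, ?_, ?_, ?_,
    fun t ht => ha.energy_equality hT hf hn hv hwork ht⟩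
  · intro v' hv'
    obtain ⟨n', hn', hnv', hmode⟩ := ha.modes_of_isStrongSolution hT hf hv'
    have hG' : MemLp (fun s => toEll2 a (-1 / 2) (f s) + (-1 : ℝ) • n' s) 2
        (volume.restrict (Ioo 0 T)) := hf.2.add (hn'.const_smul (-1 : ℝ))
    have hnn : n' =ᵐ[volume.restrict (Ioo 0 T)] n := by
      refine huniq n' hn' ?_
      filter_upwards [hnv', hmode, hv'.memL2_half.1,
        evolQuarter_ae (q := quarterWeight a) (u₀ := coeffSeq v₀) hT.le hG'] with t h1 h2 h3 h4
      ext1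
      funext k
      rw [h1]
      exact (ha.operator_eq_nonlin hN h3 (fun k => by rw [h4.1, h2]) k).symm
    have hGG : ∀ᵐ s ∂volume.restrict (Ioo 0 T), toEll2 a (-1 / 2) (f s) + (-1 : ℝ) • n' s =
        toEll2 a (-1 / 2) (f s) + (-1 : ℝ) • n s := hnn.mono fun s hs => by rw [hs]
    filter_upwards [hmode, hmem] with t h1 ht
    refine coeff_injective ?_
    rw [hv t ht, funext h1, evolMode_congr hGG ht]
  · refine continuousOn_of_coeff (continuousOn_evol (q := quarterWeight a) (u₀ := coeffSeq v₀) hG)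
      fun t ht => ?_
    ext1
    funext k
    rw [evol_apply hG ht]
    exact congrFun (hv t ht) k
  · have h0 := left_mem_Icc.2 hT.le
    refine coeff_injective (funext fun k => ?_)
    rw [hv 0 h0, ← evol_apply hG h0, evol_zero hT.le hG]
    rfl

end HPE

theorem proposition4p7 (ν ε T : ℝ) (hε : 0 < ε) (hT : 0 < T) (a : HPE.Freq → ℝ)
    (ha : (0 ≤ ν ∧ a = HPE.symbolFull ν ε) ∨ (0 < ν ∧ a = HPE.symbolHoriz ν ε))
    (v₀ : HPE.L2) (hv₀ : v₀ ∈ HPE.L2sol)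
    (f : ℝ → HPE.Freq → HPE.C2) (hf : HPE.MemL2 a (-1 / 2) T f) :
    ∃ v : ℝ → HPE.L2,
      HPE.IsStrongSolution a T v₀ f v ∧
      (∀ v' : ℝ → HPE.L2, HPE.IsStrongSolution a T v₀ f v' →
        ∀ᵐ t ∂MeasureTheory.volume.restrict (Set.Ioo 0 T), v' t = v t) ∧
      ContinuousOn v (Set.Icc 0 T) ∧ v 0 = v₀ ∧
      ∀ t ∈ Set.Ioc 0 T,
        ‖v t‖ ^ 2 + 2 * ∫ s in (0 : ℝ)..t, HPE.normSq (HPE.opPow a (1 / 2) (HPE.coeff (v s))) =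
          ‖v 0‖ ^ 2 + 2 * ∫ s in (0 : ℝ)..t, HPE.pairing (f s) (HPE.coeff (v s)) := by
  rcases ha with ⟨hν, rfl⟩ | ⟨hν, rfl⟩
  · exact (HPE.isHyperviscous_symbolFull hν hε).exists_unique_isStrongSolution hT hv₀ hf
  · exact (HPE.isHyperviscous_symbolHoriz hν hε).exists_unique_isStrongSolution hT hv₀ hf
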